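/- Let $\eta=\mathrm{diag}(-1,1,1,1)$ be the Minkowski metric on $\mathbb R^4$ (used to raise and lower indices), and let $\epsilon^{abcd}$ be totally antisymmetric with $\epsilon^{0123}=1$. Let $F$ be the on-shell minimal model of the BRST complex of conformal gravity in dimension $n=4$. It is the graded manifold with coordinates $\xi^a,\ \rho_{ab}=-\rho_{ba},\ \kappa_b,\ \lambda$ of ghost degree $1$ and, in ghost degree $0$, the overcomplete coordinates $W_{abcd|e_1\dots e_k}$ ($k\ge 0$): a Weyl tensor and its covariant derivatives. Functions and forms are taken polynomial in the coordinates. Put $D_eW_{abcd|e_1\dots e_k}=W_{abcd|e_1\dots e_ke}$, $C_{bcd}=W^a{}_{bcd|a}$, $C_{bcd|e}=W^a{}_{bcd|ae}$, and let $\Gamma^j$ be the derivation with $\Gamma^jW_{abcd}=0$ and, for $T=W_{i_1\dots i_4|i_5\dots i_{k+4}}$, $$\Gamma^jD_eT=D_e\Gamma^jT-(k+2)\delta^j_eT+\sum_s\big(\eta_{ei_s}T_{\dots}{}^{j}{}_{\dots}-\delta^j_{i_s}T_{\dots e\dots}\big),$$ where $j$, resp. $e$, stands in the slot $s$. The $W$-coordinates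 are subject to: - the antisymmetries $W_{abcd}=-W_{bacd}=-W_{abdc}$, the identity $W_{a[bcd]}=0$, and $W^a{}_{bad}=0$; - the Bianchi identities $W_{abcd|e}+W_{abde|c}+W_{abec|d}=\eta_{ae}C_{bcd}+\eta_{ac}C_{bde}+\eta_{ad}C_{bec}-(a\leftrightarrow b)$ and $C_{bcd|e}+C_{bde|c}+C_{bec|d}=0$; - the commutation relations $[D_c,D_d]T=-C_{bcd}\Gamma^bT-\sum_sW_{i_s}{}^m{}_{cd}\,T_{\dots m\dots}$; - the Bach equation $C_{abc|}{}^b=0$; - everything obtained from these by applying $D_e$ and $\Gamma^j$. The vector field $q$ on $F$ is $$q\xi^a=\rho^a{}_c\xi^c+\xi^a\lambda,\qquad q\rho^a{}_b=\rho^a{}_c\rho^c{}_b+\xi^a\kappa_b-\xi_b\kappa^a+\tfrac12\xi^c\xi^dW^a{}_{bcd},$$ $$q\kappa_b=\kappa_c\rho^c{}_b+\lambda\kappa_b+\tfrac12\xi^c\xi^dC_{bcd},\qquad q\lambda=\kappa_c\xi^c,$$ $$qT=\xi^eD_eT+\sum_s\rho_{i_s}{}^mT_{\dots m\dots}+(k+2)\lambda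 T+\kappa_j\Gamma^jT .$$ Forms on $F$ are graded commutative with respect to the total degree (form degree plus ghost degree), $d$ is the de Rham differential, $i_q$ is the contraction with $q$ (an even derivation), and $L_q=i_qd-d\,i_q$. Consider the $2$-form $$\omega=\omega_W-2\omega_C,\qquad \omega_W=d(\rho_{ab})\,d\big(W^{abnm}\epsilon_{nmpk}\xi^p\xi^k\big),\qquad \omega_C=d(\xi_a)\,d\big(C^a{}_{bc}\epsilon^{bcpk}\xi_p\xi_k\big).$$ **Proposition.** $q$ is a homological vector field of ghost degree $1$ on $F$ (that is, $L_q$ raises the ghost degree by one, preserves the form degree, and $L_q^2=0$), and $\omega$ is a $2$-form of ghost degree $n-1=3$ with $d\omega=0$ and $L_q\omega=0$; hence $(F,q,\omega)$ is the target of a presymplectic AKSZ model. Moreover $i_q\omega=d\mathcal L$ with $$\mathcal L=\big(\rho_{al}\rho^l{}_b+2\xi_a\kappa_b+\tfrac14W_{abij}\xi^i\xi^j\big)W^{abnm}\epsilon_{nmpk}\xi^p\xi^k-2\big(\rho_{an}\xi^n+\xi_a\lambda\big)C^a{}_{bc}\epsilon^{bcpk}\xi_p\xi_k .$$ -/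

import Mathlib

/-!
# The on-shell minimal model of the BRST complex of 4d conformal gravity

`Forms` is the algebra of (polynomial) differential forms on the graded manifold `F` with degree-one
coordinates `ξ^a`, `ρ_{ab} = -ρ_{ba}`, `κ_b`, `λ` and, in degree zero, the Weyl tensor `W_{abcd}`
together with its covariant derivatives `W_{abcd|e₁…e_k}`.  The latter form an overcomplete system
of coordinates, subject to the algebraic symmetries of the Weyl tensor, the Bianchi identities,
the commutation relations of covariant derivatives, the Bach equation `C_{abc|}{}^b = 0`, and all
differential consequences of these.

Signs: forms are graded commutative with respect to the total degree (form degree plus ghost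
degree); `d` is a left derivation of total degree `1`, and `i_q` is one of total degree `0`.
-/

noncomputable section

namespace ConformalGravity

/-! ## Coordinates -/

/-- The coordinates: `xi a = ξ^a`, `rho a b = ρ_{ab}`, `kappa b = κ_b`, `lam = λ`, and
`weyl k ![a, b, c, d, e₁, …, e_k] = W_{abcd|e₁…e_k}` (all indices down). -/
inductive Coord : Type
  | xi (a : Fin 4)
  | rho (a b : Fin 4)
  | kappa (b : Fin 4)
  | lam
  | weyl (k : ℕ) (i : Fin (4 + k) → Fin 4)

/-- Ghost degree of a coordinate. -/
def Coord.gh : Coord → ℕ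
  | .weyl _ _ => 0
  | _ => 1

/-- Generators of the algebra of forms: a coordinate `x` or its differential `dx`. -/
inductive Gen : Type
  | fn (x : Coord)
  | diff (x : Coord)

/-- Ghost degree of a generator. -/
def Gen.gh : Gen → ℕ
  | .fn x => x.gh
  | .diff x => x.gh

/-- Form degree of a generator. -/
def Gen.formDeg : Gen → ℕ
  | .fn _ => 0
  | .diff _ => 1

/-- Total degree of a generator. -/
def Gen.deg (x : Gen) : ℕ := x.formDeg + x.gh

/-- The free associative algebra on the generators, of which `Forms` below is a quotient. -/
abbrev Pre : Type := FreeAlgebra ℝ Gen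

/-- A coordinate as an element of `Pre`. -/
def fn (x : Coord) : Pre := FreeAlgebra.ι ℝ (Gen.fn x)

/-- The differential of a coordinate as an element of `Pre`. -/
def diff (x : Coord) : Pre := FreeAlgebra.ι ℝ (Gen.diff x)

/-! ## Derivations of the free algebra -/

/-- The parity automorphism, `x ↦ (-1)^{deg x} x`. -/
def parity : Pre →ₐ[ℝ] Pre :=
  FreeAlgebra.lift ℝ fun x => ((-1 : ℝ) ^ x.deg) • FreeAlgebra.ι ℝ x

/-- Auxiliary homomorphism `z ↦ [[σ z, D z], [0, z]]` for the twisted derivation `D` below. -/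
def twistedHom (σ : Pre →ₐ[ℝ] Pre) (f : Gen → Pre) : Pre →ₐ[ℝ] Matrix (Fin 2) (Fin 2) Pre :=
  FreeAlgebra.lift ℝ fun x => !![σ (FreeAlgebra.ι ℝ x), f x; 0, FreeAlgebra.ι ℝ x]

/-- The unique linear map `D` with `D x = f x` on generators and `D (z w) = D z w + σ z D w`. -/
def twistedDer (σ : Pre →ₐ[ℝ] Pre) (f : Gen → Pre) : Pre →ₗ[ℝ] Pre :=
  (Matrix.entryLinearMap ℝ Pre 0 1).comp (twistedHom σ f).toLinearMap

/-- The even derivation of `Pre` with given values on generators. -/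
def evenDer (f : Gen → Pre) : Pre →ₗ[ℝ] Pre := twistedDer (AlgHom.id ℝ Pre) f

/-- The odd (left) derivation of `Pre` with given values on generators. -/
def oddDer (f : Gen → Pre) : Pre →ₗ[ℝ] Pre := twistedDer parity f

theorem twistedDer_gen (σ : Pre →ₐ[ℝ] Pre) (f : Gen → Pre) (x : Gen) :
    twistedDer σ f (FreeAlgebra.ι ℝ x) = f x := by
  simp [twistedDer, twistedHom]

theorem twistedHom_diag (σ : Pre →ₐ[ℝ] Pre) (f : Gen → Pre) (z : Pre) :
    twistedHom σ f z 0 0 = σ z ∧ twistedHom σ f z 1 0 = 0 ∧ twistedHom σ f z 1 1 = z := by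
  induction z using FreeAlgebra.induction with
  | grade0 r => simp [Matrix.algebraMap_matrix_apply]
  | grade1 x => simp [twistedHom]
  | mul z w hz hw => simp [Matrix.mul_apply, Fin.sum_univ_two, hz, hw]
  | add z w hz hw => simp [hz, hw]

theorem twistedDer_mul (σ : Pre →ₐ[ℝ] Pre) (f : Gen → Pre) (z w : Pre) :
    twistedDer σ f (z * w) = twistedDer σ f z * w + σ z * twistedDer σ f w := by
  have h : ∀ u, twistedDer σ f u = twistedHom σ f u 0 1 := fun _ => rfl
  rw [h, h, h, map_mul, Matrix.mul_apply, Fin.sum_univ_two, (twistedHom_diag σ f z).1,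
    (twistedHom_diag σ f w).2.2, add_comm]

theorem twistedDer_algebraMap (σ : Pre →ₐ[ℝ] Pre) (f : Gen → Pre) (r : ℝ) :
    twistedDer σ f (algebraMap ℝ Pre r) = 0 := by
  have h : ∀ u, twistedDer σ f u = twistedHom σ f u 0 1 := fun _ => rfl
  simp [h, Matrix.algebraMap_matrix_apply]

/-! ## Tensors -/

/-- The Minkowski metric `diag(-1, 1, 1, 1)`; it is its own inverse. -/
def eta (a b : Fin 4) : ℝ := if a = b then (if a = 0 then -1 else 1) else 0

/-- The Kronecker symbol. -/
def delta (a b : Fin 4) : ℝ := if a = b then 1 else 0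

/-- The totally antisymmetric tensor `ε^{abcd}` with `ε^{0123} = 1`. -/
def epsUp (a b c d : Fin 4) : ℝ := (Matrix.of fun i j => delta (![a, b, c, d] i) j).det

/-- `ε_{abcd}`, with all indices lowered by the metric. -/
def epsDown (a b c d : Fin 4) : ℝ :=
  ∑ a', ∑ b', ∑ c', ∑ d', eta a a' * eta b b' * eta c c' * eta d d' * epsUp a' b' c' d'

/-- `ξ^a`. -/
def xi (a : Fin 4) : Pre := fn (.xi a)

/-- `ξ_a`. -/
def xiDown (a : Fin 4) : Pre := ∑ b, eta a b • xi b

/-- `ρ_{ab}`. -/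
def rho (a b : Fin 4) : Pre := fn (.rho a b)

/-- `κ_b`. -/
def kappa (b : Fin 4) : Pre := fn (.kappa b)

/-- `λ`. -/
def lam : Pre := fn .lam

/-- `W_{abcd|e₁…e_k}` for `i = ![a, b, c, d, e₁, …, e_k]`. -/
def weyl {k : ℕ} (i : Fin (4 + k) → Fin 4) : Pre := fn (.weyl k i)

/-- `W_{abcd}`. -/
def W (a b c d : Fin 4) : Pre := weyl (k := 0) ![a, b, c, d]

/-- `W_{abcd|e}`. -/
def dW (a b c d e : Fin 4) : Pre := weyl (k := 1) ![a, b, c, d, e]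

/-- `W_{abcd|ef}`. -/
def ddW (a b c d e f : Fin 4) : Pre := weyl (k := 2) ![a, b, c, d, e, f]

/-- The Cotton tensor `C_{bcd} = W^a_{bcd|a}`. -/
def C (b c d : Fin 4) : Pre := ∑ a, ∑ e, eta a e • dW a b c d e

/-- `C_{bcd|f} = W^a_{bcd|af}`. -/
def dC (b c d f : Fin 4) : Pre := ∑ a, ∑ e, eta a e • ddW a b c d e f

/-! ## Covariant derivatives and the action of the special conformal generators -/

/-- The index array of `W_{…|e₁…e_k e}`, obtained by appending the derivative index `e`. -/
def appendIndex {k : ℕ} (i : Fin (4 + k) → Fin 4) (e : Fin 4) : Fin (4 + (k + 1)) → Fin 4 :=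
  Fin.snoc (α := fun _ : Fin (4 + k + 1) => Fin 4) i e

/-- The covariant derivative `D_e`: the derivation `W_{…|e₁…e_k} ↦ W_{…|e₁…e_k e}`
(zero on the other generators). -/
def covD (e : Fin 4) : Pre →ₗ[ℝ] Pre :=
  evenDer fun
    | .fn (.weyl _ i) => weyl (appendIndex i e)
    | _ => 0

/-- `Γ^j` on the Weyl coordinates: `Γ^j W_{abcd} = 0` and, if `T = W_{abcd|e₁…e_k}` has the indices
`i`, then
`Γ^j D_e T = D_e Γ^j T - (k + 2) δ^j_e T + ∑_s (η_{e i_s} T_{…}{}^{j}{}_{…} - δ^j_{i_s} T_{…e…})`,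
where `j`, resp. `e`, stands in the slot `s`. -/
def gammaWeyl (j : Fin 4) : (k : ℕ) → (Fin (4 + k) → Fin 4) → Pre
  | 0, _ => 0
  | k + 1, i' =>
    let i : Fin (4 + k) → Fin 4 := fun s => i' (Fin.castSucc s)
    let e : Fin 4 := i' (Fin.last (4 + k))
    covD e (gammaWeyl j k i) - (((k : ℝ) + 2) * delta j e) • weyl i
      + ∑ s : Fin (4 + k), (eta e (i s) • (∑ m, eta j m • weyl (Function.update i s m))
          - delta j (i s) • weyl (Function.update i s e))

/-- The special conformal generator `Γ^j` as a derivation (zero on the other generators). -/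
def gam (j : Fin 4) : Pre →ₗ[ℝ] Pre :=
  evenDer fun
    | .fn (.weyl k i) => gammaWeyl j k i
    | _ => 0

/-- The functions of the Weyl coordinates that vanish on `F` (a generating set, stable under the
covariant derivatives and the special conformal generators). -/
inductive WeylRel : Pre → Prop
  | antisymm_left (a b c d : Fin 4) : WeylRel (W a b c d + W b a c d)
  | antisymm_right (a b c d : Fin 4) : WeylRel (W a b c d + W a b d c)
  | cyclic (a b c d : Fin 4) : WeylRel (W a b c d + W a c d b + W a d b c)
  | traceless (b d : Fin 4) : WeylRel (∑ a, ∑ c, eta a c • W a b c d)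
  /-- Bianchi identity: `W_{ab[cd|e]} = η_{a[e} C_{|b|cd]} - η_{b[e} C_{|a|cd]}`. -/
  | bianchi (a b c d e : Fin 4) : WeylRel (dW a b c d e + dW a b d e c + dW a b e c d
      - (eta a e • C b c d + eta a c • C b d e + eta a d • C b e c)
      + (eta b e • C a c d + eta b c • C a d e + eta b d • C a e c))
  /-- Bianchi identity for the Cotton tensor: `C_{b[cd|e]} = 0`. -/
  | bianchi_cotton (b c d e : Fin 4) : WeylRel (dC b c d e + dC b d e c + dC b e c d)
  /-- Commutator of covariant derivatives: for every `T = W_{…|e₁…e_k}`,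
  `[D_c, D_d] T = - C_{bcd} Γ^b T - ∑_s W_{i_s}{}^m{}_{cd} T_{…m…}`. -/
  | commutator (c d : Fin 4) (k : ℕ) (i : Fin (4 + k) → Fin 4) :
      WeylRel (covD c (covD d (weyl i)) - covD d (covD c (weyl i))
        + ∑ b, C b c d * gam b (weyl i)
        + ∑ s : Fin (4 + k), ∑ m, ∑ n,
            eta m n • (W (i s) n c d * weyl (Function.update i s m)))
  /-- Bach equation: `C_{abc|}{}^b = 0`. -/
  | bach (a c : Fin 4) : WeylRel (∑ b, ∑ e, eta b e • dC a b c e)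
  | covD (e : Fin 4) {z : Pre} : WeylRel z → WeylRel (covD e z)
  | gam (j : Fin 4) {z : Pre} : WeylRel z → WeylRel (gam j z)

/-! ## The differentials on the free algebra -/

/-- The BRST differential `q` on the coordinates. -/
def qCoord : Coord → Pre
  | .xi a => (∑ b, ∑ c, eta a b • (rho b c * xi c)) + xi a * lam
  | .rho a b => (∑ c, ∑ d, eta c d • (rho a c * rho d b))
      + (xiDown a * kappa b - xiDown b * kappa a)
      + (1 / 2 : ℝ) • ∑ c, ∑ d, xi c * xi d * W a b c d
  | .kappa b => (∑ c, ∑ d, eta c d • (kappa c * rho d b)) + lam * kappa b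
      + (1 / 2 : ℝ) • ∑ c, ∑ d, xi c * xi d * C b c d
  | .lam => ∑ c, kappa c * xi c
  | .weyl k i => (∑ e, xi e * covD e (weyl i))
      + (∑ s : Fin (4 + k), ∑ m, ∑ n,
          eta m n • (rho (i s) n * weyl (Function.update i s m)))
      + ((k : ℝ) + 2) • (lam * weyl i)
      + ∑ j, kappa j * gam j (weyl i)

/-- The de Rham differential on `Pre`. -/
def preD : Pre →ₗ[ℝ] Pre :=
  oddDer fun
    | .fn x => diff x
    | .diff _ => 0

/-- Contraction with the vector field `q` on `Pre`. -/
def preI : Pre →ₗ[ℝ] Pre :=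
  evenDer fun
    | .fn _ => 0
    | .diff x => qCoord x

/-! ## Forms on `F` -/

/-- Membership in the ideal of relations: the smallest two-sided ideal of `Pre`, stable under `d`
and `i_q`, that contains graded commutativity and the constraints on the overcomplete
coordinates. -/
inductive Vanishes : Pre → Prop
  | zero : Vanishes 0
  | add {z w : Pre} : Vanishes z → Vanishes w → Vanishes (z + w)
  | mul_left (u : Pre) {z : Pre} : Vanishes z → Vanishes (u * z)
  | mul_right (u : Pre) {z : Pre} : Vanishes z → Vanishes (z * u)
  | graded_comm (x y : Gen) :
      Vanishes (FreeAlgebra.ι ℝ x * FreeAlgebra.ι ℝ y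
        - ((-1 : ℝ) ^ (x.deg * y.deg)) • (FreeAlgebra.ι ℝ y * FreeAlgebra.ι ℝ x))
  | rho_antisymm (a b : Fin 4) : Vanishes (rho a b + rho b a)
  | weyl {z : Pre} : WeylRel z → Vanishes z
  | preD {z : Pre} : Vanishes z → Vanishes (preD z)
  | preI {z : Pre} : Vanishes z → Vanishes (preI z)

/-- The ideal of relations. -/
def relIdeal : Ideal Pre where
  carrier := {z | Vanishes z}
  zero_mem' := Vanishes.zero
  add_mem' := Vanishes.add
  smul_mem' := fun u _ h => Vanishes.mul_left u h

instance : relIdeal.IsTwoSided := ⟨fun u h => Vanishes.mul_right u h⟩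

/-- The algebra of differential forms on `F`. -/
abbrev Forms : Type := Pre ⧸ relIdeal

/-- The class of an element of `Pre` as a form on `F`. -/
def form : Pre →ₐ[ℝ] Forms := Ideal.Quotient.mkₐ ℝ relIdeal

theorem form_eq_zero_iff (z : Pre) : form z = 0 ↔ Vanishes z :=
  Ideal.Quotient.eq_zero_iff_mem

theorem form_surjective : Function.Surjective form := Ideal.Quotient.mk_surjective

/-- A linear endomorphism of `Pre` that preserves the relations descends to `Forms`. -/
def descend (D : Pre →ₗ[ℝ] Pre) (h : ∀ z, Vanishes z → Vanishes (D z)) : Forms →ₗ[ℝ] Forms where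
  toFun := Quotient.lift (fun z => form (D z)) (by
    intro z w hzw
    have h0 : Vanishes (z - w) := by
      have := (Submodule.quotientRel_def relIdeal).1 hzw
      exact this
    have h1 := (form_eq_zero_iff _).2 (h _ h0)
    rw [map_sub, map_sub] at h1
    exact sub_eq_zero.1 h1)
  map_add' := by
    intro x y
    obtain ⟨z, rfl⟩ := form_surjective x
    obtain ⟨w, rfl⟩ := form_surjective y
    change form (D (z + w)) = form (D z) + form (D w)
    simp
  map_smul' := by
    intro r x
    obtain ⟨z, rfl⟩ := form_surjective x
    change form (D (r • z)) = r • form (D z)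
    simp

theorem descend_form (D : Pre →ₗ[ℝ] Pre) (h : ∀ z, Vanishes z → Vanishes (D z)) (z : Pre) :
    descend D h (form z) = form (D z) := rfl

/-- The de Rham differential `d` on `F`. -/
def d : Forms →ₗ[ℝ] Forms := descend preD fun _ => Vanishes.preD

/-- The contraction `i_q`. -/
def contrQ : Forms →ₗ[ℝ] Forms := descend preI fun _ => Vanishes.preI

/-- The Lie derivative `L_q = i_q d - d i_q` (a graded commutator, `i_q` being even and `d` odd).
On functions it is the vector field `q` itself. -/
def lieQ : Forms →ₗ[ℝ] Forms := contrQ ∘ₗ d - d ∘ₗ contrQ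

/-- The forms on `F` of form degree `p` and ghost degree `g`. -/
def bidegree (p g : ℕ) : Submodule ℝ Forms :=
  Submodule.span ℝ {z | ∃ l : List Gen, (l.map Gen.formDeg).sum = p ∧ (l.map Gen.gh).sum = g ∧
    z = form ((l.map (FreeAlgebra.ι ℝ)).prod)}

/-! ## The presymplectic structure -/

/-- `W^{abcd}`. -/
def WUp (a b c d : Fin 4) : Pre :=
  ∑ a', ∑ b', ∑ c', ∑ d', (eta a a' * eta b b' * eta c c' * eta d d') • W a' b' c' d'

/-- `C^a_{bc}`. -/
def CMixed (a b c : Fin 4) : Pre := ∑ a', eta a a' • C a' b c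

/-- `W^{abnm} ε_{nmpk} ξ^p ξ^k`. -/
def weylDual (a b : Fin 4) : Pre :=
  ∑ n, ∑ m, ∑ p, ∑ k, epsDown n m p k • (WUp a b n m * xi p * xi k)

/-- `C^a_{bc} ε^{bcpk} ξ_p ξ_k`. -/
def cottonDual (a : Fin 4) : Pre :=
  ∑ b, ∑ c, ∑ p, ∑ k, epsUp b c p k • (CMixed a b c * xiDown p * xiDown k)

/-- `ω_W = d(ρ_{ab}) d(W^{abnm} ε_{nmpk} ξ^p ξ^k)`. -/
def omegaW : Forms := ∑ a, ∑ b, d (form (rho a b)) * d (form (weylDual a b))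

/-- `ω_C = d(ξ_a) d(C^a_{bc} ε^{bcpk} ξ_p ξ_k)`. -/
def omegaC : Forms := ∑ a, d (form (xiDown a)) * d (form (cottonDual a))

/-- `ω = ω_W - 2 ω_C`. -/
def omega : Forms := omegaW - (2 : ℝ) • omegaC

/-- The Hamiltonian
`ℒ = (ρ_{al} ρ^l_b + 2 ξ_a κ_b + ¼ W_{abij} ξ^i ξ^j) W^{abnm} ε_{nmpk} ξ^p ξ^k
  - 2 (ρ_{an} ξ^n + ξ_a λ) C^a_{bc} ε^{bcpk} ξ_p ξ_k`. -/
def hamiltonian : Forms := form (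
  (∑ a, ∑ b, ((∑ l, ∑ m, eta l m • (rho a l * rho m b)) + (2 : ℝ) • (xiDown a * kappa b)
      + (1 / 4 : ℝ) • ∑ i, ∑ j, W a b i j * xi i * xi j) * weylDual a b)
    - (2 : ℝ) • ∑ a, ((∑ n, rho a n * xi n) + xiDown a * lam) * cottonDual a)

end ConformalGravity

end

/-!
# Conformal gravity as a presymplectic AKSZ model

Everything is computed on representatives in the free algebra `Pre`, where `d`, `i_q` and `L_q`
are the twisted derivations `preD`, `preI` and `preLie`; equalities hold after applying `form`.

*`L_q² = 0`.* Since `L_q²` is a derivation commuting with `d`, it suffices to treat the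
coordinates (`vanishes_preLie_preLie`). On the coordinates of ghost degree zero `q` is the
Chevalley–Eilenberg operator of the conformal algebra: translations act by `D_e`, Lorentz
rotations by index substitutions, the dilation by the conformal weight, the special conformal
generators by `Γ^j`. The operators represent the conformal algebra, except that `[D_c, D_d]` is
the curvature (`gam_covD_lorentz`, `lorentz_gam`, `gam_gam`, `form_commutator`), and `q² = 0` is
`chevalleyEilenberg_sq`. On `ξ`, `ρ`, `κ`, `λ` the formulas for `q` are the structure equations of
the conformal algebra with curvatures `½ ξ ξ W` and `½ ξ ξ C` in `q ρ` and `q κ`, and `q² = 0` is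
the Bianchi identity for these curvatures (`form_preLie_weylCurv`, `form_preLie_cottonCurv`).

*`i_q ω = dℒ`.* Write `B_{ab} = W_{abnm} ε^{nmpk} ξ_p ξ_k` and `G_a = C_{anm} ε^{nmpk} ξ_p ξ_k`
(`weylContr dualXiXi`, `cottonContr dualXiXi`), with which `ω = dρ_{ab} dB^{ab} - 2 dξ_a dG^a`. A
product of three `ξ` is dual to a vector, so the contraction of `ξ_e ε^{nmpk} ξ_p ξ_k` with a
tensor only sees its trace (`sum_xi_mul_dualXiXi`). Tracelessness of `W` and `C`, the definition
of `C` as the divergence of `W`, and the Bach equation then become `ξ^a B_{ab} = 0`,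
`ξ^a G_a = 0`, and formulas for `q B` and `q G` in which `W`, `C` and their derivatives enter through `B` and
`G` only (`sum_xi_mul_dW`, `sum_xi_mul_dC`). With these the parts of `i_q ω` and `dℒ` without
curvature agree (`hamiltonian_identity`). What remains is `dR_{ab} B^{ab} = R_{ab} dB^{ab}` for
the curvature `R = ½ ξ ξ W` (`sum_preD_weylCurv`), a consequence of the equality of the left dual
and the right dual of a Weyl tensor (`dual_comm`).

*`L_q ω = 0`* follows, since `ω` is closed and `L_q = i_q d - d i_q`.
-/

noncomputable section

namespace ConformalGravity

/-! ### The algebra of forms -/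

-- Shortcut instances: unfolding the quotient ring in every instance search is slow.

instance : Ring Forms := inferInstance

instance : Algebra ℝ Forms := inferInstance

instance : Semiring Forms := inferInstance

instance : NonUnitalNonAssocSemiring Forms := inferInstance

instance : NonUnitalNonAssocRing Forms := inferInstance

instance : AddCommGroup Forms := inferInstance

instance : AddCommMonoid Forms := inferInstance

instance : Module ℝ Forms := inferInstance

instance : SMul ℝ Forms := inferInstance

instance : DistribMulAction ℝ Forms := inferInstance

instance : SMulZeroClass ℝ Forms := inferInstance

instance : DistribSMul ℝ Forms := inferInstance

instance : SMulCommClass ℝ Forms Forms := inferInstance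

/-! ### Derivations of the free algebra and the bigrading -/

theorem twistedDer_one (σ : Pre →ₐ[ℝ] Pre) (f : Gen → Pre) : twistedDer σ f 1 = 0 := by
  simpa using twistedDer_algebraMap σ f 1

/-- The elements of the free algebra of form degree `p` and ghost degree `g`. -/
def preBidegree (p g : ℕ) : Submodule ℝ Pre :=
  Submodule.span ℝ {z | ∃ l : List Gen, (l.map Gen.formDeg).sum = p ∧ (l.map Gen.gh).sum = g ∧
    z = (l.map (FreeAlgebra.ι ℝ)).prod}

theorem gen_mem_preBidegree (x : Gen) : FreeAlgebra.ι ℝ x ∈ preBidegree x.formDeg x.gh :=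
  Submodule.subset_span ⟨[x], by simp⟩

theorem mul_mem_preBidegree {p₁ g₁ p₂ g₂ p g : ℕ} {z w : Pre} (hz : z ∈ preBidegree p₁ g₁)
    (hw : w ∈ preBidegree p₂ g₂) (hp : p₁ + p₂ = p := by rfl) (hg : g₁ + g₂ = g := by rfl) :
    z * w ∈ preBidegree p g := by
  subst hp hg
  induction hz, hw using Submodule.span_induction₂ with
  | mem_mem z w hz hw =>
    obtain ⟨l, rfl, rfl, rfl⟩ := hz
    obtain ⟨m, rfl, rfl, rfl⟩ := hw
    exact Submodule.subset_span ⟨l ++ m, by simp⟩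
  | zero_left => simp
  | zero_right => simp
  | add_left _ _ _ _ _ _ h h' => rw [add_mul]; exact add_mem h h'
  | add_right _ _ _ _ _ _ h h' => rw [mul_add]; exact add_mem h h'
  | smul_left r _ _ _ _ h => rw [smul_mul_assoc]; exact Submodule.smul_mem _ _ h
  | smul_right r _ _ _ _ h => rw [mul_smul_comm]; exact Submodule.smul_mem _ _ h

theorem form_mem_bidegree {p g : ℕ} {z : Pre} (hz : z ∈ preBidegree p g) :
    form z ∈ bidegree p g := by
  induction hz using Submodule.span_induction with
  | mem z hz =>
    obtain ⟨l, h₁, h₂, rfl⟩ := hz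
    exact Submodule.subset_span ⟨l, h₁, h₂, rfl⟩
  | zero => simp
  | add _ _ _ _ h h' => rw [map_add]; exact add_mem h h'
  | smul r _ _ h => rw [map_smul]; exact Submodule.smul_mem _ _ h

theorem exists_of_mem_bidegree {p g : ℕ} {z : Forms} (hz : z ∈ bidegree p g) :
    ∃ w ∈ preBidegree p g, form w = z := by
  induction hz using Submodule.span_induction with
  | mem z hz =>
    obtain ⟨l, h₁, h₂, rfl⟩ := hz
    exact ⟨_, Submodule.subset_span ⟨l, h₁, h₂, rfl⟩, rfl⟩
  | zero => exact ⟨0, zero_mem _, map_zero _⟩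
  | add _ _ _ _ h h' =>
    obtain ⟨w, hw, rfl⟩ := h
    obtain ⟨w', hw', rfl⟩ := h'
    exact ⟨w + w', add_mem hw hw', map_add _ _ _⟩
  | smul r _ _ h =>
    obtain ⟨w, hw, rfl⟩ := h
    exact ⟨r • w, Submodule.smul_mem _ _ hw, map_smul _ _ _⟩

theorem parity_gen (x : Gen) :
    parity (FreeAlgebra.ι ℝ x) = ((-1 : ℝ) ^ x.deg) • FreeAlgebra.ι ℝ x := by
  simp [parity]

theorem parity_of_mem {p g : ℕ} {z : Pre} (hz : z ∈ preBidegree p g) :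
    parity z = ((-1 : ℝ) ^ (p + g)) • z := by
  induction hz using Submodule.span_induction with
  | mem z hz =>
    obtain ⟨l, rfl, rfl, rfl⟩ := hz
    induction l with
    | nil => simp
    | cons x l ih =>
      simp only [List.map_cons, List.prod_cons, map_mul, parity_gen, ih, List.sum_cons,
        smul_mul_smul_comm, ← pow_add, Gen.deg]
      congr 2
      ring
  | zero => simp
  | add _ _ _ _ h h' => rw [map_add, h, h', smul_add]
  | smul r _ _ h => rw [map_smul, h, smul_comm]

theorem parity_parity (z : Pre) : parity (parity z) = z := by
  have h : parity.comp parity = AlgHom.id ℝ Pre := by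
    ext x
    simp [parity_gen, smul_smul, ← mul_pow]
  exact DFunLike.congr_fun h z

/-- A twisted derivation has bidegree `(a, b)` as soon as it has it on the generators. -/
theorem twistedDer_mem {σ : Pre →ₐ[ℝ] Pre} {f : Gen → Pre} {a b : ℕ}
    (hσ : ∀ p g, ∀ z ∈ preBidegree p g, σ z ∈ preBidegree p g)
    (hf : ∀ x : Gen, f x ∈ preBidegree (x.formDeg + a) (x.gh + b)) {p g : ℕ} {z : Pre}
    (hz : z ∈ preBidegree p g) : twistedDer σ f z ∈ preBidegree (p + a) (g + b) := by
  induction hz using Submodule.span_induction with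
  | mem z hz =>
    obtain ⟨l, rfl, rfl, rfl⟩ := hz
    induction l with
    | nil => simp [twistedDer_one]
    | cons x l ih =>
      simp only [List.map_cons, List.prod_cons, twistedDer_mul, twistedDer_gen, List.sum_cons]
      refine add_mem (mul_mem_preBidegree (hf x) (Submodule.subset_span ⟨l, rfl, rfl, rfl⟩)
        (by ring) (by ring)) (mul_mem_preBidegree (hσ _ _ _ (gen_mem_preBidegree x)) ih
        (by ring) (by ring))
  | zero => simp
  | add _ _ _ _ h h' => rw [map_add]; exact add_mem h h'
  | smul r _ _ h => rw [map_smul]; exact Submodule.smul_mem _ _ h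

theorem parity_mem {p g : ℕ} {z : Pre} (hz : z ∈ preBidegree p g) :
    parity z ∈ preBidegree p g := by
  rw [parity_of_mem hz]
  exact Submodule.smul_mem _ _ hz

theorem evenDer_mem {f : Gen → Pre} {a b : ℕ}
    (hf : ∀ x : Gen, f x ∈ preBidegree (x.formDeg + a) (x.gh + b)) {p g : ℕ} {z : Pre}
    (hz : z ∈ preBidegree p g) : evenDer f z ∈ preBidegree (p + a) (g + b) :=
  twistedDer_mem (fun _ _ _ h => h) hf hz

theorem oddDer_mem {f : Gen → Pre} {a b : ℕ}
    (hf : ∀ x : Gen, f x ∈ preBidegree (x.formDeg + a) (x.gh + b)) {p g : ℕ} {z : Pre}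
    (hz : z ∈ preBidegree p g) : oddDer f z ∈ preBidegree (p + a) (g + b) :=
  twistedDer_mem (fun _ _ _ h => parity_mem h) hf hz

theorem evenDer_mul (f : Gen → Pre) (z w : Pre) :
    evenDer f (z * w) = evenDer f z * w + z * evenDer f w :=
  twistedDer_mul _ f z w

theorem oddDer_mul (f : Gen → Pre) (z w : Pre) :
    oddDer f (z * w) = oddDer f z * w + parity z * oddDer f w :=
  twistedDer_mul _ f z w

/-- An odd derivation anticommutes with the parity if it does so on the generators. -/
theorem parity_oddDer {f : Gen → Pre} (hf : ∀ x : Gen, parity (f x) = -((-1 : ℝ) ^ x.deg • f x))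
    (z : Pre) : parity (oddDer f z) = -oddDer f (parity z) := by
  induction z using FreeAlgebra.induction with
  | grade0 r => simp [oddDer, twistedDer_algebraMap]
  | grade1 x => rw [parity_gen, map_smul, oddDer, twistedDer_gen, hf]
  | mul z w hz hw => simp only [oddDer_mul, map_add, map_mul, hz, hw]; noncomm_ring
  | add z w hz hw => simp only [map_add, hz, hw, neg_add]

/-- An even derivation commutes with the parity if it does so on the generators. -/
theorem parity_evenDer {f : Gen → Pre} (hf : ∀ x : Gen, parity (f x) = (-1 : ℝ) ^ x.deg • f x)
    (z : Pre) : parity (evenDer f z) = evenDer f (parity z) := by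
  induction z using FreeAlgebra.induction with
  | grade0 r => simp [evenDer, twistedDer_algebraMap]
  | grade1 x => rw [parity_gen, map_smul, evenDer, twistedDer_gen, hf]
  | mul z w hz hw => simp only [evenDer_mul, map_add, map_mul, hz, hw]
  | add z w hz hw => simp only [map_add, hz, hw]

/-! ### The coordinates and the metric -/

theorem fn_mem (x : Coord) : fn x ∈ preBidegree 0 x.gh := gen_mem_preBidegree (.fn x)

theorem diff_mem (x : Coord) : diff x ∈ preBidegree 1 x.gh := gen_mem_preBidegree (.diff x)

theorem xi_mem (a : Fin 4) : xi a ∈ preBidegree 0 1 := by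
  have h := fn_mem (.xi a)
  exact h

theorem rho_mem (a b : Fin 4) : rho a b ∈ preBidegree 0 1 := by
  have h := fn_mem (.rho a b)
  exact h

theorem kappa_mem (b : Fin 4) : kappa b ∈ preBidegree 0 1 := by
  have h := fn_mem (.kappa b)
  exact h

theorem lam_mem : lam ∈ preBidegree 0 1 := by
  have h := fn_mem .lam
  exact h

theorem weyl_mem {k : ℕ} (i : Fin (4 + k) → Fin 4) : weyl i ∈ preBidegree 0 0 := by
  have h := fn_mem (.weyl k i)
  exact h

/-- The diagonal entries of the Minkowski metric. -/
def sgn (a : Fin 4) : ℝ := if a = 0 then -1 else 1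

theorem eta_eq (a b : Fin 4) : eta a b = if a = b then sgn a else 0 := rfl

theorem sgn_mul_self (a : Fin 4) : sgn a * sgn a = 1 := by
  unfold sgn; split_ifs <;> norm_num

section Module

variable {M : Type*} [AddCommGroup M] [Module ℝ M]

theorem sgn_smul_sgn_smul (a : Fin 4) (z : M) : sgn a • sgn a • z = z := by
  rw [smul_smul, sgn_mul_self, one_smul]

theorem sum_eta_smul (a : Fin 4) (f : Fin 4 → M) : ∑ b, eta a b • f b = sgn a • f a := by
  simp [eta_eq]

theorem sum_delta_smul (a : Fin 4) (f : Fin 4 → M) : ∑ b, delta a b • f b = f a := by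
  simp [delta]

theorem sum_delta_smul' (a : Fin 4) (f : Fin 4 → M) : ∑ b, delta b a • f b = f a := by
  simp [delta]

end Module

theorem xiDown_eq (a : Fin 4) : xiDown a = sgn a • xi a := sum_eta_smul a _

theorem C_eq (b c d : Fin 4) : C b c d = ∑ a, sgn a • dW a b c d a := by
  simp only [C, sum_eta_smul]

theorem dC_eq (b c d f : Fin 4) : dC b c d f = ∑ a, sgn a • ddW a b c d a f := by
  simp only [dC, sum_eta_smul]

/-! ### The module of Weyl coordinates -/

/-- The linear span of the coordinates `W_{abcd|e₁…e_k}` with `k` derivative indices. -/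
def weylSpan (k : ℕ) : Submodule ℝ Pre := Submodule.span ℝ (Set.range (weyl (k := k)))

theorem weyl_mem_weylSpan {k : ℕ} (i : Fin (4 + k) → Fin 4) : weyl i ∈ weylSpan k :=
  Submodule.subset_span ⟨i, rfl⟩

theorem weylSpan_le (k : ℕ) : weylSpan k ≤ preBidegree 0 0 := by
  rw [weylSpan, Submodule.span_le]
  rintro _ ⟨i, rfl⟩
  exact weyl_mem i

/-- Linear maps agreeing on the Weyl coordinates with `k` derivative indices agree on their span. -/
theorem weylSpan_ext {M : Type*} [AddCommGroup M] [Module ℝ M] {k : ℕ} {f g : Pre →ₗ[ℝ] M}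
    (h : ∀ i : Fin (4 + k) → Fin 4, f (weyl i) = g (weyl i)) {z : Pre} (hz : z ∈ weylSpan k) :
    f z = g z := by
  have := LinearMap.eqOn_span (f := f) (g := g) (s := Set.range (weyl (k := k)))
    (by rintro _ ⟨i, rfl⟩; exact h i)
  exact this hz

theorem weylSpan_map {f : Pre →ₗ[ℝ] Pre} {k : ℕ} {N : Submodule ℝ Pre}
    (h : ∀ i : Fin (4 + k) → Fin 4, f (weyl i) ∈ N) {z : Pre} (hz : z ∈ weylSpan k) :
    f z ∈ N := by
  have : weylSpan k ≤ N.comap f := by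
    rw [weylSpan, Submodule.span_le]
    rintro _ ⟨i, rfl⟩
    exact h i
  exact this hz

theorem covD_weyl {k : ℕ} (i : Fin (4 + k) → Fin 4) (e : Fin 4) :
    covD e (weyl i) = weyl (appendIndex i e) := twistedDer_gen _ _ _

theorem gam_weyl {k : ℕ} (i : Fin (4 + k) → Fin 4) (j : Fin 4) :
    gam j (weyl i) = gammaWeyl j k i := twistedDer_gen _ _ _

theorem covD_mem_weylSpan (e : Fin 4) {k : ℕ} {z : Pre} (hz : z ∈ weylSpan k) :
    covD e z ∈ weylSpan (k + 1) :=
  weylSpan_map (fun i => by rw [covD_weyl]; exact weyl_mem_weylSpan _) hz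

theorem gammaWeyl_mem (j : Fin 4) (k : ℕ) (i : Fin (4 + (k + 1)) → Fin 4) :
    gammaWeyl j (k + 1) i ∈ weylSpan k := by
  induction k with
  | zero =>
    simp only [gammaWeyl, map_zero]
    refine add_mem (sub_mem (zero_mem _) (Submodule.smul_mem _ _ (weyl_mem_weylSpan _))) ?_
    exact sum_mem fun s _ => sub_mem (Submodule.smul_mem _ _ (sum_mem fun m _ =>
      Submodule.smul_mem _ _ (weyl_mem_weylSpan _))) (Submodule.smul_mem _ _ (weyl_mem_weylSpan _))
  | succ k ih =>
    rw [gammaWeyl]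
    refine add_mem (sub_mem (covD_mem_weylSpan _ (ih _))
      (Submodule.smul_mem _ _ (weyl_mem_weylSpan _))) ?_
    exact sum_mem fun s _ => sub_mem (Submodule.smul_mem _ _ (sum_mem fun m _ =>
      Submodule.smul_mem _ _ (weyl_mem_weylSpan _))) (Submodule.smul_mem _ _ (weyl_mem_weylSpan _))

theorem gam_zero (j : Fin 4) {z : Pre} (hz : z ∈ weylSpan 0) : gam j z = 0 :=
  weylSpan_ext (f := gam j) (g := 0) (fun i => (gam_weyl i j).trans rfl) hz

theorem gam_mem_weylSpan (j : Fin 4) {k : ℕ} {z : Pre} (hz : z ∈ weylSpan (k + 1)) :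
    gam j z ∈ weylSpan k :=
  weylSpan_map (fun i => by rw [gam_weyl]; exact gammaWeyl_mem j k i) hz

theorem gam_weyl_mem (j : Fin 4) {k : ℕ} (i : Fin (4 + k) → Fin 4) :
    gam j (weyl i) ∈ preBidegree 0 0 := by
  rcases k with _ | k
  · rw [gam_zero j (weyl_mem_weylSpan i)]; exact zero_mem _
  · exact weylSpan_le _ (gam_mem_weylSpan j (weyl_mem_weylSpan i))

theorem covD_mem (e : Fin 4) {z : Pre} (hz : z ∈ preBidegree 0 0) : covD e z ∈ preBidegree 0 0 := by
  refine evenDer_mem (a := 0) (b := 0) ?_ hz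
  rintro ((_ | _ | _ | _ | _) | _)
  case fn.weyl => exact weyl_mem _
  all_goals exact zero_mem _

theorem W_mem (a b c d : Fin 4) : W a b c d ∈ preBidegree 0 0 := weyl_mem _

theorem C_mem_weylSpan (b c d : Fin 4) : C b c d ∈ weylSpan 1 := by
  rw [C_eq]
  exact sum_mem fun _ _ => Submodule.smul_mem _ _ (weyl_mem_weylSpan _)

theorem C_mem (b c d : Fin 4) : C b c d ∈ preBidegree 0 0 := weylSpan_le _ (C_mem_weylSpan b c d)

/-! ### The de Rham differential, the contraction and the Lie derivative -/

theorem qCoord_mem (x : Coord) : qCoord x ∈ preBidegree 0 (x.gh + 1) := by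
  have hxi : ∀ a, xiDown a ∈ preBidegree 0 1 := fun a => by
    rw [xiDown_eq]; exact Submodule.smul_mem _ _ (xi_mem a)
  have sm : ∀ {g : ℕ} (r : ℝ) {z : Pre}, z ∈ preBidegree 0 g → r • z ∈ preBidegree 0 g :=
    fun r _ h => Submodule.smul_mem _ r h
  cases x with
  | xi a =>
    change qCoord _ ∈ preBidegree 0 2
    unfold qCoord
    exact add_mem (sum_mem fun _ _ => sum_mem fun _ _ =>
      sm _ (mul_mem_preBidegree (rho_mem _ _) (xi_mem _)))
      (mul_mem_preBidegree (xi_mem _) lam_mem)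
  | rho a b =>
    change qCoord _ ∈ preBidegree 0 2
    unfold qCoord
    exact add_mem (add_mem (sum_mem fun _ _ => sum_mem fun _ _ =>
      sm _ (mul_mem_preBidegree (rho_mem _ _) (rho_mem _ _)))
      (sub_mem (mul_mem_preBidegree (hxi _) (kappa_mem _))
        (mul_mem_preBidegree (hxi _) (kappa_mem _))))
      (sm _ (sum_mem fun _ _ => sum_mem fun _ _ =>
        mul_mem_preBidegree (mul_mem_preBidegree (xi_mem _) (xi_mem _)) (W_mem _ _ _ _)))
  | kappa b =>
    change qCoord _ ∈ preBidegree 0 2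
    unfold qCoord
    exact add_mem (add_mem (sum_mem fun _ _ => sum_mem fun _ _ =>
      sm _ (mul_mem_preBidegree (kappa_mem _) (rho_mem _ _)))
      (mul_mem_preBidegree lam_mem (kappa_mem _)))
      (sm _ (sum_mem fun _ _ => sum_mem fun _ _ =>
        mul_mem_preBidegree (mul_mem_preBidegree (xi_mem _) (xi_mem _)) (C_mem _ _ _)))
  | lam =>
    change qCoord _ ∈ preBidegree 0 2
    exact sum_mem fun _ _ => mul_mem_preBidegree (kappa_mem _) (xi_mem _)
  | weyl k i =>
    change qCoord _ ∈ preBidegree 0 1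
    unfold qCoord
    exact add_mem (add_mem (add_mem
      (sum_mem fun _ _ => mul_mem_preBidegree (xi_mem _) (covD_mem _ (weyl_mem _)))
      (sum_mem fun _ _ => sum_mem fun _ _ => sum_mem fun _ _ =>
        sm _ (mul_mem_preBidegree (rho_mem _ _) (weyl_mem _))))
      (sm _ (mul_mem_preBidegree lam_mem (weyl_mem _))))
      (sum_mem fun _ _ => mul_mem_preBidegree (kappa_mem _) (gam_weyl_mem _ _))

theorem preD_mul (z w : Pre) : preD (z * w) = preD z * w + parity z * preD w := oddDer_mul _ z w

theorem preI_mul (z w : Pre) : preI (z * w) = preI z * w + z * preI w := evenDer_mul _ z w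

theorem preD_fn (x : Coord) : preD (fn x) = diff x := twistedDer_gen _ _ _

theorem preD_diff (x : Coord) : preD (diff x) = 0 := twistedDer_gen _ _ _

theorem preI_fn (x : Coord) : preI (fn x) = 0 := twistedDer_gen _ _ _

theorem preI_diff (x : Coord) : preI (diff x) = qCoord x := twistedDer_gen _ _ _

theorem parity_preD (z : Pre) : parity (preD z) = -preD (parity z) := by
  refine parity_oddDer (fun x => ?_) z
  cases x with
  | fn x =>
    rw [parity_of_mem (diff_mem x)]
    simp [Gen.deg, Gen.formDeg, Gen.gh, pow_add]
  | diff x => simp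

theorem parity_preI (z : Pre) : parity (preI z) = preI (parity z) := by
  refine parity_evenDer (fun x => ?_) z
  cases x with
  | fn x => simp
  | diff x =>
    dsimp only
    rw [parity_of_mem (qCoord_mem x), Gen.deg, Gen.formDeg, Gen.gh, zero_add, add_comm]

theorem preD_preD (z : Pre) : preD (preD z) = 0 := by
  induction z using FreeAlgebra.induction with
  | grade0 r => simp [preD, oddDer, twistedDer_algebraMap]
  | grade1 x =>
    cases x with
    | fn x => exact (congrArg preD (preD_fn x)).trans (preD_diff x)
    | diff x => exact (congrArg preD (preD_diff x)).trans (map_zero _)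
  | mul z w hz hw =>
    simp only [preD_mul, map_add, hz, hw, parity_preD]
    simp
  | add z w hz hw => simp only [map_add, hz, hw, add_zero]

/-- The Lie derivative along `q` on the free algebra. -/
def preLie : Pre →ₗ[ℝ] Pre := preI ∘ₗ preD - preD ∘ₗ preI

theorem preLie_apply (z : Pre) : preLie z = preI (preD z) - preD (preI z) := rfl

theorem preLie_mul (z w : Pre) : preLie (z * w) = preLie z * w + parity z * preLie w := by
  simp only [preLie_apply, preD_mul, preI_mul, map_add, parity_preI]
  noncomm_ring

theorem preLie_algebraMap (r : ℝ) : preLie (algebraMap ℝ Pre r) = 0 := by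
  simp [preLie_apply, preD, preI, oddDer, evenDer, twistedDer_algebraMap]

theorem parity_preLie (z : Pre) : parity (preLie z) = -preLie (parity z) := by
  simp only [preLie_apply, map_sub, parity_preI, parity_preD, map_neg]
  noncomm_ring

theorem preLie_preD (z : Pre) : preLie (preD z) = -preD (preLie z) := by
  simp [preLie_apply, preD_preD]

theorem preLie_fn (x : Coord) : preLie (fn x) = qCoord x := by
  rw [preLie_apply, preI_fn, preD_fn, preI_diff, map_zero, sub_zero]

theorem preLie_diff (x : Coord) : preLie (diff x) = -preD (qCoord x) := by
  rw [← preD_fn, preLie_preD, preLie_fn]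

theorem lieQ_form (z : Pre) : lieQ (form z) = form (preLie z) := by
  rw [preLie_apply, map_sub]; rfl

theorem d_form (z : Pre) : d (form z) = form (preD z) := rfl

theorem contrQ_form (z : Pre) : contrQ (form z) = form (preI z) := rfl

theorem preI_eq_zero {g : ℕ} {z : Pre} (hz : z ∈ preBidegree 0 g) : preI z = 0 := by
  induction hz using Submodule.span_induction with
  | mem z hz =>
    obtain ⟨l, h₁, -, rfl⟩ := hz
    induction l with
    | nil => exact twistedDer_one _ _
    | cons x l ih =>
      cases x with
      | fn x =>
        simp only [List.map_cons, List.sum_cons, Gen.formDeg, zero_add] at h₁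
        rw [List.map_cons, List.prod_cons, preI_mul, ih h₁]
        have : preI (FreeAlgebra.ι ℝ (Gen.fn x)) = 0 := preI_fn x
        rw [this, zero_mul, mul_zero, add_zero]
      | diff x => simp [Gen.formDeg] at h₁
  | zero => simp
  | add _ _ _ _ h h' => rw [map_add, h, h', add_zero]
  | smul r _ _ h => rw [map_smul, h, smul_zero]

/-- On functions, `i_q d` is the vector field itself. -/
theorem preI_preD {g : ℕ} {z : Pre} (hz : z ∈ preBidegree 0 g) : preI (preD z) = preLie z := by
  rw [preLie_apply, preI_eq_zero hz, map_zero, sub_zero]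

theorem preD_mem {p g : ℕ} {z : Pre} (hz : z ∈ preBidegree p g) :
    preD z ∈ preBidegree (p + 1) g := by
  refine oddDer_mem (a := 1) (b := 0) ?_ hz
  rintro (x | x)
  · exact diff_mem x
  · exact zero_mem _

theorem preLie_eq_oddDer (z : Pre) : preLie z = oddDer (fun x => preLie (FreeAlgebra.ι ℝ x)) z := by
  induction z using FreeAlgebra.induction with
  | grade0 r => rw [preLie_algebraMap, oddDer, twistedDer_algebraMap]
  | grade1 x => rw [oddDer, twistedDer_gen]
  | mul z w hz hw => rw [preLie_mul, oddDer_mul, ← hz, ← hw]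
  | add z w hz hw => rw [map_add, map_add, hz, hw]

theorem preLie_mem {p g : ℕ} {z : Pre} (hz : z ∈ preBidegree p g) :
    preLie z ∈ preBidegree p (g + 1) := by
  rw [preLie_eq_oddDer]
  refine oddDer_mem (a := 0) (b := 1) ?_ hz
  rintro (x | x)
  · have : preLie (FreeAlgebra.ι ℝ (Gen.fn x)) = qCoord x := preLie_fn x
    rw [this]
    exact qCoord_mem x
  · have : preLie (FreeAlgebra.ι ℝ (Gen.diff x)) = -preD (qCoord x) := preLie_diff x
    rw [this]
    exact neg_mem (preD_mem (qCoord_mem x))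

/-- `L_q` squares to zero as soon as it does so on the coordinates, because `L_q²` is a derivation
commuting with `d`. -/
theorem vanishes_preLie_preLie (h : ∀ x : Coord, Vanishes (preLie (qCoord x))) (z : Pre) :
    Vanishes (preLie (preLie z)) := by
  induction z using FreeAlgebra.induction with
  | grade0 r => rw [preLie_algebraMap, map_zero]; exact .zero
  | grade1 x =>
    cases x with
    | fn x =>
      have : preLie (FreeAlgebra.ι ℝ (Gen.fn x)) = qCoord x := preLie_fn x
      rw [this]
      exact h x
    | diff x =>
      have : preLie (FreeAlgebra.ι ℝ (Gen.diff x)) = -preD (qCoord x) := preLie_diff x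
      rw [this, map_neg, preLie_preD, neg_neg]
      exact (h x).preD
  | mul z w hz hw =>
    have : preLie (preLie (z * w)) = preLie (preLie z) * w + z * preLie (preLie w) := by
      simp only [preLie_mul, map_add, parity_preLie, parity_parity]
      noncomm_ring
    rw [this]
    exact (hz.mul_right _).add (hw.mul_left _)
  | add z w hz hw => rw [map_add, map_add]; exact hz.add hw

/-! ### Graded commutativity -/

theorem form_gen_mul_gen (x y : Gen) : form (FreeAlgebra.ι ℝ x) * form (FreeAlgebra.ι ℝ y)
    = ((-1 : ℝ) ^ (x.deg * y.deg)) • (form (FreeAlgebra.ι ℝ y) * form (FreeAlgebra.ι ℝ x)) := by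
  have := (form_eq_zero_iff _).2 (Vanishes.graded_comm x y)
  rw [map_sub, map_smul, map_mul, map_mul] at this
  exact sub_eq_zero.1 this

theorem form_mul_comm {p g p' g' : ℕ} {z w : Pre} (hz : z ∈ preBidegree p g)
    (hw : w ∈ preBidegree p' g') :
    form z * form w = ((-1 : ℝ) ^ ((p + g) * (p' + g'))) • (form w * form z) := by
  induction hz, hw using Submodule.span_induction₂ with
  | mem_mem z w hz hw =>
    obtain ⟨l, rfl, rfl, rfl⟩ := hz
    obtain ⟨m, rfl, rfl, rfl⟩ := hw
    induction l with
    | nil => simp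
    | cons x l ih =>
      have hx : form (FreeAlgebra.ι ℝ x) * form ((m.map (FreeAlgebra.ι ℝ)).prod)
          = ((-1 : ℝ) ^ (x.deg * ((m.map Gen.formDeg).sum + (m.map Gen.gh).sum))) •
            (form ((m.map (FreeAlgebra.ι ℝ)).prod) * form (FreeAlgebra.ι ℝ x)) := by
        clear ih
        induction m with
        | nil => simp
        | cons y m ih =>
          simp only [List.map_cons, List.prod_cons, map_mul, List.sum_cons]
          rw [← mul_assoc, form_gen_mul_gen, smul_mul_assoc, mul_assoc, ih, mul_smul_comm,
            smul_smul, ← pow_add, ← mul_assoc]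
          congr 2
          simp only [Gen.deg]; ring
      simp only [List.map_cons, List.prod_cons, map_mul, List.sum_cons] at hx ih ⊢
      rw [mul_assoc, ih, mul_smul_comm, ← mul_assoc, hx, smul_mul_assoc, smul_smul, ← pow_add,
        ← mul_assoc]
      congr 2
      simp only [Gen.deg]; ring
  | zero_left => simp
  | zero_right => simp
  | add_left _ _ _ _ _ _ h h' =>
    rw [map_add, add_mul _ _ (form _), h, h', mul_add (form _), smul_add]
  | add_right _ _ _ _ _ _ h h' =>
    rw [map_add, mul_add (form _), h, h', add_mul _ _ (form _), smul_add]
  | smul_left r _ _ _ _ h => rw [map_smul, smul_mul_assoc, h, mul_smul_comm, smul_comm]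
  | smul_right r _ _ _ _ h => rw [map_smul, mul_smul_comm, h, smul_mul_assoc, smul_comm]

/-- Forms of even total degree are central. -/
theorem form_commute {p g : ℕ} {z : Pre} (hz : z ∈ preBidegree p g) (h : Even (p + g)) (u : Forms) :
    form z * u = u * form z := by
  obtain ⟨w, rfl⟩ := form_surjective u
  change Commute (form z) (form w)
  induction w using FreeAlgebra.induction with
  | grade0 r => rw [AlgHom.commutes]; exact (Algebra.commutes r _).symm
  | grade1 x =>
    have := form_mul_comm hz (gen_mem_preBidegree x)
    rwa [Even.neg_one_pow (h.mul_right _), one_smul] at this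
  | mul z w hz hw => rw [map_mul]; exact hz.mul_right hw
  | add z w hz hw => rw [map_add]; exact hz.add_right hw

/-- Forms of odd total degree anticommute. -/
theorem form_anticomm {p g p' g' : ℕ} {z w : Pre} (hz : z ∈ preBidegree p g)
    (hw : w ∈ preBidegree p' g') (h : Odd (p + g)) (h' : Odd (p' + g')) :
    form z * form w = -(form w * form z) := by
  rw [form_mul_comm hz hw, Odd.neg_one_pow (h.mul h'), neg_smul, one_smul]

/-! ### The conformal algebra acting on the Weyl coordinates -/

theorem delta_self (a : Fin 4) : delta a a = 1 := if_pos rfl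

theorem delta_ne {a b : Fin 4} (h : a ≠ b) : delta a b = 0 := if_neg h

theorem delta_comm (a b : Fin 4) : delta a b = delta b a := by
  simp only [delta, eq_comm]

theorem eta_eq_delta (a b : Fin 4) : eta a b = sgn a * delta b a := by
  simp only [eta_eq, delta, eq_comm (a := b), mul_ite, mul_one, mul_zero]

theorem gam_mem_weylSpan_pred (j : Fin 4) {k : ℕ} {z : Pre} (hz : z ∈ weylSpan k) :
    gam j z ∈ weylSpan (k - 1) := by
  rcases k with _ | k
  · rw [gam_zero j hz]; exact zero_mem _
  · exact gam_mem_weylSpan j hz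

/-- The generator of `gl(4)` that replaces, slot by slot, the index value `a` by `b`, as a
derivation (zero on the generators other than the Weyl coordinates). -/
def rot (a b : Fin 4) : Pre →ₗ[ℝ] Pre :=
  evenDer fun
    | .fn (.weyl _ i) => ∑ s, delta (i s) a • weyl (Function.update i s b)
    | _ => 0

theorem rot_weyl (a b : Fin 4) {k : ℕ} (i : Fin (4 + k) → Fin 4) :
    rot a b (weyl i) = ∑ s, delta (i s) a • weyl (Function.update i s b) := twistedDer_gen _ _ _

theorem rot_mem_weylSpan (a b : Fin 4) {k : ℕ} {z : Pre} (hz : z ∈ weylSpan k) :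
    rot a b z ∈ weylSpan k :=
  weylSpan_map (fun i => by
    rw [rot_weyl]
    exact sum_mem fun _ _ => Submodule.smul_mem _ _ (weyl_mem_weylSpan _)) hz

theorem appendIndex_castSucc {k : ℕ} (i : Fin (4 + k) → Fin 4) (e : Fin 4) (s : Fin (4 + k)) :
    appendIndex i e (Fin.castSucc s) = i s := Fin.snoc_castSucc (α := fun _ => Fin 4) _ _ _

theorem appendIndex_last {k : ℕ} (i : Fin (4 + k) → Fin 4) (e : Fin 4) :
    appendIndex i e (Fin.last (4 + k)) = e := Fin.snoc_last (α := fun _ => Fin 4) _ _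

theorem update_appendIndex_castSucc {k : ℕ} (i : Fin (4 + k) → Fin 4) (e : Fin 4)
    (s : Fin (4 + k)) (m : Fin 4) :
    Function.update (appendIndex i e) (Fin.castSucc s) m = appendIndex (Function.update i s m) e :=
  (Fin.snoc_update (α := fun _ => Fin 4) _ _ _ _).symm

theorem update_appendIndex_last {k : ℕ} (i : Fin (4 + k) → Fin 4) (e m : Fin 4) :
    Function.update (appendIndex i e) (Fin.last (4 + k)) m = appendIndex i m :=
  Fin.update_snoc_last (α := fun _ => Fin 4) _ _ _

theorem rot_covD (a b e : Fin 4) {k : ℕ} {z : Pre} (hz : z ∈ weylSpan k) :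
    rot a b (covD e z) = covD e (rot a b z) + delta e a • covD b z := by
  refine weylSpan_ext (f := rot a b ∘ₗ covD e) (g := covD e ∘ₗ rot a b + delta e a • covD b)
    (fun i => ?_) hz
  have h : rot a b (weyl (appendIndex i e)) = ∑ s : Fin (4 + k + 1),
    delta (appendIndex i e s) a • weyl (Function.update (appendIndex i e) s b) := rot_weyl _ _ _
  rw [Fin.sum_univ_castSucc] at h
  simp only [LinearMap.comp_apply, LinearMap.add_apply, LinearMap.smul_apply, covD_weyl, h,
    appendIndex_castSucc, appendIndex_last, update_appendIndex_castSucc, update_appendIndex_last,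
    rot_weyl, map_sum, map_smul]

theorem gam_covD (j e : Fin 4) {k : ℕ} {z : Pre} (hz : z ∈ weylSpan k) :
    gam j (covD e z) = covD e (gam j z) - (((k : ℝ) + 2) * delta j e) • z
      + ((sgn e * sgn j) • rot e j z - rot j e z) := by
  refine weylSpan_ext (f := gam j ∘ₗ covD e) (g := covD e ∘ₗ gam j
    - (((k : ℝ) + 2) * delta j e) • LinearMap.id + ((sgn e * sgn j) • rot e j - rot j e))
    (fun i => ?_) hz
  simp only [LinearMap.comp_apply, LinearMap.add_apply, LinearMap.sub_apply, LinearMap.smul_apply,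
    LinearMap.id_apply, covD_weyl, gam_weyl, gammaWeyl, appendIndex_castSucc, appendIndex_last,
    rot_weyl, sum_eta_smul, Finset.sum_sub_distrib, Finset.smul_sum, smul_smul, eta_eq_delta e,
    delta_comm j (i _)]
  congr 2
  refine Finset.sum_congr rfl fun s _ => ?_
  congr 1
  ring

/-- The composition of two of the operators `rot` splits into a part where both act on the same slot
and a part where they act on two different slots. -/
theorem rot_rot_weyl {k : ℕ} (i : Fin (4 + k) → Fin 4) (a b c d : Fin 4) :
    rot a b (rot c d (weyl i)) = delta d a • rot c b (weyl i)
      + ∑ s, ∑ t, (if t = s then 0 else (delta (i s) c * delta (i t) a) •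
          weyl (Function.update (Function.update i s d) t b)) := by
  simp only [rot_weyl, map_sum, map_smul, Finset.smul_sum, smul_smul]
  rw [← Finset.sum_add_distrib]
  refine Finset.sum_congr rfl fun s _ => ?_
  rw [← Finset.add_sum_erase _ _ (Finset.mem_univ s),
    ← Finset.add_sum_erase _ _ (Finset.mem_univ s)]
  simp only [Function.update_self, Function.update_idem, if_true, zero_add]
  rw [mul_comm (delta (i s) c)]
  congr 1
  refine Finset.sum_congr rfl fun t ht => ?_
  have ht := Finset.ne_of_mem_erase ht
  rw [if_neg ht, Function.update_of_ne ht]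

theorem rot_rot (a b c d : Fin 4) {k : ℕ} {z : Pre} (hz : z ∈ weylSpan k) :
    rot a b (rot c d z) - rot c d (rot a b z)
      = delta d a • rot c b z - delta b c • rot a d z := by
  refine weylSpan_ext (f := rot a b ∘ₗ rot c d - rot c d ∘ₗ rot a b)
    (g := delta d a • rot c b - delta b c • rot a d) (fun i => ?_) hz
  simp only [LinearMap.comp_apply, LinearMap.sub_apply, LinearMap.smul_apply, rot_rot_weyl]
  rw [add_sub_add_comm, Finset.sum_comm, ← Finset.sum_sub_distrib]
  convert add_zero _
  refine Finset.sum_eq_zero fun s _ => ?_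
  rw [← Finset.sum_sub_distrib]
  refine Finset.sum_eq_zero fun t _ => ?_
  by_cases h : s = t
  · simp [h]
  · rw [if_neg h, if_neg (Ne.symm h), Function.update_comm h, mul_comm, sub_self]

/-- The Lorentz generators, as the combinations of the `rot a b` that preserve the metric. -/
def lorentz (a m : Fin 4) : Pre →ₗ[ℝ] Pre := sgn m • rot a m - sgn a • rot m a

theorem lorentz_apply (a m : Fin 4) (z : Pre) :
    lorentz a m z = sgn m • rot a m z - sgn a • rot m a z := rfl

theorem lorentz_mem_weylSpan (a m : Fin 4) {k : ℕ} {z : Pre} (hz : z ∈ weylSpan k) :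
    lorentz a m z ∈ weylSpan k :=
  sub_mem (Submodule.smul_mem _ _ (rot_mem_weylSpan _ _ hz))
    (Submodule.smul_mem _ _ (rot_mem_weylSpan _ _ hz))

theorem lorentz_covD (a m e : Fin 4) {k : ℕ} {z : Pre} (hz : z ∈ weylSpan k) :
    lorentz a m (covD e z) = covD e (lorentz a m z)
      + (sgn m * delta e a) • covD m z - (sgn a * delta e m) • covD a z := by
  simp only [lorentz_apply, rot_covD _ _ _ hz, map_sub, map_smul]
  module

theorem exists_eq_appendIndex {k : ℕ} (i : Fin (4 + (k + 1)) → Fin 4) :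
    ∃ (i' : Fin (4 + k) → Fin 4) (e : Fin 4), i = appendIndex i' e :=
  ⟨fun s => i (Fin.castSucc s), i (Fin.last (4 + k)),
    (Fin.snoc_init_self (α := fun _ : Fin (4 + k + 1) => Fin 4) i).symm⟩

theorem sgn_mul_delta (a b : Fin 4) : sgn a * delta a b = sgn b * delta a b := by
  by_cases h : a = b
  · rw [h]
  · rw [delta_ne h, mul_zero, mul_zero]

/-- The commutator of a special conformal generator and a translation is a dilation plus a Lorentz
rotation. -/
theorem gam_covD_lorentz (j e : Fin 4) {k : ℕ} {z : Pre} (hz : z ∈ weylSpan k) :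
    gam j (covD e z) = covD e (gam j z) - (((k : ℝ) + 2) * delta j e) • z
      - sgn e • lorentz j e z := by
  rw [gam_covD j e hz, lorentz_apply, smul_sub, sgn_smul_sgn_smul, smul_smul]
  abel

theorem sgn_mul_sgn_mul_delta (a b : Fin 4) : sgn a * sgn b * delta a b = delta a b := by
  rw [mul_assoc, ← sgn_mul_delta, ← mul_assoc, sgn_mul_self, one_mul]

theorem lorentz_antisymm (a m : Fin 4) (z : Pre) : lorentz a m z = -lorentz m a z := by
  simp only [lorentz_apply, neg_sub]

theorem lorentz_lorentz (a m j e : Fin 4) {k : ℕ} {z : Pre} (hz : z ∈ weylSpan k) :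
    lorentz a m (lorentz j e z) - lorentz j e (lorentz a m z)
      = (sgn a * delta e a) • lorentz j m z - (sgn m * delta e m) • lorentz j a z
        - (sgn a * delta j a) • lorentz e m z + (sgn m * delta j m) • lorentz e a z := by
  have h₁ := rot_rot a m j e hz
  have h₂ := rot_rot a m e j hz
  have h₃ := rot_rot m a j e hz
  have h₄ := rot_rot m a e j hz
  have e₁ := sgn_mul_delta e a
  have e₂ := sgn_mul_delta e m
  have e₃ := sgn_mul_delta j a
  have e₄ := sgn_mul_delta j m
  rw [delta_comm m j] at h₁
  rw [delta_comm m e] at h₂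
  rw [delta_comm a j] at h₃
  rw [delta_comm a e] at h₄
  simp only [lorentz_apply, map_sub, map_smul]
  linear_combination (norm := module) (sgn m * sgn e) • h₁ - (sgn m * sgn j) • h₂
    - (sgn a * sgn e) • h₃ + (sgn a * sgn j) • h₄ + e₁ • (sgn m • rot j m z)
    - e₂ • (sgn a • rot j a z) - e₃ • (sgn m • rot e m z) + e₄ • (sgn a • rot e a z)

/-- Lorentz covariance of the special conformal generators. -/
theorem lorentz_gam (a m j : Fin 4) {k : ℕ} {z : Pre} (hz : z ∈ weylSpan k) :
    lorentz a m (gam j z) = gam j (lorentz a m z)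
      + (sgn j * delta j a) • gam m z - (sgn j * delta j m) • gam a z := by
  induction k generalizing z with
  | zero =>
    rw [gam_zero _ hz, gam_zero _ hz, gam_zero _ hz, gam_zero _ (lorentz_mem_weylSpan a m hz)]
    simp
  | succ k ih =>
    refine weylSpan_ext (f := lorentz a m ∘ₗ gam j) (g := gam j ∘ₗ lorentz a m
      + (sgn j * delta j a) • gam m - (sgn j * delta j m) • gam a) (fun i => ?_) hz
    obtain ⟨i', e, rfl⟩ := exists_eq_appendIndex i
    have hi := weyl_mem_weylSpan i'
    simp only [LinearMap.comp_apply, LinearMap.add_apply, LinearMap.sub_apply,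
      LinearMap.smul_apply, ← covD_weyl]
    rw [gam_covD_lorentz j e hi, lorentz_covD a m e hi]
    simp only [map_add, map_sub, map_smul, gam_covD_lorentz _ _ hi,
      gam_covD_lorentz _ _ (lorentz_mem_weylSpan _ _ hi),
      lorentz_covD a m e (gam_mem_weylSpan_pred j hi), ih hi]
    rw [lorentz_antisymm m e, lorentz_antisymm a e, delta_comm m e, delta_comm a e]
    have e₁ := sgn_mul_delta j a
    have e₂ := sgn_mul_delta j m
    linear_combination (norm := module) (-sgn e) • lorentz_lorentz a m j e hi
      - sgn_mul_sgn_mul_delta e a • lorentz j m (weyl i')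
      + (delta e a) • sgn_mul_self m • lorentz j m (weyl i')
      + sgn_mul_sgn_mul_delta e m • lorentz j a (weyl i')
      - (delta e m) • sgn_mul_self a • lorentz j a (weyl i')
      - e₁ • (sgn e • lorentz e m (weyl i')) + e₂ • (sgn e • lorentz e a (weyl i'))
      + e₁ • ((((k : ℝ) + 2) * delta e m) • weyl i')
      - e₂ • ((((k : ℝ) + 2) * delta e a) • weyl i')

/-- The special conformal generators commute: with `gam_covD_lorentz` and `lorentz_gam` this follows
by induction on the number of derivatives. -/
theorem gam_gam (i j : Fin 4) {k : ℕ} {z : Pre} (hz : z ∈ weylSpan k) :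
    gam i (gam j z) = gam j (gam i z) := by
  induction k generalizing z with
  | zero => rw [gam_zero _ hz, gam_zero _ hz, map_zero, map_zero]
  | succ k ih =>
    refine weylSpan_ext (f := gam i ∘ₗ gam j) (g := gam j ∘ₗ gam i) (fun t => ?_) hz
    obtain ⟨t', e, rfl⟩ := exists_eq_appendIndex t
    have ht := weyl_mem_weylSpan t'
    -- the weight of `Γ^j T` is one less than that of `T`; for `k = 0` it vanishes
    have key : ∀ i j, gam i (covD e (gam j (weyl t'))) = covD e (gam i (gam j (weyl t')))
        - (((k : ℝ) + 1) * delta i e) • gam j (weyl t')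
        - sgn e • lorentz i e (gam j (weyl t')) := by
      intro i j
      rcases k with _ | k
      · simp [gam_zero _ ht]
      · rw [gam_covD_lorentz i e (gam_mem_weylSpan j ht)]
        congr 3
        push_cast
        ring
    simp only [LinearMap.comp_apply, ← covD_weyl, gam_covD_lorentz _ _ ht, map_sub, map_smul, key,
      ih ht, lorentz_gam _ _ _ ht]
    rw [delta_comm j i]
    linear_combination (norm := module) sgn_mul_sgn_mul_delta j e • gam i (weyl t')
      - sgn_mul_sgn_mul_delta i e • gam j (weyl t')
      + sgn_mul_delta i j • (sgn e • gam e (weyl t'))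

/-! ### The action of `q` on the Weyl coordinates -/

theorem eq_zero_of_eq_neg {M : Type*} [AddCommGroup M] [Module ℝ M] {z : M} (h : z = -z) :
    z = 0 := by
  have h₂ : (2 : ℝ) • z = 0 := by
    rw [two_smul]
    nth_rewrite 2 [h]
    exact add_neg_cancel _
  exact (smul_eq_zero.1 h₂).resolve_left two_ne_zero

theorem sum_sum_antisymm {M : Type*} [AddCommGroup M] [Module ℝ M] {ι : Type*} [Fintype ι]
    (F : ι → ι → M) (h : ∀ a b, F a b = -F b a) : ∑ a, ∑ b, F a b = 0 := by
  refine eq_zero_of_eq_neg ?_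
  conv_lhs => rw [Finset.sum_comm]
  simp only [← Finset.sum_neg_distrib]
  exact Finset.sum_congr rfl fun a _ => Finset.sum_congr rfl fun b _ => h b a

theorem sum_comm₃ {M ι κ ν : Type*} [AddCommMonoid M] [Fintype ι] [Fintype κ] [Fintype ν]
    (F : ι → κ → ν → M) : ∑ a, ∑ b, ∑ c, F a b c = ∑ c, ∑ a, ∑ b, F a b c := by
  rw [Finset.sum_comm (s := Finset.univ (α := ν))]
  exact Finset.sum_congr rfl fun a _ => Finset.sum_comm

theorem sum_comm₄ {M ι κ ν μ : Type*} [AddCommMonoid M] [Fintype ι] [Fintype κ] [Fintype ν]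
    [Fintype μ] (F : ι → κ → ν → μ → M) :
    ∑ a, ∑ b, ∑ c, ∑ d, F a b c d = ∑ c, ∑ d, ∑ a, ∑ b, F a b c d := by
  rw [sum_comm₃]
  exact Finset.sum_congr rfl fun c _ => sum_comm₃ _

theorem preLie_weylSpan {k : ℕ} {z : Pre} (hz : z ∈ weylSpan k) :
    preLie z = (∑ e, xi e * covD e z) + (∑ a, ∑ m, sgn m • (rho a m * rot a m z))
      + ((k : ℝ) + 2) • (lam * z) + ∑ j, kappa j * gam j z := by
  have h := weylSpan_ext (f := preLie) (g := (∑ e, LinearMap.mulLeft ℝ (xi e) ∘ₗ covD e)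
    + (∑ a, ∑ m, sgn m • (LinearMap.mulLeft ℝ (rho a m) ∘ₗ rot a m))
    + ((k : ℝ) + 2) • LinearMap.mulLeft ℝ lam + ∑ j, LinearMap.mulLeft ℝ (kappa j) ∘ₗ gam j)
    (fun i => ?_) hz
  · simpa [LinearMap.sum_apply] using h
  · have h₁ : preLie (weyl i) = qCoord (.weyl k i) := preLie_fn _
    rw [h₁]
    simp only [qCoord, LinearMap.add_apply, LinearMap.sum_apply, LinearMap.smul_apply,
      LinearMap.comp_apply, LinearMap.mulLeft_apply, sum_eta_smul, rot_weyl, Finset.mul_sum,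
      mul_smul_comm, Finset.smul_sum]
    congr 3
    rw [sum_comm₃]
    refine Finset.sum_congr rfl fun s _ => ?_
    rw [Finset.sum_comm]
    refine Finset.sum_congr rfl fun m _ => ?_
    simp only [smul_comm (sgn m), sum_delta_smul]

/-- As `Γ^j` lowers the number of derivatives by one, the weight of `Γ^j T` is one less than that of
`T`; without derivatives both sides vanish. -/
theorem preLie_gam (j : Fin 4) {k : ℕ} {z : Pre} (hz : z ∈ weylSpan k) :
    preLie (gam j z) = (∑ e, xi e * covD e (gam j z))
      + (∑ a, ∑ m, sgn m • (rho a m * rot a m (gam j z)))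
      + ((k : ℝ) + 1) • (lam * gam j z) + ∑ i, kappa i * gam i (gam j z) := by
  rcases k with _ | k
  · simp [gam_zero _ hz]
  · rw [preLie_weylSpan (gam_mem_weylSpan j hz)]
    congr 3
    push_cast
    ring

theorem form_commutator {k : ℕ} {z : Pre} (hz : z ∈ weylSpan k) (c d : Fin 4) :
    form (covD c (covD d z)) - form (covD d (covD c z))
      = -(∑ b, form (C b c d) * form (gam b z))
        - ∑ a, ∑ m, sgn m • (form (W a m c d) * form (rot a m z)) := by
  have h := weylSpan_ext (f := form.toLinearMap ∘ₗ (covD c ∘ₗ covD d - covD d ∘ₗ covD c))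
    (g := form.toLinearMap ∘ₗ (-(∑ b, LinearMap.mulLeft ℝ (C b c d) ∘ₗ gam b)
        - ∑ a, ∑ m, sgn m • (LinearMap.mulLeft ℝ (W a m c d) ∘ₗ rot a m))) (fun i => ?_) hz
  · simpa [LinearMap.sum_apply] using h
  · have h := (form_eq_zero_iff _).2 (.weyl (.commutator c d k i))
    simp only [map_add, map_sub, map_sum, map_mul, map_smul, sum_eta_smul] at h
    simp only [LinearMap.comp_apply, LinearMap.sub_apply, LinearMap.neg_apply, LinearMap.sum_apply,
      LinearMap.smul_apply, LinearMap.mulLeft_apply, AlgHom.toLinearMap_apply, map_sub, map_neg,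
      map_sum, map_smul, map_mul, rot_weyl]
    have e : ∑ a, ∑ m, sgn m • (form (W a m c d)
          * ∑ s, delta (i s) a • form (weyl (Function.update i s m)))
        = ∑ s, ∑ m, sgn m • (form (W (i s) m c d) * form (weyl (Function.update i s m))) := by
      simp only [Finset.mul_sum, Finset.smul_sum, mul_smul_comm]
      rw [sum_comm₃]
      refine Finset.sum_congr rfl fun s _ => ?_
      rw [Finset.sum_comm]
      refine Finset.sum_congr rfl fun m _ => ?_
      simp only [smul_comm (sgn m), sum_delta_smul]
    simp only [Finset.mul_sum, Finset.smul_sum, mul_smul_comm] at e ⊢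
    rw [e]
    linear_combination (norm := module) h

section Ring

variable {A : Type*} [Ring A] [Algebra ℝ A]

theorem sum_antisymm_mul {ι : Type*} [Fintype ι] {X : ι → ι → A} (hX : ∀ a b, X a b = -X b a)
    (H : ι → ι → A) :
    ∑ a, ∑ b, X a b * H a b = (1 / 2 : ℝ) • ∑ a, ∑ b, X a b * (H a b - H b a) := by
  have h := sum_sum_antisymm (fun a b => X a b * (H a b + H b a)) fun a b => by
    rw [hX, neg_mul, add_comm]
  simp only [mul_add, mul_sub, Finset.sum_add_distrib, Finset.sum_sub_distrib] at h ⊢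
  linear_combination (norm := module) (1 / 2 : ℝ) • h

/-- The Chevalley–Eilenberg identity for the conformal algebra acting on a module: the odd
operator `x D + r R + (w + 2) l + κ Γ` squares to zero once the commutators of `D`, `R`, `Γ`
cancel the terms from the structure equations for `x`, `r`, `l`, `κ`. -/
theorem chevalleyEilenberg_sq (w : ℝ) (x κ : Fin 4 → A) (r : Fin 4 → Fin 4 → A) (l : A)
    (Cc : Fin 4 → Fin 4 → Fin 4 → A) (Ww : Fin 4 → Fin 4 → Fin 4 → Fin 4 → A)
    (hxx : ∀ a b, x a * x b = -(x b * x a)) (hκκ : ∀ a b, κ a * κ b = -(κ b * κ a))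
    (hxκ : ∀ a b, x a * κ b = -(κ b * x a)) (hxr : ∀ a b c, x a * r b c = -(r b c * x a))
    (hxl : ∀ a, x a * l = -(l * x a)) (hκl : ∀ a, κ a * l = -(l * κ a))
    (hrκ : ∀ a b c, r a b * κ c = -(κ c * r a b)) (hrl : ∀ a b, r a b * l = -(l * r a b))
    (hrr : ∀ a b c d, r a b * r c d = -(r c d * r a b)) (hll : l * l = 0)
    (hr : ∀ a b, r a b = -r b a)
    (z : A) (D G : Fin 4 → A) (DD DG GD GG R : Fin 4 → Fin 4 → A)
    (DR RD RG GR : Fin 4 → Fin 4 → Fin 4 → A) (RR : Fin 4 → Fin 4 → Fin 4 → Fin 4 → A)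
    (hDD : ∀ c d, DD c d - DD d c = -(∑ b, Cc b c d * G b) - ∑ a, ∑ m, sgn m • (Ww a m c d * R a m))
    (hRD : ∀ a m e, RD a m e = DR e a m + delta e a • D m)
    (hGD : ∀ j e, GD j e = DG e j - ((w + 2) * delta j e) • z + ((sgn e * sgn j) • R e j - R j e))
    (hRR : ∀ a b c d, RR a b c d - RR c d a b = delta d a • R c b - delta b c • R a d)
    (hRG : ∀ j a m, (sgn m • RG a m j - sgn a • RG m a j) = (sgn m • GR j a m - sgn a • GR j m a)
      + (sgn j * delta j a) • G m - (sgn j * delta j m) • G a)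
    (hGG : ∀ i j, GG i j = GG j i) :
    (∑ e, (((∑ c, sgn e • (r e c * x c)) + x e * l) * D e
        - x e * ((∑ f, x f * DD f e) + (∑ a, ∑ m, sgn m • (r a m * RD a m e))
          + (w + 3) • (l * D e) + ∑ j, κ j * GD j e)))
    + (∑ a, ∑ m, sgn m • (((∑ c, sgn c • (r a c * r c m))
          + (sgn a • (x a * κ m) - sgn m • (x m * κ a))
          + (1 / 2 : ℝ) • ∑ c, ∑ d, x c * x d * Ww a m c d) * R a m
        - r a m * ((∑ e, x e * DR e a m) + (∑ b, ∑ n, sgn n • (r b n * RR b n a m))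
          + (w + 2) • (l * R a m) + ∑ j, κ j * GR j a m)))
    + (w + 2) • ((∑ c, κ c * x c) * z - l * ((∑ e, x e * D e) + (∑ a, ∑ m, sgn m • (r a m * R a m))
          + (w + 2) • (l * z) + ∑ j, κ j * G j))
    + (∑ j, (((∑ c, sgn c • (κ c * r c j)) + l * κ j
          + (1 / 2 : ℝ) • ∑ c, ∑ d, x c * x d * Cc j c d) * G j
        - κ j * ((∑ e, x e * DG e j) + (∑ a, ∑ m, sgn m • (r a m * RG a m j))
          + (w + 1) • (l * G j) + ∑ i, κ i * GG i j))) = 0 := by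
  -- the square is sorted by the two ghost variables that occur
  have h_xx : -(∑ e, x e * ∑ f, x f * DD f e)
      + (∑ j, ((1 / 2 : ℝ) • ∑ c, ∑ d, x c * x d * Cc j c d) * G j)
      + (∑ a, ∑ m, sgn m • (((1 / 2 : ℝ) • ∑ c, ∑ d, x c * x d * Ww a m c d) * R a m)) = 0 := by
    have h := sum_antisymm_mul hxx (fun e f => DD f e)
    have e₁ : ∀ e f, DD f e - DD e f
        = (∑ b, Cc b e f * G b) + ∑ a, ∑ m, sgn m • (Ww a m e f * R a m) := by
      intro e f
      rw [← neg_sub, hDD]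
      abel
    have c₁ : ∑ j, ((1 / 2 : ℝ) • ∑ c, ∑ d, x c * x d * Cc j c d) * G j
        = (1 / 2 : ℝ) • ∑ e, ∑ f, x e * x f * ∑ b, Cc b e f * G b := by
      simp only [Finset.mul_sum, Finset.sum_mul, Finset.smul_sum, smul_mul_assoc, mul_assoc]
      exact (sum_comm₃ _).symm
    have c₂ : ∑ a, ∑ m, sgn m • (((1 / 2 : ℝ) • ∑ c, ∑ d, x c * x d * Ww a m c d) * R a m)
        = (1 / 2 : ℝ) • ∑ e, ∑ f, x e * x f * ∑ a, ∑ m, sgn m • (Ww a m e f * R a m) := by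
      simp only [Finset.mul_sum, Finset.sum_mul, Finset.smul_sum, smul_mul_assoc, mul_assoc,
        mul_smul_comm, smul_comm (sgn _) (1 / 2 : ℝ)]
      exact sum_comm₄ _
    simp only [e₁, mul_add, Finset.sum_add_distrib] at h
    have c₀ : ∑ e, x e * ∑ f, x f * DD f e = ∑ e, ∑ f, x e * x f * DD f e := by
      simp only [Finset.mul_sum, mul_assoc]
    rw [c₀, c₁, c₂, h]
    module
  have h_xr : (∑ e, (∑ c, sgn e • (r e c * x c)) * D e)
      - (∑ e, x e * (∑ a, ∑ m, sgn m • (r a m * RD a m e)))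
      - (∑ a, ∑ m, sgn m • (r a m * ∑ e, x e * DR e a m)) = 0 := by
    have h : ∑ e, x e * (∑ a, ∑ m, sgn m • (r a m * RD a m e))
        = -(∑ a, ∑ m, sgn m • (r a m * ∑ e, x e * DR e a m))
          + ∑ e, (∑ c, sgn e • (r e c * x c)) * D e := by
      have e₁ : ∀ e, x e * (∑ a, ∑ m, sgn m • (r a m * RD a m e))
          = -(∑ a, ∑ m, sgn m • (r a m * (x e * DR e a m)))
            + ∑ m, sgn m • (r m e * x e) * D m := by
        intro e
        have e₂ : ∀ a m, x e * (sgn m • (r a m * RD a m e))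
            = -(sgn m • (r a m * (x e * DR e a m)))
              + delta a e • (sgn m • (r m a * x e) * D m) := by
          intro a m
          rw [mul_smul_comm, ← mul_assoc, hxr, hRD, neg_mul, mul_add, mul_assoc, mul_smul_comm,
            hr m a, delta_comm a e, smul_mul_assoc, neg_mul, neg_mul]
          module
        simp only [Finset.mul_sum, e₂, Finset.sum_add_distrib, Finset.sum_neg_distrib]
        rw [Finset.sum_comm (f := fun a m => delta a e • _)]
        simp only [sum_delta_smul']
      simp only [e₁, Finset.sum_add_distrib, Finset.sum_neg_distrib, Finset.mul_sum,
        Finset.smul_sum, Finset.sum_mul]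
      rw [Finset.sum_comm (f := fun e m => sgn m • (r m e * x e) * D m)]
      congr 2
      rw [Finset.sum_comm]
      refine Finset.sum_congr rfl fun a _ => Finset.sum_comm
    rw [h]
    abel
  have h_xl : (∑ e, x e * l * D e) - (∑ e, x e * ((w + 3) • (l * D e)))
      - (w + 2) • (l * ∑ e, x e * D e) = 0 := by
    simp only [mul_smul_comm, ← mul_assoc, Finset.mul_sum, Finset.smul_sum, hxl, neg_mul, smul_neg,
      ← Finset.sum_sub_distrib]
    refine Finset.sum_eq_zero fun e _ => ?_
    module
  have h_xκ : -(∑ e, x e * ∑ j, κ j * GD j e)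
      + (∑ a, ∑ m, sgn m • ((sgn a • (x a * κ m) - sgn m • (x m * κ a)) * R a m))
      + (w + 2) • ((∑ c, κ c * x c) * z) - ∑ j, κ j * ∑ e, x e * DG e j = 0 := by
    have e₁ : ∀ e j, x e * (κ j * GD j e) = -(κ j * (x e * DG e j))
        + delta j e • ((w + 2) • (κ j * x e * z))
        - (sgn e * sgn j) • (κ j * x e * R e j) + κ j * x e * R j e := by
      intro e j
      rw [← mul_assoc, hxκ, hGD]
      simp only [neg_mul, mul_add, mul_sub, mul_smul_comm, ← mul_assoc]
      module
    have e₂ : ∀ a m, sgn m • ((sgn a • (x a * κ m) - sgn m • (x m * κ a)) * R a m)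
        = κ a * x m * R a m - (sgn a * sgn m) • (κ m * x a * R a m) := by
      intro a m
      rw [hxκ, hxκ]
      simp only [sub_mul, smul_mul_assoc, neg_mul, smul_sub, smul_neg, sgn_smul_sgn_smul]
      module
    simp only [Finset.mul_sum, Finset.sum_mul, Finset.smul_sum, e₁, e₂, Finset.sum_add_distrib,
      Finset.sum_sub_distrib, Finset.sum_neg_distrib, sum_delta_smul']
    rw [Finset.sum_comm (f := fun e j => κ j * (x e * DG e j)),
      Finset.sum_comm (f := fun e j => κ j * x e * R j e)]
    abel
  have h_rr : (∑ a, ∑ m, sgn m • ((∑ c, sgn c • (r a c * r c m)) * R a m))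
      - (∑ a, ∑ m, sgn m • (r a m * ∑ b, ∑ n, sgn n • (r b n * RR b n a m))) = 0 := by
    have h := sum_antisymm_mul (X := fun p q : Fin 4 × Fin 4 => r p.1 p.2 * r q.1 q.2)
      (fun p q => hrr _ _ _ _) (fun p q => (sgn p.2 * sgn q.2) • RR q.1 q.2 p.1 p.2)
    have e₁ : ∀ a m b n, (sgn m * sgn n) • RR b n a m - (sgn n * sgn m) • RR a m b n
        = delta m b • (sgn m * sgn n) • R a n - delta n a • (sgn m * sgn n) • R b m := by
      intro a m b n
      linear_combination (norm := module) (sgn m * sgn n) • hRR b n a m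
    simp only [e₁, mul_sub, mul_smul_comm, Finset.sum_sub_distrib, Fintype.sum_prod_type] at h
    have c₁ : ∑ a, ∑ m, ∑ b, ∑ n, delta m b • (sgn m * sgn n) • (r a m * r b n * R a n)
        = ∑ a, ∑ n, ∑ m, (sgn m * sgn n) • (r a m * r m n * R a n) := by
      refine Finset.sum_congr rfl fun a _ => ?_
      rw [sum_comm₃]
      simp only [sum_delta_smul]
    have c₂ : ∑ a, ∑ m, ∑ b, ∑ n, delta n a • (sgn m * sgn n) • (r a m * r b n * R b m)
        = -∑ a, ∑ n, ∑ m, (sgn m * sgn n) • (r a m * r m n * R a n) := by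
      simp only [sum_delta_smul']
      rw [sum_comm₃, ← Finset.sum_neg_distrib]
      refine Finset.sum_congr rfl fun b _ => ?_
      rw [Finset.sum_comm, ← Finset.sum_neg_distrib]
      refine Finset.sum_congr rfl fun m _ => ?_
      rw [← Finset.sum_neg_distrib]
      refine Finset.sum_congr rfl fun a _ => ?_
      rw [hrr a, neg_mul, smul_neg, mul_comm (sgn m)]
    rw [c₁, c₂] at h
    simp only [Finset.mul_sum, Finset.sum_mul, Finset.smul_sum, smul_mul_assoc, mul_smul_comm,
      smul_smul, ← mul_assoc] at h ⊢
    rw [h]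
    simp only [mul_comm (sgn _) (sgn (_ : Fin 4))]
    module
  have h_rl : -(∑ a, ∑ m, sgn m • (r a m * ((w + 2) • (l * R a m))))
      - (w + 2) • (l * ∑ a, ∑ m, sgn m • (r a m * R a m)) = 0 := by
    simp only [mul_smul_comm, ← mul_assoc, Finset.mul_sum, Finset.smul_sum, hrl, neg_mul, smul_neg,
      ← Finset.sum_sub_distrib, ← Finset.sum_neg_distrib]
    refine Finset.sum_eq_zero fun a _ => Finset.sum_eq_zero fun m _ => ?_
    module
  have h_rκ : -(∑ a, ∑ m, sgn m • (r a m * ∑ j, κ j * GR j a m))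
      + (∑ j, (∑ c, sgn c • (κ c * r c j)) * G j)
      - (∑ j, κ j * ∑ a, ∑ m, sgn m • (r a m * RG a m j)) = 0 := by
    have e₁ : ∀ j, ∑ a, ∑ m, sgn m • (r a m * RG a m j)
        = (∑ a, ∑ m, sgn m • (r a m * GR j a m)) + ∑ m, sgn j • (r j m * G m) := by
      intro j
      have h₁ := sum_antisymm_mul hr (fun a m => sgn m • RG a m j)
      have h₂ := sum_antisymm_mul hr (fun a m => sgn m • GR j a m)
      have h₃ : ∑ a, ∑ m, r a m * ((sgn j * delta j a) • G m)
          = ∑ m, sgn j • (r j m * G m) := by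
        rw [Finset.sum_comm]
        refine Finset.sum_congr rfl fun m _ => ?_
        simp only [mul_smul_comm, mul_comm (sgn j), mul_smul, sum_delta_smul]
      have h₄ : ∑ a, ∑ m, r a m * ((sgn j * delta j m) • G a)
          = -∑ m, sgn j • (r j m * G m) := by
        rw [← Finset.sum_neg_distrib]
        refine Finset.sum_congr rfl fun a _ => ?_
        simp only [mul_smul_comm, mul_comm (sgn j), mul_smul, sum_delta_smul]
        rw [hr a j, neg_mul, smul_neg]
      simp only [hRG, mul_add, mul_sub, Finset.sum_add_distrib, Finset.sum_sub_distrib, h₃, h₄]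
        at h₁ h₂
      simp only [mul_smul_comm] at h₁ h₂ ⊢
      linear_combination (norm := module) h₁ - h₂
    have e₂ : ∀ a m j, r a m * (κ j * GR j a m) = -(κ j * (r a m * GR j a m)) := by
      intro a m j
      rw [← mul_assoc, hrκ, neg_mul, mul_assoc]
    simp only [e₁, mul_add, Finset.mul_sum, Finset.sum_mul, Finset.smul_sum, e₂,
      Finset.sum_add_distrib, mul_smul_comm, smul_mul_assoc, smul_neg, Finset.sum_neg_distrib,
      mul_assoc]
    rw [Finset.sum_comm (f := fun j c => sgn c • (κ c * (r c j * G j)))]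
    have e₃ : ∑ a, ∑ m, ∑ j, sgn m • (κ j * (r a m * GR j a m))
        = ∑ j, ∑ a, ∑ m, sgn m • (κ j * (r a m * GR j a m)) := by
      rw [sum_comm₃]
    rw [e₃]
    abel
  have h_κl : -((w + 2) • (l * ∑ j, κ j * G j)) + (∑ j, l * κ j * G j)
      - (∑ j, κ j * ((w + 1) • (l * G j))) = 0 := by
    simp only [mul_smul_comm, ← mul_assoc, Finset.mul_sum, Finset.smul_sum, hκl, neg_mul, smul_neg,
      ← Finset.sum_sub_distrib, ← Finset.sum_neg_distrib, ← Finset.sum_add_distrib]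
    refine Finset.sum_eq_zero fun a _ => ?_
    module
  have h_κκ : ∑ j, κ j * ∑ i, κ i * GG i j = 0 := by
    simp only [Finset.mul_sum, ← mul_assoc]
    refine sum_sum_antisymm _ fun a b => ?_
    rw [hκκ, hGG, neg_mul]
  have h_ll : (w + 2) • (l * ((w + 2) • (l * z))) = 0 := by
    rw [mul_smul_comm, ← mul_assoc, hll, zero_mul, smul_zero, smul_zero]
  have key := congrArg₂ (· + ·) (congrArg₂ (· + ·) (congrArg₂ (· + ·) (congrArg₂ (· + ·) h_xx h_xr)
    (congrArg₂ (· + ·) h_xl h_xκ)) (congrArg₂ (· + ·) (congrArg₂ (· + ·) h_rr h_rl)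
    (congrArg₂ (· + ·) h_rκ h_κl))) (congrArg₂ (· - ·) (neg_eq_zero.2 h_κκ) h_ll)
  simp only [add_zero, sub_zero] at key
  refine Eq.trans ?_ key
  simp only [add_mul, sub_mul, mul_add, smul_add, smul_sub,
    Finset.sum_add_distrib, Finset.sum_sub_distrib]
  module

end Ring

/-! ### The structure equations of the conformal algebra -/

theorem parity_xi (a : Fin 4) : parity (xi a) = -xi a := by
  simpa using parity_of_mem (xi_mem a)

theorem parity_rho (a b : Fin 4) : parity (rho a b) = -rho a b := by
  simpa using parity_of_mem (rho_mem a b)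

theorem parity_kappa (b : Fin 4) : parity (kappa b) = -kappa b := by
  simpa using parity_of_mem (kappa_mem b)

theorem parity_lam : parity lam = -lam := by
  simpa using parity_of_mem lam_mem

theorem form_odd_mul {z w : Pre} (hz : z ∈ preBidegree 0 1) (hw : w ∈ preBidegree 0 1) :
    form z * form w = -(form w * form z) :=
  form_anticomm hz hw odd_one odd_one

theorem form_odd_sq {z : Pre} (hz : z ∈ preBidegree 0 1) : form z * form z = 0 :=
  eq_zero_of_eq_neg (form_odd_mul hz hz)

theorem form_rho_antisymm (a b : Fin 4) : form (rho a b) = -form (rho b a) := by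
  have h := (form_eq_zero_iff _).2 (.rho_antisymm a b)
  rw [map_add] at h
  exact eq_neg_of_add_eq_zero_left h

/-- The curvature two-form `½ ξ^c ξ^d W_{abcd}` of `ρ_{ab}`. -/
def weylCurv (a b : Fin 4) : Pre := (1 / 2 : ℝ) • ∑ c, ∑ d, xi c * xi d * W a b c d

/-- The curvature two-form `½ ξ^c ξ^d C_{bcd}` of `κ_b`. -/
def cottonCurv (b : Fin 4) : Pre := (1 / 2 : ℝ) • ∑ c, ∑ d, xi c * xi d * C b c d

theorem preLie_xi (a : Fin 4) :
    preLie (xi a) = (∑ c, sgn a • (rho a c * xi c)) + xi a * lam := by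
  have h : preLie (xi a) = qCoord (.xi a) := preLie_fn _
  rw [h, qCoord]
  congr 1
  rw [Finset.sum_comm]
  exact Finset.sum_congr rfl fun c _ => sum_eta_smul a _

theorem preLie_rho (a b : Fin 4) :
    preLie (rho a b) = (∑ c, sgn c • (rho a c * rho c b))
      + (sgn a • (xi a * kappa b) - sgn b • (xi b * kappa a)) + weylCurv a b := by
  have h : preLie (rho a b) = qCoord (.rho a b) := preLie_fn _
  rw [h, qCoord]
  simp only [sum_eta_smul, xiDown_eq, smul_mul_assoc]
  rfl

theorem preLie_kappa (b : Fin 4) :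
    preLie (kappa b) = (∑ c, sgn c • (kappa c * rho c b)) + lam * kappa b + cottonCurv b := by
  have h : preLie (kappa b) = qCoord (.kappa b) := preLie_fn _
  rw [h, qCoord]
  simp only [sum_eta_smul]
  rfl

theorem preLie_lam : preLie lam = ∑ c, kappa c * xi c := preLie_fn _

/-- `q² = 0` on the Weyl coordinates: the Chevalley–Eilenberg identity, the curvature terms being
those of the commutator of covariant derivatives. -/
theorem form_preLie_preLie_weyl {k : ℕ} (i : Fin (4 + k) → Fin 4) :
    form (preLie (preLie (weyl i))) = 0 := by
  have hi := weyl_mem_weylSpan i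
  have h3 : ∀ e, preLie (covD e (weyl i)) = (∑ f, xi f * covD f (covD e (weyl i)))
      + (∑ a, ∑ m, sgn m • (rho a m * rot a m (covD e (weyl i))))
      + ((k : ℝ) + 3) • (lam * covD e (weyl i)) + ∑ j, kappa j * gam j (covD e (weyl i)) := by
    intro e
    rw [preLie_weylSpan (covD_mem_weylSpan e hi)]
    congr 3
    push_cast
    ring
  have h := chevalleyEilenberg_sq (A := Forms) (k : ℝ) (fun a => form (xi a))
    (fun a => form (kappa a)) (fun a b => form (rho a b)) (form lam)
    (fun b c d => form (C b c d)) (fun a b c d => form (W a b c d))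
    (fun a b => form_odd_mul (xi_mem a) (xi_mem b))
    (fun a b => form_odd_mul (kappa_mem a) (kappa_mem b))
    (fun a b => form_odd_mul (xi_mem a) (kappa_mem b))
    (fun a b c => form_odd_mul (xi_mem a) (rho_mem b c))
    (fun a => form_odd_mul (xi_mem a) lam_mem)
    (fun a => form_odd_mul (kappa_mem a) lam_mem)
    (fun a b c => form_odd_mul (rho_mem a b) (kappa_mem c))
    (fun a b => form_odd_mul (rho_mem a b) lam_mem)
    (fun a b c d => form_odd_mul (rho_mem a b) (rho_mem c d))
    (form_odd_sq lam_mem) form_rho_antisymm (form (weyl i))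
    (fun e => form (covD e (weyl i))) (fun j => form (gam j (weyl i)))
    (fun f e => form (covD f (covD e (weyl i)))) (fun e j => form (covD e (gam j (weyl i))))
    (fun j e => form (gam j (covD e (weyl i)))) (fun i' j => form (gam i' (gam j (weyl i))))
    (fun a m => form (rot a m (weyl i)))
    (fun e a m => form (covD e (rot a m (weyl i)))) (fun a m e => form (rot a m (covD e (weyl i))))
    (fun a m j => form (rot a m (gam j (weyl i)))) (fun j a m => form (gam j (rot a m (weyl i))))
    (fun b n a m => form (rot b n (rot a m (weyl i))))
    (fun c d => form_commutator hi c d)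
    (fun a m e => by rw [rot_covD a m e hi, map_add, map_smul])
    (fun j e => by
      rw [gam_covD j e hi]
      simp only [map_add, map_sub, map_smul])
    (fun a b c d => by
      rw [← map_sub, rot_rot a b c d hi, map_sub, map_smul, map_smul])
    (fun j a m => by
      have h := congrArg form (lorentz_gam a m j hi)
      simpa only [lorentz_apply, map_sub, map_add, map_smul] using h)
    (fun i' j => by rw [gam_gam i' j hi])
  rw [← h, preLie_weylSpan hi]
  simp only [map_add, map_sum, map_smul, preLie_mul, parity_xi, parity_rho, parity_kappa,
    parity_lam, neg_mul, map_mul, preLie_xi, preLie_rho, preLie_kappa, preLie_lam, h3,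
    preLie_weylSpan (rot_mem_weylSpan _ _ hi), preLie_weylSpan hi, preLie_gam _ hi, map_sub,
    weylCurv, cottonCurv, ← sub_eq_add_neg]

section Ring

variable {A : Type*} [Ring A] [Algebra ℝ A]

/-- The structure equations of the conformal algebra with curvatures `F`, `g` are consistent: the
square of the differential vanishes on `x`. -/
theorem structure_sq_x (x κ : Fin 4 → A) (r : Fin 4 → Fin 4 → A) (l : A)
    (F : Fin 4 → Fin 4 → A) (a : Fin 4)
    (hxκ : ∀ a b, x a * κ b = -(κ b * x a))
    (hll : l * l = 0) (hx0 : ∀ a, x a * x a = 0) (hF : ∑ c, F a c * x c = 0) :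
    (∑ c, sgn a • (((∑ d, sgn d • (r a d * r d c))
        + (sgn a • (x a * κ c) - sgn c • (x c * κ a)) + F a c) * x c
        - r a c * ((∑ d, sgn c • (r c d * x d)) + x c * l)))
      + (((∑ c, sgn a • (r a c * x c)) + x a * l) * l - x a * ∑ c, κ c * x c) = 0 := by
  have f₁ : ∑ c, sgn a • ((∑ d, sgn d • (r a d * r d c)) * x c)
      = ∑ c, sgn a • (r a c * ∑ d, sgn c • (r c d * x d)) := by
    simp only [Finset.mul_sum, Finset.sum_mul, Finset.smul_sum, smul_mul_assoc, mul_smul_comm,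
      mul_assoc]
    exact Finset.sum_comm
  have f₂ : ∑ c, sgn a • ((sgn a • (x a * κ c)) * x c) = x a * ∑ c, κ c * x c := by
    simp only [Finset.mul_sum, smul_mul_assoc, mul_assoc, sgn_smul_sgn_smul]
  have f₃ : ∑ c, sgn a • ((sgn c • (x c * κ a)) * x c) = 0 := by
    refine Finset.sum_eq_zero fun c _ => ?_
    rw [hxκ, smul_mul_assoc, neg_mul, mul_assoc, hx0, mul_zero, neg_zero, smul_zero, smul_zero]
  have f₄ : ∑ c, sgn a • (F a c * x c) = 0 := by rw [← Finset.smul_sum, hF, smul_zero]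
  have f₅ : x a * l * l = 0 := by rw [mul_assoc, hll, mul_zero]
  simp only [add_mul, sub_mul, mul_add, smul_add, smul_sub, Finset.mul_sum, Finset.sum_mul,
    Finset.smul_sum, smul_mul_assoc, mul_smul_comm, mul_assoc, Finset.sum_add_distrib,
    Finset.sum_sub_distrib] at f₁ f₂ f₃ f₄ f₅ ⊢
  linear_combination (norm := module) f₁ + f₂ - f₃ + f₄ + f₅

/-- The square of the differential vanishes on `r`. -/
theorem structure_sq_r (x κ : Fin 4 → A) (r : Fin 4 → Fin 4 → A) (l : A)
    (F : Fin 4 → Fin 4 → A) (g : Fin 4 → A) (a b : Fin 4)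
    (hxr : ∀ a b c, x a * r b c = -(r b c * x a)) (hκr : ∀ a b c, κ a * r b c = -(r b c * κ a))
    (hr : ∀ a b, r a b = -r b a) (hFr : ∀ a b c d, F a b * r c d = r c d * F a b) :
    (∑ c, sgn c • (((∑ d, sgn d • (r a d * r d c))
        + (sgn a • (x a * κ c) - sgn c • (x c * κ a)) + F a c) * r c b
        - r a c * ((∑ d, sgn d • (r c d * r d b))
        + (sgn c • (x c * κ b) - sgn b • (x b * κ c)) + F c b)))
      + (sgn a • (((∑ c, sgn a • (r a c * x c)) + x a * l) * κ b
          - x a * ((∑ c, sgn c • (κ c * r c b)) + l * κ b + g b))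
        - sgn b • (((∑ c, sgn b • (r b c * x c)) + x b * l) * κ a
          - x b * ((∑ c, sgn c • (κ c * r c a)) + l * κ a + g a)))
      + ((∑ c, sgn c • (r a c * F c b + r b c * F a c))
        + (sgn a • (x a * g b) - sgn b • (x b * g a))) = 0 := by
  have h : ∀ c d e f, x c * κ d * r e f = -(r f e * (x c * κ d)) := by
    intro c d e f
    rw [mul_assoc, hκr, mul_neg, ← mul_assoc, hxr, hr e f, neg_mul, neg_mul, neg_mul, neg_neg,
      mul_assoc]
  have f₁ : ∑ c, sgn c • ((∑ d, sgn d • (r a d * r d c)) * r c b)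
      = ∑ c, sgn c • (r a c * ∑ d, sgn d • (r c d * r d b)) := by
    simp only [Finset.mul_sum, Finset.sum_mul, Finset.smul_sum, smul_mul_assoc, mul_smul_comm,
      mul_assoc]
    rw [Finset.sum_comm]
    exact Finset.sum_congr rfl fun c _ => Finset.sum_congr rfl fun d _ => smul_comm _ _ _
  have f₂ : ∑ c, sgn c • ((sgn a • (x a * κ c)) * r c b)
      = sgn a • (x a * ∑ c, sgn c • (κ c * r c b)) := by
    simp only [Finset.mul_sum, Finset.smul_sum, smul_mul_assoc, mul_smul_comm, mul_assoc]
    exact Finset.sum_congr rfl fun c _ => smul_comm _ _ _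
  have f₃ : ∑ c, sgn c • ((sgn c • (x c * κ a)) * r c b)
      = -(sgn b • ((∑ c, sgn b • (r b c * x c)) * κ a)) := by
    simp only [Finset.sum_mul, Finset.smul_sum, smul_mul_assoc, h, smul_neg, sgn_smul_sgn_smul,
      Finset.sum_neg_distrib, mul_assoc]
  have f₄ : ∑ c, sgn c • (r a c * (sgn c • (x c * κ b)))
      = sgn a • ((∑ c, sgn a • (r a c * x c)) * κ b) := by
    simp only [Finset.sum_mul, Finset.smul_sum, smul_mul_assoc, mul_smul_comm, sgn_smul_sgn_smul,
      mul_assoc]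
  have f₅ : ∑ c, sgn c • (r a c * (sgn b • (x b * κ c)))
      = -(sgn b • (x b * ∑ c, sgn c • (κ c * r c a))) := by
    simp only [Finset.mul_sum, Finset.smul_sum, mul_smul_comm, ← mul_assoc (x _), h, smul_neg,
      Finset.sum_neg_distrib, neg_neg]
    exact Finset.sum_congr rfl fun c _ => smul_comm _ _ _
  have f₆ : ∑ c, sgn c • (F a c * r c b) = -∑ c, sgn c • (r b c * F a c) := by
    simp only [hr _ b, mul_neg, hFr, smul_neg, Finset.sum_neg_distrib]
  simp only [add_mul, sub_mul, mul_add, mul_sub, smul_add, smul_sub, Finset.mul_sum,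
    Finset.sum_mul, Finset.smul_sum, smul_mul_assoc, mul_smul_comm, mul_assoc,
    Finset.sum_add_distrib, Finset.sum_sub_distrib] at f₁ f₂ f₃ f₄ f₅ f₆ ⊢
  linear_combination (norm := module) f₁ + f₂ - f₃ - f₄ + f₅ + f₆

/-- The square of the differential vanishes on `κ`. -/
theorem structure_sq_κ (x κ : Fin 4 → A) (r : Fin 4 → Fin 4 → A) (l : A)
    (F : Fin 4 → Fin 4 → A) (g : Fin 4 → A) (b : Fin 4)
    (hxκ : ∀ a b, x a * κ b = -(κ b * x a)) (hκ0 : ∀ a, κ a * κ a = 0) (hll : l * l = 0)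
    (hr : ∀ a b, r a b = -r b a) (hgr : ∀ a c d, g a * r c d = r c d * g a) :
    (∑ c, sgn c • (((∑ d, sgn d • (κ d * r d c)) + l * κ c + g c) * r c b
        - κ c * ((∑ d, sgn d • (r c d * r d b))
        + (sgn c • (x c * κ b) - sgn b • (x b * κ c)) + F c b)))
      + ((∑ c, κ c * x c) * κ b - l * ((∑ c, sgn c • (κ c * r c b)) + l * κ b + g b))
      + ((∑ c, sgn c • (r b c * g c)) + l * g b + ∑ j, sgn j • (κ j * F j b)) = 0 := by
  have f₁ : ∑ c, sgn c • ((∑ d, sgn d • (κ d * r d c)) * r c b)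
      = ∑ c, sgn c • (κ c * ∑ d, sgn d • (r c d * r d b)) := by
    simp only [Finset.mul_sum, Finset.sum_mul, Finset.smul_sum, smul_mul_assoc, mul_smul_comm,
      mul_assoc]
    rw [Finset.sum_comm]
    exact Finset.sum_congr rfl fun c _ => Finset.sum_congr rfl fun d _ => smul_comm _ _ _
  have f₂ : ∑ c, sgn c • (g c * r c b) = -∑ c, sgn c • (r b c * g c) := by
    simp only [hr _ b, mul_neg, hgr, smul_neg, Finset.sum_neg_distrib]
  have f₃ : ∑ c, sgn c • (κ c * (sgn b • (x b * κ c))) = 0 := by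
    refine Finset.sum_eq_zero fun c _ => ?_
    rw [hxκ, mul_smul_comm, mul_neg, ← mul_assoc, hκ0, zero_mul, neg_zero, smul_zero, smul_zero]
  have f₄ : ∑ c, sgn c • (κ c * (sgn c • (x c * κ b))) = (∑ c, κ c * x c) * κ b := by
    simp only [Finset.sum_mul, mul_smul_comm, sgn_smul_sgn_smul, mul_assoc]
  have f₅ : l * (l * κ b) = 0 := by rw [← mul_assoc, hll, zero_mul]
  simp only [add_mul, mul_add, mul_sub, smul_add, smul_sub, Finset.mul_sum,
    Finset.sum_mul, Finset.smul_sum, smul_mul_assoc, mul_smul_comm, mul_assoc,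
    Finset.sum_add_distrib, Finset.sum_sub_distrib] at f₁ f₂ f₃ f₄ f₅ ⊢
  linear_combination (norm := module) f₁ + f₂ + f₃ - f₄ - f₅

/-- The square of the differential vanishes on `l`. -/
theorem structure_sq_l (x κ : Fin 4 → A) (r : Fin 4 → Fin 4 → A) (l : A) (g : Fin 4 → A)
    (hxl : ∀ a, x a * l = -(l * x a)) (hκl : ∀ a, κ a * l = -(l * κ a))
    (hg : ∑ c, g c * x c = 0) :
    ∑ c, (((∑ d, sgn d • (κ d * r d c)) + l * κ c + g c) * x c
      - κ c * ((∑ d, sgn c • (r c d * x d)) + x c * l)) = 0 := by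
  have f₁ : ∑ c, (∑ d, sgn d • (κ d * r d c)) * x c
      = ∑ c, κ c * ∑ d, sgn c • (r c d * x d) := by
    simp only [Finset.mul_sum, Finset.sum_mul, smul_mul_assoc, mul_smul_comm, mul_assoc]
    exact Finset.sum_comm
  have f₂ : ∀ c, κ c * (x c * l) = l * κ c * x c := by
    intro c
    rw [hxl, mul_neg, ← mul_assoc, hκl, neg_mul, neg_neg]
  simp only [add_mul, mul_add, Finset.sum_add_distrib, Finset.sum_sub_distrib, f₁, f₂, hg]
  abel

end Ring

/-! ### Algebraic identities for the Weyl and Cotton tensors -/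

theorem form_weylRel {z : Pre} (h : WeylRel z) : form z = 0 :=
  (form_eq_zero_iff _).2 (.weyl h)

theorem appendIndex_four (a b c d e : Fin 4) :
    appendIndex (k := 0) ![a, b, c, d] e = ![a, b, c, d, e] := by
  ext s
  fin_cases s <;> rfl

theorem appendIndex_five (a b c d e f : Fin 4) :
    appendIndex (k := 1) ![a, b, c, d, e] f = ![a, b, c, d, e, f] := by
  ext s
  fin_cases s <;> rfl

theorem covD_W (a b c d e : Fin 4) : covD e (W a b c d) = dW a b c d e := by
  rw [W, covD_weyl, appendIndex_four, dW]

theorem covD_dW (a b c d e f : Fin 4) : covD f (dW a b c d e) = ddW a b c d e f := by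
  rw [dW, covD_weyl, appendIndex_five, ddW]

theorem covD_C (b c d e : Fin 4) : covD e (C b c d) = dC b c d e := by
  simp only [C_eq, dC_eq, map_sum, map_smul, covD_dW]

theorem W_mem_weylSpan (a b c d : Fin 4) : W a b c d ∈ weylSpan 0 := weyl_mem_weylSpan _

theorem rot_W (p m a b c d : Fin 4) : rot p m (W a b c d)
    = delta a p • W m b c d + delta b p • W a m c d + delta c p • W a b m d
      + delta d p • W a b c m := by
  have h : ∀ i j : Fin (4 + 0) → Fin 4, (∀ s, i s = j s) → (weyl i : Pre) = weyl j :=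
    fun i j h => congrArg _ (funext h)
  rw [W, rot_weyl]
  refine (Fin.sum_univ_four _).trans ?_
  refine congrArg₂ (· + ·) (congrArg₂ (· + ·) (congrArg₂ (· + ·) ?_ ?_) ?_) ?_ <;>
  · refine congrArg₂ (· • ·) rfl (h _ _ fun s => ?_)
    fin_cases s <;> rfl

/-- Relations between Weyl coordinates persist under covariant differentiation. -/
theorem form_covD_eq {z w : Pre} (h : WeylRel (z + w)) (e : Fin 4) :
    form (covD e z) = -form (covD e w) := by
  have := form_weylRel (.covD e h)
  rw [map_add, map_add] at this
  exact eq_neg_of_add_eq_zero_left this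

theorem form_W_antisymm_left (a b c d : Fin 4) : form (W a b c d) = -form (W b a c d) := by
  have h := form_weylRel (.antisymm_left a b c d)
  rw [map_add] at h
  exact eq_neg_of_add_eq_zero_left h

theorem form_W_antisymm_right (a b c d : Fin 4) : form (W a b c d) = -form (W a b d c) := by
  have h := form_weylRel (.antisymm_right a b c d)
  rw [map_add] at h
  exact eq_neg_of_add_eq_zero_left h

theorem form_W_cyclic (a b c d : Fin 4) :
    form (W a b c d) + form (W a c d b) + form (W a d b c) = 0 := by
  have h := form_weylRel (.cyclic a b c d)
  simpa only [map_add] using h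

theorem form_W_trace (b d : Fin 4) : ∑ a, sgn a • form (W a b a d) = 0 := by
  have h := form_weylRel (.traceless b d)
  simpa only [map_sum, map_smul, sum_eta_smul] using h

theorem form_dW_antisymm_left (a b c d e : Fin 4) :
    form (dW a b c d e) = -form (dW b a c d e) := by
  simpa only [covD_W] using form_covD_eq (.antisymm_left a b c d) e

theorem form_dW_antisymm_right (a b c d e : Fin 4) :
    form (dW a b c d e) = -form (dW a b d c e) := by
  simpa only [covD_W] using form_covD_eq (.antisymm_right a b c d) e

theorem form_dW_cyclic (a b c d e : Fin 4) :
    form (dW a b c d e) + form (dW a c d b e) + form (dW a d b c e) = 0 := by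
  have h := form_weylRel (.covD e (.cyclic a b c d))
  simpa only [map_add, covD_W] using h

theorem form_dW_trace (b d e : Fin 4) : ∑ a, sgn a • form (dW a b a d e) = 0 := by
  have h := form_weylRel (.covD e (.traceless b d))
  simpa only [map_sum, map_smul, sum_eta_smul, covD_W] using h

/-- The pair symmetry of a tensor with the algebraic symmetries of a curvature tensor. -/
theorem pair_symm {M : Type*} [AddCommGroup M] [Module ℝ M]
    {w : Fin 4 → Fin 4 → Fin 4 → Fin 4 → M} (h₁ : ∀ a b c d, w a b c d = -w b a c d)
    (h₂ : ∀ a b c d, w a b c d = -w a b d c)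
    (h₃ : ∀ a b c d, w a b c d + w a c d b + w a d b c = 0) (a b c d : Fin 4) :
    w a b c d = w c d a b := by
  have e₂ : -w b c a d - w d b a c - w a b c d = 0 := by
    rw [← h₃ b c d a, h₂ b c d a, h₁ b d a c, h₁ b a c d]
    abel
  have e₃ : w c d a b + w a c d b + w b c a d = 0 := by
    rw [← h₃ c d a b, h₁ c a b d, h₂ a c b d, h₁ c b d a, h₂ b c d a]
    abel
  have e₄ : -w a d b c - w d b a c - w c d a b = 0 := by
    rw [← h₃ d a b c, h₁ d a b c, h₂ d b c a, h₁ d c a b]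
    abel
  linear_combination (norm := module) (1 / 2 : ℝ) • (h₃ a b c d) - (1 / 2 : ℝ) • e₂
    - (1 / 2 : ℝ) • e₃ + (1 / 2 : ℝ) • e₄

theorem form_W_pair (a b c d : Fin 4) : form (W a b c d) = form (W c d a b) :=
  pair_symm (w := fun a b c d => form (W a b c d)) form_W_antisymm_left form_W_antisymm_right
    form_W_cyclic a b c d

theorem form_dW_pair (a b c d e : Fin 4) : form (dW a b c d e) = form (dW c d a b e) :=
  pair_symm (w := fun a b c d => form (dW a b c d e))
    (fun _ _ _ _ => form_dW_antisymm_left _ _ _ _ _)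
    (fun _ _ _ _ => form_dW_antisymm_right _ _ _ _ _) (fun _ _ _ _ => form_dW_cyclic _ _ _ _ _)
    a b c d

theorem form_C (b c d : Fin 4) : form (C b c d) = ∑ a, sgn a • form (dW a b c d a) := by
  simp only [C_eq, map_sum, map_smul]

theorem form_C_antisymm (b c d : Fin 4) : form (C b c d) = -form (C b d c) := by
  simp only [form_C, ← Finset.sum_neg_distrib, ← smul_neg, ← form_dW_antisymm_right]

theorem form_C_cyclic (b c d : Fin 4) :
    form (C b c d) + form (C c d b) + form (C d b c) = 0 := by
  simp only [form_C, ← Finset.sum_add_distrib, ← smul_add, form_dW_cyclic, smul_zero,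
    Finset.sum_const_zero]

theorem form_C_trace (c : Fin 4) : ∑ b, sgn b • form (C b b c) = 0 := by
  simp only [form_C, Finset.smul_sum]
  rw [Finset.sum_comm]
  refine Finset.sum_eq_zero fun a _ => ?_
  have h := form_dW_trace a c a
  have : ∀ b, sgn b • sgn a • form (dW a b b c a) = -(sgn a • sgn b • form (dW b a b c a)) := by
    intro b
    rw [form_dW_antisymm_left, smul_neg, smul_neg, smul_comm]
  simp only [this, Finset.sum_neg_distrib, ← Finset.smul_sum, h, smul_zero, neg_zero]

theorem form_dC_antisymm (b c d e : Fin 4) : form (dC b c d e) = -form (dC b d c e) := by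
  have h : ∀ a, form (ddW a b c d a e) = -form (ddW a b d c a e) := by
    intro a
    have h := form_weylRel (.covD e (.covD a (.antisymm_right a b c d)))
    simp only [map_add, covD_W, covD_dW] at h
    exact eq_neg_of_add_eq_zero_left h
  simp only [dC_eq, map_sum, map_smul, ← Finset.sum_neg_distrib, ← smul_neg, ← h]

theorem form_bach (a c : Fin 4) : ∑ b, sgn b • form (dC a b c b) = 0 := by
  have h := form_weylRel (.bach a c)
  simpa only [map_sum, map_smul, sum_eta_smul] using h

theorem form_bianchi_cotton (b c d e : Fin 4) :
    form (dC b c d e) + form (dC b d e c) + form (dC b e c d) = 0 := by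
  have h := form_weylRel (.bianchi_cotton b c d e)
  simpa only [map_add] using h

theorem form_bianchi (a b c d e : Fin 4) :
    form (dW a b c d e) + form (dW a b d e c) + form (dW a b e c d)
      = (eta a e • form (C b c d) + eta a c • form (C b d e) + eta a d • form (C b e c))
      - (eta b e • form (C a c d) + eta b c • form (C a d e) + eta b d • form (C a e c)) := by
  have h := form_weylRel (.bianchi a b c d e)
  simp only [map_add, map_sub, map_smul] at h
  linear_combination (norm := module) h

/-- The special conformal generators map the Cotton tensor to the Weyl tensor,
`Γ^j C_{bcd} = W^j_{bcd}`. -/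
theorem form_gam_C (j b c d : Fin 4) : form (gam j (C b c d)) = sgn j • form (W j b c d) := by
  have h : ∀ p, sgn p • form (gam j (dW p b c d p)) = sgn j • form (W j b c d)
      + (delta b p • sgn j • form (W p j c d) + delta c p • sgn j • form (W p b j d)
        + delta d p • sgn j • form (W p b c j))
      - (delta j p • (2 * sgn p) • form (W p b c d) + delta p j • sgn p • form (W p b c d)
          + delta b j • sgn p • form (W p p c d)
          + delta c j • sgn p • form (W p b p d) + delta d j • sgn p • form (W p b c p)) := by
    intro p
    rw [← covD_W, gam_covD j p (W_mem_weylSpan p b c d), gam_zero j (W_mem_weylSpan p b c d)]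
    simp only [map_add, map_sub, map_smul, rot_W, delta_self, one_smul, map_zero, Nat.cast_zero,
      zero_add, zero_sub, map_neg, mul_smul, smul_add, smul_sub, smul_neg, sgn_smul_sgn_smul]
    simp only [smul_comm (sgn _) (delta _ _), smul_comm (2 : ℝ) (delta _ _),
      smul_comm (2 : ℝ) (sgn _)]
    abel
  have hpp : ∀ p, form (W p p c d) = 0 := fun p => eq_zero_of_eq_neg (form_W_antisymm_left p p c d)
  have ht : ∑ p, sgn p • form (W p b c p) = 0 := by
    have := form_W_trace b c
    simp only [fun p => form_W_antisymm_right p b c p, smul_neg, Finset.sum_neg_distrib, this,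
      neg_zero]
  have e₁ : form (W b j c d) = -form (W j b c d) := form_W_antisymm_left _ _ _ _
  have e₂ : form (W c b j d) = form (W j d c b) := form_W_pair _ _ _ _
  have e₃ : form (W d b c j) = form (W j c b d) := by
    rw [form_W_pair, form_W_antisymm_left, form_W_antisymm_right, neg_neg]
  have e₄ : form (W j b d c) = -form (W j b c d) := form_W_antisymm_right _ _ _ _
  have key := form_W_cyclic j d c b
  rw [e₄] at key
  rw [C_eq]
  simp only [map_sum, map_smul, h, Finset.sum_add_distrib, Finset.sum_sub_distrib, sum_delta_smul,
    sum_delta_smul', ← Finset.smul_sum, form_W_trace, ht, hpp, smul_zero, Finset.sum_const_zero,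
    Finset.sum_const, Finset.card_univ, Fintype.card_fin, e₁, e₂, e₃]
  rw [← Nat.cast_smul_eq_nsmul ℝ]
  linear_combination (norm := (push_cast; module)) sgn j • key

theorem rot_C (p m b c d : Fin 4) : rot p m (C b c d)
    = delta b p • C m c d + delta c p • C b m d + delta d p • C b c m
      + sgn p • (dW m b c d p + dW p b c d m) := by
  have h : ∀ a, rot p m (dW a b c d a) = delta a p • (dW m b c d a + dW a b c d m)
      + delta b p • dW a m c d a + delta c p • dW a b m d a + delta d p • dW a b c m a := by
    intro a
    rw [← covD_W, rot_covD p m a (W_mem_weylSpan a b c d), rot_W]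
    simp only [map_add, map_smul, covD_W]
    module
  simp only [C_eq, map_sum, map_smul, h, smul_add, Finset.sum_add_distrib, Finset.smul_sum,
    smul_comm (sgn _) (delta _ _), sum_delta_smul']
  abel

theorem form_preLie_W (a b c d : Fin 4) : form (preLie (W a b c d))
    = (∑ e, form (xi e) * form (dW a b c d e))
      + (∑ m, sgn m • (form (rho a m) * form (W m b c d) + form (rho b m) * form (W a m c d)
          + form (rho c m) * form (W a b m d) + form (rho d m) * form (W a b c m)))
      + (2 : ℝ) • (form lam * form (W a b c d)) := by
  rw [preLie_weylSpan (W_mem_weylSpan a b c d)]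
  simp only [gam_zero _ (W_mem_weylSpan a b c d), rot_W, covD_W, map_add, map_sum, map_mul,
    map_smul, mul_add, smul_add, mul_smul_comm, mul_zero, Finset.sum_const_zero, add_zero,
    Finset.sum_add_distrib, Nat.cast_zero, zero_add]
  simp only [smul_comm (sgn _) (delta _ _)]
  congr 2
  have h : ∀ (a : Fin 4) (f : Fin 4 → Fin 4 → Forms),
      ∑ p, ∑ m, delta a p • f p m = ∑ m, f a m := by
    intro a f
    rw [Finset.sum_comm]
    simp only [sum_delta_smul]
  simp only [h]

theorem form_preLie_C (b c d : Fin 4) : form (preLie (C b c d))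
    = (∑ e, form (xi e) * form (dC b c d e))
      + (∑ m, sgn m • (form (rho b m) * form (C m c d) + form (rho c m) * form (C b m d)
          + form (rho d m) * form (C b c m)))
      + (3 : ℝ) • (form lam * form (C b c d))
      + ∑ j, sgn j • (form (kappa j) * form (W j b c d)) := by
  rw [preLie_weylSpan (C_mem_weylSpan b c d)]
  have h : ∑ p, ∑ m, sgn p • sgn m • (form (rho p m)
      * (form (dW m b c d p) + form (dW p b c d m))) = 0 := by
    refine sum_sum_antisymm _ fun p m => ?_
    rw [form_rho_antisymm, neg_mul, add_comm, smul_neg, smul_neg, smul_comm]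
  have h' : ∀ (a : Fin 4) (f : Fin 4 → Fin 4 → Forms),
      ∑ p, ∑ m, delta a p • f p m = ∑ m, f a m := by
    intro a f
    rw [Finset.sum_comm]
    simp only [sum_delta_smul]
  simp only [covD_C, map_add, map_sum, map_mul, map_smul, form_gam_C, mul_smul_comm, rot_C,
    mul_add, smul_add, smul_comm (sgn _) (delta _ _), Finset.sum_add_distrib, h',
    smul_comm (sgn (_ : Fin 4)) (sgn (_ : Fin 4))] at h ⊢
  simp only [Nat.cast_one]
  linear_combination (norm := module) h

/-! ### Contractions of the Weyl and Cotton tensors with a two-tensor -/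

section Ring

variable {A : Type*} [Ring A] [Algebra ℝ A]

/-- Lorentz invariance of the contraction of a covariant with a contravariant two-tensor. -/
theorem rot_contraction {r t y : Fin 4 → Fin 4 → A} (hr : ∀ a b, r a b = -r b a)
    (ht : ∀ a b u, t a b * u = u * t a b) :
    ∑ n, ∑ m, ((∑ c, sgn c • (r n c * t c m + r m c * t n c)) * y n m
      + t n m * ∑ c, (sgn n • (r n c * y c m) + sgn m • (r m c * y n c))) = 0 := by
  have f₁ : ∑ n, ∑ m, ∑ c, sgn c • (r n c * (t c m * y n m))
      = -∑ n, ∑ m, ∑ c, sgn n • (r n c * (t n m * y c m)) := by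
    rw [sum_comm₃, ← Finset.sum_neg_distrib]
    refine Finset.sum_congr rfl fun c _ => ?_
    rw [Finset.sum_comm, ← Finset.sum_neg_distrib]
    refine Finset.sum_congr rfl fun m _ => ?_
    rw [← Finset.sum_neg_distrib]
    refine Finset.sum_congr rfl fun n _ => ?_
    rw [hr, neg_mul, smul_neg]
  have f₂ : ∑ n, ∑ m, ∑ c, sgn c • (r m c * (t n c * y n m))
      = -∑ n, ∑ m, ∑ c, sgn m • (r m c * (t n m * y n c)) := by
    rw [← Finset.sum_neg_distrib]
    refine Finset.sum_congr rfl fun n _ => ?_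
    rw [Finset.sum_comm, ← Finset.sum_neg_distrib]
    refine Finset.sum_congr rfl fun c _ => ?_
    rw [← Finset.sum_neg_distrib]
    refine Finset.sum_congr rfl fun m _ => ?_
    rw [hr, neg_mul, smul_neg]
  have h : ∀ a b c d e f, t a b * (r c d * y e f) = r c d * (t a b * y e f) := by
    intro a b c d e f
    rw [← mul_assoc, ht, mul_assoc]
  simp only [add_mul, mul_add, smul_add, Finset.mul_sum, Finset.sum_mul, smul_mul_assoc,
    mul_smul_comm, mul_assoc, Finset.sum_add_distrib, h, f₁, f₂]
  abel

/-- A three-tensor with vanishing cyclic sum is annihilated by products of three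
anticommuting elements. -/
theorem sum_cyclic_eq_zero {x : Fin 4 → A} (hxx : ∀ a b, x a * x b = -(x b * x a))
    {t : Fin 4 → Fin 4 → Fin 4 → A} (ht : ∀ n m e, t n m e + t m e n + t e n m = 0) :
    ∑ e, ∑ n, ∑ m, t n m e * (x e * (x n * x m)) = 0 := by
  have hx : ∀ e n m, x n * (x m * x e) = x e * (x n * x m) := by
    intro e n m
    rw [hxx m e, mul_neg, ← mul_assoc, hxx n e, neg_mul, neg_neg, mul_assoc]
  have h₁ : ∑ e, ∑ n, ∑ m, t n m e * (x e * (x n * x m))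
      = ∑ e, ∑ n, ∑ m, t m e n * (x e * (x n * x m)) := by
    rw [sum_comm₃]
    simp only [hx]
  have h₂ : ∑ e, ∑ n, ∑ m, t m e n * (x e * (x n * x m))
      = ∑ e, ∑ n, ∑ m, t e n m * (x e * (x n * x m)) := by
    rw [sum_comm₃]
    simp only [hx]
  have h₃ : ∑ e, ∑ n, ∑ m, (t n m e + t m e n + t e n m) * (x e * (x n * x m)) = 0 := by
    simp only [ht, zero_mul, Finset.sum_const_zero]
  simp only [add_mul, Finset.sum_add_distrib] at h₃
  linear_combination (norm := module) (1 / 3 : ℝ) • h₃ + (2 / 3 : ℝ) • h₁ + (1 / 3 : ℝ) • h₂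

end Ring

theorem form_W_mul (a b c d : Fin 4) (u : Forms) : form (W a b c d) * u = u * form (W a b c d) :=
  form_commute (W_mem a b c d) Even.zero u

theorem form_C_mul (b c d : Fin 4) (u : Forms) : form (C b c d) * u = u * form (C b c d) :=
  form_commute (C_mem b c d) Even.zero u

theorem form_dW_mul (a b c d e : Fin 4) (u : Forms) :
    form (dW a b c d e) * u = u * form (dW a b c d e) :=
  form_commute (weyl_mem _) Even.zero u

theorem dC_mem (b c d e : Fin 4) : dC b c d e ∈ preBidegree 0 0 := by
  rw [← covD_C]
  exact covD_mem _ (C_mem b c d)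

theorem form_dC_mul (b c d e : Fin 4) (u : Forms) : form (dC b c d e) * u = u * form (dC b c d e) :=
  form_commute (dC_mem b c d e) Even.zero u

theorem parity_W (a b c d : Fin 4) : parity (W a b c d) = W a b c d := by
  simpa using parity_of_mem (W_mem a b c d)

theorem parity_C (b c d : Fin 4) : parity (C b c d) = C b c d := by
  simpa using parity_of_mem (C_mem b c d)

theorem form_preLie_congr {z w : Pre} (h : form z = form w) :
    form (preLie z) = form (preLie w) := by
  rw [← lieQ_form, ← lieQ_form, h]

/-- The contraction `W_{abnm} Y^{nm}`. -/
def weylContr (Y : Fin 4 → Fin 4 → Pre) (a b : Fin 4) : Pre := ∑ n, ∑ m, W a b n m * Y n m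

/-- The contraction `C_{bnm} Y^{nm}`. -/
def cottonContr (Y : Fin 4 → Fin 4 → Pre) (b : Fin 4) : Pre := ∑ n, ∑ m, C b n m * Y n m

/-- `q` acts on the two-tensor `Y^{nm}` as on `ξ^n ξ^m`. -/
def TransformsLikeXiXi (Y : Fin 4 → Fin 4 → Pre) : Prop :=
  ∀ n m, form (preLie (Y n m))
    = (∑ c, (sgn n • (form (rho n c) * form (Y c m)) + sgn m • (form (rho m c) * form (Y n c))))
      - (2 : ℝ) • (form lam * form (Y n m))

theorem form_preLie_weylContr {Y : Fin 4 → Fin 4 → Pre} (hY : TransformsLikeXiXi Y)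
    (a b : Fin 4) : form (preLie (weylContr Y a b))
      = (∑ c, sgn c • (form (rho a c) * form (weylContr Y c b)
          + form (rho b c) * form (weylContr Y a c)))
        + ∑ e, ∑ n, ∑ m, form (xi e) * (form (dW a b n m e) * form (Y n m)) := by
  have h := rot_contraction form_rho_antisymm (t := fun n m => form (W a b n m))
    (y := fun n m => form (Y n m)) (fun n m => form_W_mul a b n m)
  have h₁ : ∀ n m, form (W a b n m) * (form lam * form (Y n m))
      = form lam * (form (W a b n m) * form (Y n m)) := by
    intro n m
    rw [← mul_assoc, form_W_mul, mul_assoc]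
  have f₁ := sum_comm₃ fun n m c => sgn c •
    (form (rho a c) * (form (W c b n m) * form (Y n m)))
  have f₂ := sum_comm₃ fun n m c => sgn c •
    (form (rho b c) * (form (W a c n m) * form (Y n m)))
  have f₃ := sum_comm₃ fun n m e => form (xi e) * (form (dW a b n m e) * form (Y n m))
  simp only [weylContr, map_sum, preLie_mul, parity_W, map_add, map_mul, form_preLie_W, hY _ _]
  simp only [add_mul, mul_sub, mul_add, smul_add, Finset.mul_sum, Finset.sum_mul, Finset.smul_sum,
    smul_mul_assoc, mul_smul_comm, mul_assoc, Finset.sum_add_distrib, Finset.sum_sub_distrib, h₁]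
    at h ⊢
  linear_combination (norm := module) h + f₁ + f₂ + f₃

theorem form_preLie_cottonContr {Y : Fin 4 → Fin 4 → Pre} (hY : TransformsLikeXiXi Y)
    (b : Fin 4) : form (preLie (cottonContr Y b))
      = (∑ c, sgn c • (form (rho b c) * form (cottonContr Y c)))
        + form lam * form (cottonContr Y b)
        + (∑ j, sgn j • (form (kappa j) * form (weylContr Y j b)))
        + ∑ e, ∑ n, ∑ m, form (xi e) * (form (dC b n m e) * form (Y n m)) := by
  have h := rot_contraction form_rho_antisymm (t := fun n m => form (C b n m))
    (y := fun n m => form (Y n m)) (fun n m => form_C_mul b n m)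
  have h₁ : ∀ n m, form (C b n m) * (form lam * form (Y n m))
      = form lam * (form (C b n m) * form (Y n m)) := by
    intro n m
    rw [← mul_assoc, form_C_mul, mul_assoc]
  have f₁ := sum_comm₃ fun n m c => sgn c •
    (form (rho b c) * (form (C c n m) * form (Y n m)))
  have f₂ := sum_comm₃ fun n m j => sgn j •
    (form (kappa j) * (form (W j b n m) * form (Y n m)))
  have f₃ := sum_comm₃ fun n m e => form (xi e) * (form (dC b n m e) * form (Y n m))
  have f₄ : ∑ n, ∑ m, (3 : ℝ) • (form lam * (form (C b n m) * form (Y n m)))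
      = ∑ n, ∑ m, (2 : ℝ) • (form lam * (form (C b n m) * form (Y n m)))
        + ∑ n, ∑ m, form lam * (form (C b n m) * form (Y n m)) := by
    simp only [← Finset.smul_sum]
    module
  simp only [cottonContr, weylContr, map_sum, preLie_mul, parity_C, map_add, map_mul,
    form_preLie_C, hY _ _]
  simp only [add_mul, mul_sub, mul_add, smul_add, Finset.mul_sum, Finset.sum_mul, Finset.smul_sum,
    smul_mul_assoc, mul_smul_comm, mul_assoc, Finset.sum_add_distrib, Finset.sum_sub_distrib, h₁]
    at h ⊢
  linear_combination (norm := module) h + f₁ + f₂ + f₃ + f₄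

theorem form_preLie_xi_mul_xi (p k : Fin 4) : form (preLie (xi p * xi k))
    = (∑ c, (sgn p • (form (rho p c) * (form (xi c) * form (xi k)))
        + sgn k • (form (rho k c) * (form (xi p) * form (xi c)))))
      - (2 : ℝ) • (form lam * (form (xi p) * form (xi k))) := by
  have h₁ : ∀ c, form (xi p) * (form (rho k c) * form (xi c))
      = -(form (rho k c) * (form (xi p) * form (xi c))) := by
    intro c
    rw [← mul_assoc, form_odd_mul (xi_mem p) (rho_mem k c), neg_mul, mul_assoc]
  have h₂ : form (xi p) * (form lam * form (xi k)) = -(form lam * (form (xi p) * form (xi k))) := by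
    rw [← mul_assoc, form_odd_mul (xi_mem p) lam_mem, neg_mul, mul_assoc]
  have h₃ : form (xi p) * (form (xi k) * form lam) = form lam * (form (xi p) * form (xi k)) := by
    rw [form_odd_mul (xi_mem k) lam_mem, mul_neg, h₂, neg_neg]
  simp only [preLie_mul, parity_xi, preLie_xi, map_add, map_mul, map_neg, map_sum, map_smul,
    add_mul, mul_add, Finset.mul_sum, Finset.sum_mul, smul_mul_assoc, mul_smul_comm, neg_mul,
    mul_assoc, h₁, h₂, h₃, smul_neg, Finset.sum_neg_distrib, Finset.sum_add_distrib]
  module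

/-! ### The square of `q` on the coordinates of ghost degree one -/

/-- The two-tensor `½ ξ^n ξ^m`. -/
def halfXiXi (n m : Fin 4) : Pre := (1 / 2 : ℝ) • (xi n * xi m)

theorem transformsLikeXiXi_halfXiXi : TransformsLikeXiXi halfXiXi := by
  intro n m
  simp only [halfXiXi, map_smul, form_preLie_xi_mul_xi, map_mul, smul_sub, Finset.smul_sum,
    smul_add, mul_smul_comm, smul_comm (1 / 2 : ℝ)]

theorem form_weylCurv (a b : Fin 4) : form (weylCurv a b) = form (weylContr halfXiXi a b) := by
  simp only [weylCurv, weylContr, halfXiXi, map_smul, map_sum, map_mul, form_W_mul,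
    Finset.smul_sum, smul_mul_assoc]

theorem form_cottonCurv (b : Fin 4) : form (cottonCurv b) = form (cottonContr halfXiXi b) := by
  simp only [cottonCurv, cottonContr, halfXiXi, map_smul, map_sum, map_mul, form_C_mul,
    Finset.smul_sum, smul_mul_assoc]

theorem form_xi_mul_xi (a b : Fin 4) : form (xi a) * form (xi b) = -(form (xi b) * form (xi a)) :=
  form_odd_mul (xi_mem a) (xi_mem b)

theorem weylCurv_mem (a b : Fin 4) : weylCurv a b ∈ preBidegree 0 2 :=
  Submodule.smul_mem _ _ (sum_mem fun _ _ => sum_mem fun _ _ =>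
    mul_mem_preBidegree (mul_mem_preBidegree (xi_mem _) (xi_mem _)) (W_mem _ _ _ _))

theorem cottonCurv_mem (b : Fin 4) : cottonCurv b ∈ preBidegree 0 2 :=
  Submodule.smul_mem _ _ (sum_mem fun _ _ => sum_mem fun _ _ =>
    mul_mem_preBidegree (mul_mem_preBidegree (xi_mem _) (xi_mem _)) (C_mem _ _ _))

theorem form_weylCurv_mul (a b : Fin 4) (u : Forms) :
    form (weylCurv a b) * u = u * form (weylCurv a b) :=
  form_commute (weylCurv_mem a b) even_two u

theorem form_cottonCurv_mul (b : Fin 4) (u : Forms) :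
    form (cottonCurv b) * u = u * form (cottonCurv b) :=
  form_commute (cottonCurv_mem b) even_two u

/-- The Bianchi identity for the curvature of `ρ_{ab}`. -/
theorem form_preLie_weylCurv (a b : Fin 4) : form (preLie (weylCurv a b))
    = (∑ c, sgn c • (form (rho a c) * form (weylCurv c b) + form (rho b c) * form (weylCurv a c)))
      + (sgn a • (form (xi a) * form (cottonCurv b)) - sgn b • (form (xi b) * form (cottonCurv a)))
      := by
  have h := sum_cyclic_eq_zero (x := fun a => form (xi a)) form_xi_mul_xi
    (t := fun n m e => form (dW a b n m e)
      - (eta a e • form (C b n m) - eta b e • form (C a n m))) (fun n m e => by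
      have := form_bianchi a b n m e
      linear_combination (norm := module) this)
  rw [form_preLie_congr (form_weylCurv a b), form_preLie_weylContr transformsLikeXiXi_halfXiXi]
  simp only [← form_weylCurv]
  congr 1
  simp only [form_cottonCurv, cottonContr, map_sum, halfXiXi, map_mul, map_smul]
  have e₁ : ∀ a b, ∑ e, ∑ n, ∑ m, eta a e • (form (C b n m)
      * (form (xi e) * (form (xi n) * form (xi m))))
      = sgn a • (form (xi a) * ∑ n, ∑ m, form (C b n m) * (form (xi n) * form (xi m))) := by
    intro a b
    simp only [← Finset.smul_sum, sum_eta_smul, Finset.mul_sum]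
    refine congrArg _ (Finset.sum_congr rfl fun n _ => Finset.sum_congr rfl fun m _ => ?_)
    rw [← mul_assoc, form_C_mul, mul_assoc]
  have e₂ : ∀ e n m, form (xi e) * (form (dW a b n m e) * (form (xi n) * form (xi m)))
      = form (dW a b n m e) * (form (xi e) * (form (xi n) * form (xi m))) := by
    intro e n m
    rw [← mul_assoc, ← form_dW_mul, mul_assoc]
  simp only [sub_mul, Finset.sum_sub_distrib, smul_mul_assoc, e₁] at h
  simp only [mul_smul_comm, e₂, ← Finset.smul_sum]
  linear_combination (norm := module) (1 / 2 : ℝ) • h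

/-- The Bianchi identity for the curvature of `κ_b`. -/
theorem form_preLie_cottonCurv (b : Fin 4) : form (preLie (cottonCurv b))
    = (∑ c, sgn c • (form (rho b c) * form (cottonCurv c))) + form lam * form (cottonCurv b)
      + ∑ j, sgn j • (form (kappa j) * form (weylCurv j b)) := by
  have h := sum_cyclic_eq_zero (x := fun a => form (xi a)) form_xi_mul_xi
    (t := fun n m e => form (dC b n m e)) (form_bianchi_cotton b)
  rw [form_preLie_congr (form_cottonCurv b), form_preLie_cottonContr transformsLikeXiXi_halfXiXi]
  simp only [← form_weylCurv, ← form_cottonCurv]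
  convert add_zero _
  have e₂ : ∀ e n m, form (xi e) * (form (dC b n m e) * (form (xi n) * form (xi m)))
      = form (dC b n m e) * (form (xi e) * (form (xi n) * form (xi m))) := by
    intro e n m
    rw [← mul_assoc, ← form_dC_mul, mul_assoc]
  simp only [halfXiXi, map_smul, map_mul, mul_smul_comm, e₂, ← Finset.smul_sum, h, smul_zero]

theorem sum_weylCurv_mul_xi (a : Fin 4) : ∑ c, form (weylCurv a c) * form (xi c) = 0 := by
  have h := sum_cyclic_eq_zero (x := fun a => form (xi a)) form_xi_mul_xi
    (t := fun n m e => form (W a e n m)) (fun n m e => by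
      have := form_W_cyclic a e n m
      linear_combination (norm := module) this)
  have e : ∀ c, form (weylCurv a c) * form (xi c) = (1 / 2 : ℝ) • ∑ n, ∑ m,
      form (W a c n m) * (form (xi c) * (form (xi n) * form (xi m))) := by
    intro c
    rw [form_weylCurv_mul, form_weylCurv]
    simp only [weylContr, halfXiXi, map_sum, map_mul, map_smul, mul_smul_comm, Finset.mul_sum,
      Finset.smul_sum]
    refine Finset.sum_congr rfl fun n _ => Finset.sum_congr rfl fun m _ => ?_
    rw [← mul_assoc, ← form_W_mul, mul_assoc]
  simp only [e, ← Finset.smul_sum, h, smul_zero]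

theorem sum_cottonCurv_mul_xi : ∑ c, form (cottonCurv c) * form (xi c) = 0 := by
  have h := sum_cyclic_eq_zero (x := fun a => form (xi a)) form_xi_mul_xi
    (t := fun n m e => form (C e n m)) (fun n m e => by
      have := form_C_cyclic e n m
      linear_combination (norm := module) this)
  have e : ∀ c, form (cottonCurv c) * form (xi c) = (1 / 2 : ℝ) • ∑ n, ∑ m,
      form (C c n m) * (form (xi c) * (form (xi n) * form (xi m))) := by
    intro c
    rw [form_cottonCurv_mul, form_cottonCurv]
    simp only [cottonContr, halfXiXi, map_sum, map_mul, map_smul, mul_smul_comm, Finset.mul_sum,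
      Finset.smul_sum]
    refine Finset.sum_congr rfl fun n _ => Finset.sum_congr rfl fun m _ => ?_
    rw [← mul_assoc, ← form_C_mul, mul_assoc]
  simp only [e, ← Finset.smul_sum, h, smul_zero]

theorem form_preLie_preLie_coord (x : Coord) : form (preLie (preLie (fn x))) = 0 := by
  have hxκ := fun a b => form_odd_mul (xi_mem a) (kappa_mem b)
  have hll := form_odd_sq lam_mem
  cases x with
  | xi a =>
    change form (preLie (preLie (xi a))) = 0
    have h := structure_sq_x (fun a => form (xi a)) (fun a => form (kappa a))
      (fun a b => form (rho a b)) (form lam) (fun a b => form (weylCurv a b)) a hxκ hll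
      (fun a => form_odd_sq (xi_mem a)) (sum_weylCurv_mul_xi a)
    rw [← h, preLie_xi]
    simp only [map_add, map_sum, map_smul, preLie_mul, parity_xi, parity_rho, neg_mul, map_mul,
      map_sub, preLie_xi, preLie_rho, preLie_lam, ← sub_eq_add_neg]
  | rho a b =>
    change form (preLie (preLie (rho a b))) = 0
    have h := structure_sq_r (fun a => form (xi a)) (fun a => form (kappa a))
      (fun a b => form (rho a b)) (form lam) (fun a b => form (weylCurv a b))
      (fun b => form (cottonCurv b)) a b
      (fun a b c => form_odd_mul (xi_mem a) (rho_mem b c))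
      (fun a b c => form_odd_mul (kappa_mem a) (rho_mem b c)) form_rho_antisymm
      (fun a b c d => form_weylCurv_mul a b _)
    rw [← h, preLie_rho]
    simp only [map_add, map_sum, map_smul, preLie_mul, parity_xi, parity_rho, neg_mul, map_mul,
      map_sub, preLie_xi, preLie_rho, preLie_kappa, form_preLie_weylCurv, ← sub_eq_add_neg]
  | kappa b =>
    change form (preLie (preLie (kappa b))) = 0
    have h := structure_sq_κ (fun a => form (xi a)) (fun a => form (kappa a))
      (fun a b => form (rho a b)) (form lam) (fun a b => form (weylCurv a b))
      (fun b => form (cottonCurv b)) b hxκ (fun a => form_odd_sq (kappa_mem a)) hll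
      form_rho_antisymm (fun a c d => form_cottonCurv_mul a _)
    rw [← h, preLie_kappa]
    simp only [map_add, map_sum, map_smul, preLie_mul, parity_kappa, parity_lam, neg_mul, map_mul,
      map_sub, preLie_rho, preLie_kappa, preLie_lam, form_preLie_cottonCurv, ← sub_eq_add_neg]
  | lam =>
    change form (preLie (preLie lam)) = 0
    have h := structure_sq_l (fun a => form (xi a)) (fun a => form (kappa a))
      (fun a b => form (rho a b)) (form lam) (fun b => form (cottonCurv b))
      (fun a => form_odd_mul (xi_mem a) lam_mem) (fun a => form_odd_mul (kappa_mem a) lam_mem)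
      sum_cottonCurv_mul_xi
    rw [← h, preLie_lam]
    simp only [map_add, map_sub, map_sum, map_smul, preLie_mul, parity_kappa, neg_mul, map_mul,
      preLie_kappa, preLie_xi, ← sub_eq_add_neg]
  | weyl k i => exact form_preLie_preLie_weyl i

theorem lieQ_lieQ (z : Forms) : lieQ (lieQ z) = 0 := by
  obtain ⟨w, rfl⟩ := form_surjective z
  rw [lieQ_form, lieQ_form, form_eq_zero_iff]
  refine vanishes_preLie_preLie (fun x => ?_) w
  rw [← form_eq_zero_iff, ← preLie_fn]
  exact form_preLie_preLie_coord x

theorem lieQ_mem_bidegree {p g : ℕ} {z : Forms} (hz : z ∈ bidegree p g) :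
    lieQ z ∈ bidegree p (g + 1) := by
  obtain ⟨w, hw, rfl⟩ := exists_of_mem_bidegree hz
  rw [lieQ_form]
  exact form_mem_bidegree (preLie_mem hw)

/-! ### The Levi-Civita tensor and products of the `ξ^a` -/

/-- The Levi-Civita symbol as a Vandermonde product, normalized by its value `12` on `0123`. -/
def epsInt (a b c d : Fin 4) : ℤ :=
  (((b : ℕ) : ℤ) - (a : ℕ)) * (((c : ℕ) : ℤ) - (a : ℕ)) * (((d : ℕ) : ℤ) - (a : ℕ))
    * (((c : ℕ) : ℤ) - (b : ℕ)) * (((d : ℕ) : ℤ) - (b : ℕ)) * (((d : ℕ) : ℤ) - (c : ℕ)) / 12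

theorem det_eq_epsInt : ∀ a b c d : Fin 4,
    (Matrix.of fun i j : Fin 4 => if ![a, b, c, d] i = j then (1 : ℤ) else 0).det
      = epsInt a b c d := by
  decide +kernel

theorem epsUp_eq_epsInt (a b c d : Fin 4) : epsUp a b c d = epsInt a b c d := by
  rw [← det_eq_epsInt, epsUp, Int.cast_det]
  congr 1
  ext i j
  simp [delta]

/-- The two-tensor `ε^{nmpk} ξ_p ξ_k`. -/
def dualXiXi (n m : Fin 4) : Pre :=
  ∑ p, ∑ k, (epsUp n m p k * (sgn p * sgn k)) • (xi p * xi k)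

/-- The components of `ε^{nmpk} ξ_p ξ_k`, which is antisymmetric in `n` and `m`. The signs come from
those of the permutations and from the lowering of the index of `ξ^0`. -/
theorem form_dualXiXi_table :
    (∀ n, form (dualXiXi n n) = 0) ∧ (∀ n m, form (dualXiXi n m) = -form (dualXiXi m n)) ∧
    form (dualXiXi 0 1) = (2 : ℝ) • (form (xi 2) * form (xi 3)) ∧
    form (dualXiXi 0 2) = (-2 : ℝ) • (form (xi 1) * form (xi 3)) ∧
    form (dualXiXi 0 3) = (2 : ℝ) • (form (xi 1) * form (xi 2)) ∧
    form (dualXiXi 1 2) = (-2 : ℝ) • (form (xi 0) * form (xi 3)) ∧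
    form (dualXiXi 1 3) = (2 : ℝ) • (form (xi 0) * form (xi 2)) ∧
    form (dualXiXi 2 3) = (-2 : ℝ) • (form (xi 0) * form (xi 1)) := by
  have h₀ : ∀ n p k, epsInt n n p k = 0 := by decide
  have h₁ : ∀ n m p k, epsInt n m p k = -epsInt m n p k := by decide
  have e : ∀ n m, form (dualXiXi n m)
      = ∑ p, ∑ k, ((epsInt n m p k : ℝ) * (sgn p * sgn k)) • (form (xi p) * form (xi k)) := by
    intro n m
    simp only [dualXiXi, epsUp_eq_epsInt, map_sum, map_smul, map_mul]
  have s : sgn 0 = -1 ∧ sgn 1 = 1 ∧ sgn 2 = 1 ∧ sgn 3 = 1 := by simp [sgn]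
  obtain ⟨s₀, s₁, s₂, s₃⟩ := s
  have x₁ := form_xi_mul_xi 1 0
  have x₂ := form_xi_mul_xi 2 0
  have x₃ := form_xi_mul_xi 2 1
  have x₄ := form_xi_mul_xi 3 0
  have x₅ := form_xi_mul_xi 3 1
  have x₆ := form_xi_mul_xi 3 2
  refine ⟨fun n => ?_, fun n m => ?_, ?_, ?_, ?_, ?_, ?_, ?_⟩
  · simp only [e, h₀, Int.cast_zero, zero_mul, zero_smul, Finset.sum_const_zero]
  · simp only [e, h₁ n m, Int.cast_neg, neg_mul, neg_smul, Finset.sum_neg_distrib]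
  all_goals
    rw [e]
    simp [Fin.sum_univ_four, epsInt, s₀, s₁, s₂, s₃, x₁, x₂, x₃, x₄, x₅, x₆]
    module

set_option linter.unusedSimpArgs false in
/-- The Lorentz invariance of the Levi-Civita tensor: `ε^{nmpk} ξ_p ξ_k` transforms under `q` as
`ξ^n ξ^m` does. -/
theorem transformsLikeXiXi_dualXiXi : TransformsLikeXiXi dualXiXi := by
  obtain ⟨t₀, ta, t₁, t₂, t₃, t₄, t₅, t₆⟩ := form_dualXiXi_table
  have s : sgn 0 = -1 ∧ sgn 1 = 1 ∧ sgn 2 = 1 ∧ sgn 3 = 1 := by simp [sgn]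
  obtain ⟨s₀, s₁, s₂, s₃⟩ := s
  have x₁ := form_xi_mul_xi 1 0
  have x₂ := form_xi_mul_xi 2 0
  have x₃ := form_xi_mul_xi 2 1
  have x₄ := form_xi_mul_xi 3 0
  have x₅ := form_xi_mul_xi 3 1
  have x₆ := form_xi_mul_xi 3 2
  have y : ∀ a, form (xi a) * form (xi a) = 0 := fun a => form_odd_sq (xi_mem a)
  have r₀ : ∀ a, form (rho a a) = 0 := fun a => eq_zero_of_eq_neg (form_rho_antisymm a a)
  have r₁ := form_rho_antisymm 1 0
  have r₂ := form_rho_antisymm 2 0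
  have r₃ := form_rho_antisymm 2 1
  have r₄ := form_rho_antisymm 3 0
  have r₅ := form_rho_antisymm 3 1
  have r₆ := form_rho_antisymm 3 2
  have u₁ := ta 1 0
  have u₂ := ta 2 0
  have u₃ := ta 2 1
  have u₄ := ta 3 0
  have u₅ := ta 3 1
  have u₆ := ta 3 2
  have key : ∀ n m p k (r : ℝ), form (dualXiXi n m) = r • (form (xi p) * form (xi k)) →
      form (preLie (dualXiXi n m)) = r • form (preLie (xi p * xi k)) := by
    intro n m p k r h
    rw [form_preLie_congr (w := r • (xi p * xi k)) (by rw [h, map_smul, map_mul]), map_smul,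
      map_smul]
  -- by antisymmetry in `n` and `m`, the six components with `n < m` suffice
  have lt : ∀ n m, n < m → form (preLie (dualXiXi n m))
      = (∑ c, (sgn n • (form (rho n c) * form (dualXiXi c m))
          + sgn m • (form (rho m c) * form (dualXiXi n c))))
        - (2 : ℝ) • (form lam * form (dualXiXi n m)) := by
    intro n m h
    fin_cases n <;> fin_cases m <;> first | exact absurd h (by decide) | skip
    on_goal 1 => refine (key _ _ _ _ _ t₁).trans ?_
    on_goal 2 => refine (key _ _ _ _ _ t₂).trans ?_
    on_goal 3 => refine (key _ _ _ _ _ t₃).trans ?_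
    on_goal 4 => refine (key _ _ _ _ _ t₄).trans ?_
    on_goal 5 => refine (key _ _ _ _ _ t₅).trans ?_
    on_goal 6 => refine (key _ _ _ _ _ t₆).trans ?_
    all_goals
      simp [form_preLie_xi_mul_xi, Fin.sum_univ_four, s₀, s₁, s₂, s₃, t₀, t₁, t₂, t₃, t₄, t₅, t₆,
        r₀, r₁, r₂, r₃, r₄, r₅, r₆, u₁, u₂, u₃, u₄, u₅, u₆, y, x₁, x₂, x₃, x₄, x₅, x₆]
      module
  intro n m
  rcases lt_trichotomy n m with h | rfl | h
  · exact lt n m h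
  · rw [form_preLie_congr (w := 0) (by rw [t₀, map_zero])]
    simp only [map_zero, t₀, mul_zero, smul_zero, sub_zero, ta n, mul_neg, smul_neg]
    exact (Finset.sum_eq_zero fun _ _ => add_neg_cancel _).symm
  · have e := lt m n h
    rw [form_preLie_congr (w := -dualXiXi m n) (by rw [ta, map_neg])]
    rw [map_neg, map_neg, e, ta n m]
    simp only [fun c => ta c m, fun c => ta n c, mul_neg, smul_neg, neg_sub,
      Finset.sum_add_distrib, Finset.sum_neg_distrib]
    module

/-! ### Duality of the Weyl tensor -/

theorem epsUp_antisymm (a b c d : Fin 4) : epsUp a b c d = -epsUp b a c d := by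
  have h : ∀ a b c d, epsInt a b c d = -epsInt b a c d := by decide
  rw [epsUp_eq_epsInt, epsUp_eq_epsInt, h, Int.cast_neg]

theorem epsUp_pair (a b c d : Fin 4) : epsUp a b c d = epsUp c d a b := by
  have h : ∀ a b c d, epsInt a b c d = epsInt c d a b := by decide
  rw [epsUp_eq_epsInt, epsUp_eq_epsInt, h]

/-- The contractions of the Levi-Civita symbol with an antisymmetric two-tensor. -/
theorem epsUp_contr {g : Fin 4 → Fin 4 → ℝ} (hg : ∀ a b, g a b = -g b a) :
    ∑ c, ∑ d, epsUp 0 1 c d * g c d = 2 * g 2 3 ∧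
    ∑ c, ∑ d, epsUp 0 2 c d * g c d = -2 * g 1 3 ∧
    ∑ c, ∑ d, epsUp 0 3 c d * g c d = 2 * g 1 2 ∧
    ∑ c, ∑ d, epsUp 1 2 c d * g c d = 2 * g 0 3 ∧
    ∑ c, ∑ d, epsUp 1 3 c d * g c d = -2 * g 0 2 ∧
    ∑ c, ∑ d, epsUp 2 3 c d * g c d = 2 * g 0 1 := by
  simp only [epsUp_eq_epsInt]
  refine ⟨?_, ?_, ?_, ?_, ?_, ?_⟩
  all_goals
    simp [Fin.sum_univ_four, epsInt, hg 3 2, hg 3 1, hg 3 0, hg 2 1, hg 2 0, hg 1 0]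
    ring

/-- An antisymmetric two-tensor is determined by its six components above the diagonal. -/
theorem antisymm_ext {g h : Fin 4 → Fin 4 → ℝ} (hg : ∀ a b, g a b = -g b a)
    (hh : ∀ a b, h a b = -h b a) (H : ∀ a b, a < b → g a b = h a b) (a b : Fin 4) :
    g a b = h a b := by
  rcases lt_trichotomy a b with l | rfl | l
  · exact H a b l
  · linarith [hg a a, hh a a]
  · rw [hg, hh, H b a l]

set_option linter.unusedSimpArgs false in
/-- For a tensor with the algebraic symmetries of the Weyl tensor the left dual and the right dual
agree. -/
theorem dual_comm {w : Fin 4 → Fin 4 → Fin 4 → Fin 4 → ℝ}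
    (hl : ∀ a b c d, w a b c d = -w b a c d) (hr : ∀ a b c d, w a b c d = -w a b d c)
    (hp : ∀ a b c d, w a b c d = w c d a b)
    (hc : ∀ a b c d, w a b c d + w a c d b + w a d b c = 0)
    (ht : ∀ b d, ∑ a, sgn a * w a b a d = 0) (a b p k : Fin 4) :
    sgn p * sgn k * ∑ n, ∑ m, epsUp p k n m * w a b n m
      = sgn a * sgn b * ∑ n, ∑ m, epsUp a b n m * w n m p k := by
  have s : sgn 0 = -1 ∧ sgn 1 = 1 ∧ sgn 2 = 1 ∧ sgn 3 = 1 := by simp [sgn]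
  obtain ⟨s₀, s₁, s₂, s₃⟩ := s
  have l₀ : ∀ a c d, w a a c d = 0 := fun a c d => by linarith [hl a a c d]
  have r₀ : ∀ a b c, w a b c c = 0 := fun a b c => by linarith [hr a b c c]
  have T := fun b d => ht b d
  -- the relations in terms of the components `w a b c d` with `a < b` and `c < d`
  simp only [Fin.sum_univ_four, s₀, s₁, s₂, s₃] at T
  have t₀₀ := T 0 0
  have t₀₁ := T 0 1
  have t₀₂ := T 0 2
  have t₀₃ := T 0 3
  have t₁₁ := T 1 1
  have t₁₂ := T 1 2
  have t₁₃ := T 1 3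
  have t₂₂ := T 2 2
  have t₂₃ := T 2 3
  have t₃₃ := T 3 3
  have c₀ := hc 0 1 2 3
  simp only [l₀, r₀, hl 3 2, hl 3 1, hl 3 0, hl 2 1, hl 2 0, hl 1 0, hr _ _ 3 2, hr _ _ 3 1,
    hr _ _ 3 0, hr _ _ 2 1, hr _ _ 2 0, hr _ _ 1 0]
    at t₀₀ t₀₁ t₀₂ t₀₃ t₁₁ t₁₂ t₁₃ t₂₂ t₂₃ t₃₃ c₀
  have p₁ := hp 0 1 0 2
  have p₂ := hp 0 1 0 3
  have p₃ := hp 0 1 1 2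
  have p₄ := hp 0 1 1 3
  have p₅ := hp 0 1 2 3
  have p₆ := hp 0 2 0 3
  have p₇ := hp 0 2 1 2
  have p₈ := hp 0 2 1 3
  have p₉ := hp 0 2 2 3
  have q₁ := hp 0 3 1 2
  have q₂ := hp 0 3 1 3
  have q₃ := hp 0 3 2 3
  have q₄ := hp 1 2 1 3
  have q₅ := hp 1 2 2 3
  have q₆ := hp 1 3 2 3
  -- both sides are antisymmetric in `a b` and in `p k`
  revert a b
  refine antisymm_ext (fun a b => ?_) (fun a b => ?_) fun a b hab => ?_
  · simp only [hl a b, mul_neg, Finset.sum_neg_distrib]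
  · simp only [epsUp_antisymm a b, neg_mul, mul_neg, Finset.sum_neg_distrib, mul_comm (sgn a)]
  revert p k
  refine antisymm_ext (fun p k => ?_) (fun p k => ?_) fun p k hpk => ?_
  · simp only [epsUp_antisymm p k, neg_mul, mul_neg, Finset.sum_neg_distrib, mul_comm (sgn p)]
  · simp only [fun n m => hr n m p k, mul_neg, Finset.sum_neg_distrib]
  obtain ⟨a₁, a₂, a₃, a₄, a₅, a₆⟩ := epsUp_contr (hr a b)
  obtain ⟨b₁, b₂, b₃, b₄, b₅, b₆⟩ := epsUp_contr (g := fun n m => w n m p k) fun n m => hl n m p k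
  fin_cases p <;> fin_cases k <;> first | exact absurd hpk (by decide) | skip
  all_goals fin_cases a <;> fin_cases b <;> first | exact absurd hab (by decide) | skip
  all_goals
    simp only [Fin.mk_one, Fin.zero_eta, Fin.reduceFinMk, s₀, s₁, s₂, s₃, a₁, a₂, a₃, a₄, a₅, a₆,
      b₁, b₂, b₃, b₄, b₅, b₆] at a₁ a₂ a₃ a₄ a₅ a₆ b₁ b₂ b₃ b₄ b₅ b₆ ⊢
    linarith

/-! ### Identities for the dual curvatures -/

set_option linter.unusedSimpArgs false in
/-- The products of three and of four `ξ^a` are dual to a vector and to a scalar. -/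
theorem exists_xi_mul_dualXiXi : ∃ (Θ : Fin 4 → Forms) (V : Forms),
    (∀ e n m, form (xi e) * form (dualXiXi n m)
      = sgn e • (delta e n • Θ m - delta e m • Θ n)) ∧
    ∀ i m, form (xi i) * Θ m = (sgn i * delta i m) • V := by
  obtain ⟨t₀, ta, t₁, t₂, t₃, t₄, t₅, t₆⟩ := form_dualXiXi_table
  have s : sgn 0 = -1 ∧ sgn 1 = 1 ∧ sgn 2 = 1 ∧ sgn 3 = 1 := by simp [sgn]
  obtain ⟨s₀, s₁, s₂, s₃⟩ := s
  have x₁ := form_xi_mul_xi 1 0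
  have x₂ := form_xi_mul_xi 2 0
  have x₃ := form_xi_mul_xi 2 1
  have x₄ := form_xi_mul_xi 3 0
  have x₅ := form_xi_mul_xi 3 1
  have x₆ := form_xi_mul_xi 3 2
  have y : ∀ a, form (xi a) * form (xi a) = 0 := fun a => form_odd_sq (xi_mem a)
  have asc : ∀ {u v w : Forms} (z : Forms), u * v = w → u * (v * z) = w * z := by
    rintro u v _ z rfl
    exact (mul_assoc _ _ _).symm
  have X₁ := fun z => asc z x₁
  have X₂ := fun z => asc z x₂
  have X₃ := fun z => asc z x₃
  have X₄ := fun z => asc z x₄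
  have X₅ := fun z => asc z x₅
  have X₆ := fun z => asc z x₆
  have Y := fun a z => asc z (y a)
  refine ⟨![(-2 : ℝ) • (form (xi 1) * (form (xi 2) * form (xi 3))),
    (-2 : ℝ) • (form (xi 0) * (form (xi 2) * form (xi 3))),
    (2 : ℝ) • (form (xi 0) * (form (xi 1) * form (xi 3))),
    (-2 : ℝ) • (form (xi 0) * (form (xi 1) * form (xi 2)))],
    (2 : ℝ) • (form (xi 0) * (form (xi 1) * (form (xi 2) * form (xi 3)))), ?_, ?_⟩
  · intro e
    refine fun n m => ?_
    fin_cases e <;> fin_cases n <;> fin_cases m <;>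
    simp [t₀, t₁, t₂, t₃, t₄, t₅, t₆, ta 1 0, ta 2 0, ta 2 1, ta 3 0, ta 3 1, ta 3 2, s₀, s₁, s₂,
      s₃, delta, x₁, x₂, x₃, x₄, x₅, x₆, y, X₁, X₂, X₃, X₄, X₅, X₆, Y, mul_assoc]
  · intro i m
    fin_cases i <;> fin_cases m <;>
    simp [s₀, s₁, s₂, s₃, delta, x₁, x₂, x₃, x₄, x₅, x₆, y, X₁, X₂, X₃, X₄, X₅, X₆, Y, mul_assoc]

/-- The product `½ ξ^i ξ^j ε^{nmpk} ξ_p ξ_k` is symmetric in the pairs `ij` and `nm`. -/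
theorem form_halfXiXi_mul_dualXiXi (i j n m : Fin 4) :
    form (halfXiXi i j) * form (dualXiXi n m) = form (halfXiXi n m) * form (dualXiXi i j) := by
  obtain ⟨Θ, V, h₁, h₂⟩ := exists_xi_mul_dualXiXi
  have h : ∀ i j n m, form (halfXiXi i j) * form (dualXiXi n m)
      = ((1 / 2) * (sgn i * sgn j * (delta j n * delta i m - delta j m * delta i n))) • V := by
    intro i j n m
    rw [halfXiXi, map_smul, map_mul, smul_mul_assoc, mul_assoc, h₁, mul_smul_comm, mul_sub,
      mul_smul_comm, mul_smul_comm, h₂, h₂]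
    module
  rw [h, h]
  congr 2
  have e₁ := sgn_mul_delta j n
  have e₂ := sgn_mul_delta i m
  have e₃ := sgn_mul_delta j m
  have e₄ := sgn_mul_delta i n
  rw [delta_comm m i, delta_comm n j, delta_comm m j, delta_comm n i]
  linear_combination sgn i * delta i m * e₁ + sgn n * delta j n * e₂
    - sgn i * delta i n * e₃ - sgn m * delta j m * e₄

/-- The contraction of an antisymmetric three-tensor with `ξ_e ε^{nmpk} ξ_p ξ_k`, which is dual to a
vector, only involves its trace. -/
theorem sum_xi_mul_dualXiXi {Θ : Fin 4 → Forms}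
    (hΘ : ∀ e n m, form (xi e) * form (dualXiXi n m)
      = sgn e • (delta e n • Θ m - delta e m • Θ n))
    {t : Fin 4 → Fin 4 → Fin 4 → Forms} (ht : ∀ n m e u, t n m e * u = u * t n m e)
    (ha : ∀ n m e, t n m e = -t m n e) :
    ∑ e, ∑ n, ∑ m, form (xi e) * (t n m e * form (dualXiXi n m))
      = (2 : ℝ) • ∑ m, (∑ n, sgn n • t n m n) * Θ m := by
  have h : ∀ e n m, form (xi e) * (t n m e * form (dualXiXi n m))
      = delta e n • sgn e • (t n m e * Θ m) + delta e m • sgn e • (t m n e * Θ n) := by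
    intro e n m
    rw [← mul_assoc, ← ht, mul_assoc, hΘ, ha m n e]
    simp only [mul_smul_comm, mul_sub, neg_mul]
    module
  simp only [h, Finset.sum_add_distrib, sum_delta_smul]
  have h₁ : ∀ f : Fin 4 → Fin 4 → Forms,
      ∑ e, ∑ n, ∑ m, delta e n • f e m = ∑ m, ∑ n, f n m := by
    intro f
    rw [Finset.sum_comm (s := (Finset.univ : Finset (Fin 4))) (f := fun m n => f n m)]
    refine Finset.sum_congr rfl fun e _ => ?_
    simp only [← Finset.smul_sum, sum_delta_smul]
  rw [show ∑ e, ∑ n, ∑ m, delta e n • sgn e • (t n m e * Θ m)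
      = ∑ e, ∑ n, delta e n • ∑ m, sgn e • (t n m e * Θ m) by simp only [Finset.smul_sum]]
  simp only [sum_delta_smul, Finset.sum_mul, smul_mul_assoc]
  rw [two_smul, Finset.sum_comm]

/-- The Weyl tensor being traceless, the dual Weyl tensor satisfies the cyclic identity. -/
theorem sum_xi_mul_weylContr (b : Fin 4) :
    ∑ a, form (xi a) * form (weylContr dualXiXi a b) = 0 := by
  obtain ⟨Θ, V, h₁, -⟩ := exists_xi_mul_dualXiXi
  have h := sum_xi_mul_dualXiXi h₁ (t := fun n m e => form (W e b n m))
    (fun n m e => form_W_mul e b n m) fun n m e => form_W_antisymm_right e b n m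
  simp only [form_W_trace, zero_mul, Finset.sum_const_zero, smul_zero] at h
  simpa only [weylContr, map_sum, map_mul, Finset.mul_sum] using h

/-- The Cotton tensor being traceless, the dual Cotton tensor satisfies the cyclic identity. -/
theorem sum_xi_mul_cottonContr : ∑ a, form (xi a) * form (cottonContr dualXiXi a) = 0 := by
  obtain ⟨Θ, V, h₁, -⟩ := exists_xi_mul_dualXiXi
  have h := sum_xi_mul_dualXiXi h₁ (t := fun n m e => form (C e n m))
    (fun n m e => form_C_mul e n m) fun n m e => form_C_antisymm e n m
  simp only [form_C_trace, zero_mul, Finset.sum_const_zero, smul_zero] at h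
  simpa only [cottonContr, map_sum, map_mul, Finset.mul_sum] using h

/-- The Bianchi identity for the dual Weyl tensor, which is the definition of the Cotton tensor as
the divergence of the Weyl tensor. -/
theorem sum_xi_mul_dW (a b : Fin 4) :
    ∑ e, ∑ n, ∑ m, form (xi e) * (form (dW a b n m e) * form (dualXiXi n m))
      = sgn a • (form (xi a) * form (cottonContr dualXiXi b))
        - sgn b • (form (xi b) * form (cottonContr dualXiXi a)) := by
  obtain ⟨Θ, V, h₁, -⟩ := exists_xi_mul_dualXiXi
  have h := sum_xi_mul_dualXiXi h₁ (t := fun n m e => form (dW a b n m e))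
    (fun n m e => form_dW_mul a b n m e) fun n m e => form_dW_antisymm_right a b n m e
  have hC : ∀ a b, sgn a • (form (xi a) * form (cottonContr dualXiXi b))
      = (2 : ℝ) • ∑ m, form (C b a m) * Θ m := by
    intro a b
    have h := sum_xi_mul_dualXiXi h₁ (t := fun n m e => delta a e • form (C b n m))
      (fun n m e u => by rw [smul_mul_assoc, form_C_mul, mul_smul_comm])
      fun n m e => by rw [form_C_antisymm, smul_neg]
    simp only [smul_mul_assoc, mul_smul_comm, ← Finset.smul_sum, sum_delta_smul] at h
    simp only [cottonContr, map_sum, map_mul, Finset.mul_sum, h]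
    simp only [smul_comm _ (delta a _), sum_delta_smul, smul_mul_assoc, smul_comm _ (2 : ℝ),
      Finset.smul_sum, sgn_smul_sgn_smul]
  have hW : ∀ m, ∑ n, sgn n • form (dW a b n m n) = form (C m a b) := by
    intro m
    simp only [form_C, form_dW_pair a b]
  rw [h, hC, hC, ← smul_sub, ← Finset.sum_sub_distrib]
  refine congrArg _ (Finset.sum_congr rfl fun m _ => ?_)
  rw [hW, ← sub_mul]
  congr 1
  have := form_C_cyclic m a b
  linear_combination (norm := module) this - form_C_antisymm b m a

/-- The Bianchi identity for the dual Cotton tensor, which is the Bach equation. -/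
theorem sum_xi_mul_dC (a : Fin 4) :
    ∑ e, ∑ n, ∑ m, form (xi e) * (form (dC a n m e) * form (dualXiXi n m)) = 0 := by
  obtain ⟨Θ, V, h₁, -⟩ := exists_xi_mul_dualXiXi
  have h := sum_xi_mul_dualXiXi h₁ (t := fun n m e => form (dC a n m e))
    (fun n m e => form_dC_mul a n m e) fun n m e => form_dC_antisymm a n m e
  simpa only [form_bach, zero_mul, Finset.sum_const_zero, smul_zero] using h

/-- The left dual and the right dual of the Weyl tensor agree; `dual_comm` applies to the values of
any linear functional on the components. -/
theorem form_W_dual (a b p k : Fin 4) :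
    (sgn p * sgn k) • ∑ n, ∑ m, epsUp p k n m • form (W a b n m)
      = (sgn a * sgn b) • ∑ n, ∑ m, epsUp a b n m • form (W n m p k) := by
  rw [← sub_eq_zero, ← Module.forall_dual_apply_eq_zero_iff ℝ]
  intro φ
  have h := dual_comm (w := fun a b c d => φ (form (W a b c d)))
    (fun a b c d => by rw [form_W_antisymm_left, map_neg])
    (fun a b c d => by rw [form_W_antisymm_right, map_neg])
    (fun a b c d => by rw [form_W_pair])
    (fun a b c d => by rw [← map_add, ← map_add, form_W_cyclic, map_zero])
    (fun b d => by
      have := congrArg φ (form_W_trace b d)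
      simpa only [map_sum, map_smul, smul_eq_mul, map_zero] using this) a b p k
  simp only [map_sub, map_smul, map_sum, smul_eq_mul, h, sub_self]

theorem dualXiXi_eq (n m : Fin 4) : dualXiXi n m
    = ∑ p, ∑ k, (2 * (epsUp n m p k * (sgn p * sgn k))) • halfXiXi p k := by
  refine Finset.sum_congr rfl fun p _ => Finset.sum_congr rfl fun k _ => ?_
  rw [halfXiXi]
  module

/-- Moving the dual from the two-tensor `y` to the left pair of indices of the Weyl tensor. -/
theorem sum_W_mul_dual (a b : Fin 4) (y : Fin 4 → Fin 4 → Forms) :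
    ∑ n, ∑ m, form (W a b n m) * ∑ p, ∑ k, (2 * (epsUp n m p k * (sgn p * sgn k))) • y p k
      = ∑ n, ∑ m, (2 * (sgn a * sgn b) * epsUp a b n m) • ∑ p, ∑ k, form (W n m p k) * y p k := by
  have h₁ : ∀ p k, ∑ n, ∑ m, (2 * (epsUp n m p k * (sgn p * sgn k))) • (form (W a b n m) * y p k)
      = ∑ n, ∑ m, (2 * (sgn a * sgn b) * epsUp a b n m) • (form (W n m p k) * y p k) := by
    intro p k
    have h := congrArg (fun z => (2 : ℝ) • (z * y p k)) (form_W_dual a b p k)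
    simp only [Finset.smul_sum, Finset.sum_mul, smul_mul_assoc, smul_smul] at h
    refine Eq.trans ?_ (h.trans ?_)
    all_goals refine Finset.sum_congr rfl fun n _ => Finset.sum_congr rfl fun m _ => ?_
    all_goals congr 1
    · rw [epsUp_pair]
      ring
    · ring
  simp only [Finset.mul_sum, Finset.smul_sum, mul_smul_comm]
  rw [sum_comm₄, sum_comm₄ (fun n m p k => (2 * (sgn a * sgn b) * epsUp a b n m) •
    (form (W n m p k) * y p k))]
  simp only [h₁]

theorem form_preD_weylContr (Y : Fin 4 → Fin 4 → Pre) (a b : Fin 4) :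
    form (preD (weylContr Y a b)) = (∑ n, ∑ m, form (preD (W a b n m)) * form (Y n m))
      + ∑ n, ∑ m, form (W a b n m) * form (preD (Y n m)) := by
  simp only [weylContr, map_sum, preD_mul, parity_W, map_add, map_mul, Finset.sum_add_distrib]

/-- The pairing of the curvature two-form with the dual Weyl tensor is a symmetric bilinear form in
the curvature, so that both factors contribute equally to the differential of its square. -/
theorem sum_preD_weylCurv : ∑ a, ∑ b, (sgn a * sgn b) •
    (form (preD (weylCurv a b)) * form (weylContr dualXiXi a b)
      - form (weylCurv a b) * form (preD (weylContr dualXiXi a b))) = 0 := by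
  have hd : ∀ a b, form (preD (weylCurv a b)) = form (preD (weylContr halfXiXi a b)) := by
    intro a b
    rw [← d_form, ← d_form, form_weylCurv]
  have hh : ∀ n m u, form (halfXiXi n m) * u = u * form (halfXiXi n m) := fun n m u =>
    form_commute (Submodule.smul_mem _ _ (mul_mem_preBidegree (xi_mem n) (xi_mem m))) even_two u
  -- the terms with `dW` cancel by the symmetry of the product of four `ξ^a`
  have h₁ : ∀ a b, (∑ i, ∑ j, form (preD (W a b i j)) * form (halfXiXi i j))
        * form (weylContr dualXiXi a b)
      = form (weylContr halfXiXi a b)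
        * ∑ n, ∑ m, form (preD (W a b n m)) * form (dualXiXi n m) := by
    intro a b
    simp only [weylContr, map_sum, map_mul, Finset.mul_sum, Finset.sum_mul]
    rw [sum_comm₄]
    refine Finset.sum_congr rfl fun n _ => Finset.sum_congr rfl fun m _ => Finset.sum_congr rfl
      fun i _ => Finset.sum_congr rfl fun j _ => ?_
    rw [mul_assoc, hh n m, mul_assoc, ← hh n m, form_halfXiXi_mul_dualXiXi, ← mul_assoc,
      ← form_W_mul, mul_assoc, mul_assoc (form (W a b i j)), ← mul_assoc (form (halfXiXi i j)),
      hh i j, mul_assoc, hh i j, mul_assoc]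
  -- the terms with `dξ` cancel since the left dual and the right dual of `W` agree
  have h₂ : ∀ a b, form (weylContr dualXiXi a b)
      = ∑ n, ∑ m, (2 * (sgn a * sgn b) * epsUp a b n m) • form (weylContr halfXiXi n m) := by
    intro a b
    have h := sum_W_mul_dual a b fun p k => form (halfXiXi p k)
    simp only [weylContr, map_sum, map_mul, map_smul, dualXiXi_eq, h]
  have h₃ : ∀ a b, ∑ n, ∑ m, form (W a b n m) * form (preD (dualXiXi n m))
      = ∑ n, ∑ m, (2 * (sgn a * sgn b) * epsUp a b n m) •
        ∑ p, ∑ k, form (W n m p k) * form (preD (halfXiXi p k)) := by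
    intro a b
    have h := sum_W_mul_dual a b fun p k => form (preD (halfXiXi p k))
    simp only [map_sum, map_smul, dualXiXi_eq, h]
  have h₄ : ∀ a b, (sgn a * sgn b) •
      (form (preD (weylCurv a b)) * form (weylContr dualXiXi a b)
        - form (weylCurv a b) * form (preD (weylContr dualXiXi a b)))
      = ∑ n, ∑ m, (2 * epsUp a b n m) •
        ((∑ i, ∑ j, form (W a b i j) * form (preD (halfXiXi i j))) * form (weylContr halfXiXi n m)
        - (∑ i, ∑ j, form (W n m i j) * form (preD (halfXiXi i j)))
          * form (weylContr halfXiXi a b)) := by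
    intro a b
    have hs : ∀ n m, (sgn a * sgn b) * (2 * (sgn a * sgn b) * epsUp a b n m)
        = 2 * epsUp a b n m := by
      intro n m
      linear_combination 2 * epsUp a b n m * (sgn a * sgn a * sgn_mul_self b + sgn_mul_self a)
    rw [hd, form_preD_weylContr, form_preD_weylContr, add_mul, h₁, ← form_weylCurv a b, mul_add,
      add_sub_add_left_eq_sub, form_weylCurv_mul a b, h₂, h₃]
    simp only [mul_smul_comm, smul_mul_assoc, Finset.smul_sum, Finset.mul_sum, Finset.sum_mul,
      smul_sub, smul_smul, hs, Finset.sum_sub_distrib]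
  simp only [h₄]
  have h₅ := sum_comm₄ fun a b n m => (2 * epsUp a b n m) •
        ((∑ i, ∑ j, form (W a b i j) * form (preD (halfXiXi i j))) * form (weylContr halfXiXi n m))
  simp only [smul_sub, Finset.sum_sub_distrib]
  rw [h₅, sub_eq_zero]
  simp only [fun a b n m => epsUp_pair n m a b]

/-! ### The presymplectic form and its Hamiltonian -/

theorem weylContr_mem (a b : Fin 4) : weylContr dualXiXi a b ∈ preBidegree 0 2 :=
  sum_mem fun _ _ => sum_mem fun _ _ => mul_mem_preBidegree (W_mem _ _ _ _) <|
    sum_mem fun _ _ => sum_mem fun _ _ =>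
      Submodule.smul_mem _ _ (mul_mem_preBidegree (xi_mem _) (xi_mem _))

theorem cottonContr_mem (a : Fin 4) : cottonContr dualXiXi a ∈ preBidegree 0 2 :=
  sum_mem fun _ _ => sum_mem fun _ _ => mul_mem_preBidegree (C_mem _ _ _) <|
    sum_mem fun _ _ => sum_mem fun _ _ =>
      Submodule.smul_mem _ _ (mul_mem_preBidegree (xi_mem _) (xi_mem _))

theorem form_weylContr_antisymm (Y : Fin 4 → Fin 4 → Pre) (a b : Fin 4) :
    form (weylContr Y a b) = -form (weylContr Y b a) := by
  simp only [weylContr, map_sum, map_mul, form_W_antisymm_left a b, neg_mul,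
    Finset.sum_neg_distrib]

theorem epsDown_eq (a b c d : Fin 4) :
    epsDown a b c d = sgn a * sgn b * sgn c * sgn d * epsUp a b c d := by
  have h : ∀ a (f : Fin 4 → ℝ), ∑ b, eta a b * f b = sgn a * f a := sum_eta_smul
  simp only [epsDown, mul_assoc, ← Finset.mul_sum, h]

theorem WUp_eq (a b c d : Fin 4) :
    WUp a b c d = (sgn a * sgn b * sgn c * sgn d) • W a b c d := by
  simp only [WUp, mul_assoc, mul_smul, ← Finset.smul_sum, sum_eta_smul]

theorem CMixed_eq (a b c : Fin 4) : CMixed a b c = sgn a • C a b c := sum_eta_smul a _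

theorem weylDual_eq (a b : Fin 4) : weylDual a b = (sgn a * sgn b) • weylContr dualXiXi a b := by
  simp only [weylDual, weylContr, dualXiXi, epsDown_eq, WUp_eq, Finset.mul_sum, Finset.smul_sum,
    smul_mul_assoc, mul_smul_comm, smul_smul, mul_assoc (W _ _ _ _)]
  refine Finset.sum_congr rfl fun n _ => Finset.sum_congr rfl fun m _ =>
    Finset.sum_congr rfl fun p _ => Finset.sum_congr rfl fun k _ => ?_
  congr 1
  linear_combination sgn p * sgn k * epsUp n m p k * sgn a * sgn b *
    (sgn n * sgn n * sgn_mul_self m + sgn_mul_self n)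

theorem cottonDual_eq (a : Fin 4) : cottonDual a = sgn a • cottonContr dualXiXi a := by
  simp only [cottonDual, cottonContr, dualXiXi, CMixed_eq, xiDown_eq, Finset.mul_sum,
    Finset.smul_sum, smul_mul_assoc, mul_smul_comm, smul_smul, mul_assoc (C _ _ _)]
  refine Finset.sum_congr rfl fun n _ => Finset.sum_congr rfl fun m _ =>
    Finset.sum_congr rfl fun p _ => Finset.sum_congr rfl fun k _ => ?_
  congr 1
  ring

/-- `ω` as the class of an element of the free algebra. -/
def preOmega : Pre :=
  (∑ a, ∑ b, (sgn a * sgn b) • (preD (rho a b) * preD (weylContr dualXiXi a b)))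
    - (2 : ℝ) • ∑ a, preD (xi a) * preD (cottonContr dualXiXi a)

theorem omega_eq : omega = form preOmega := by
  simp only [omega, omegaW, omegaC, preOmega, weylDual_eq, cottonDual_eq, xiDown_eq, d_form,
    map_sub, map_sum, map_smul, map_mul, smul_mul_assoc, mul_smul_comm, sgn_smul_sgn_smul]

theorem omega_mem : omega ∈ bidegree 2 3 := by
  rw [omega_eq]
  refine form_mem_bidegree (sub_mem (sum_mem fun a _ => sum_mem fun b _ => ?_) ?_)
  · exact Submodule.smul_mem _ _ (mul_mem_preBidegree (preD_mem (rho_mem a b))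
      (preD_mem (weylContr_mem a b)))
  · exact Submodule.smul_mem _ _ (sum_mem fun a _ => mul_mem_preBidegree (preD_mem (xi_mem a))
      (preD_mem (cottonContr_mem a)))

theorem d_omega : d omega = 0 := by
  rw [omega_eq, d_form]
  simp only [preOmega, map_sub, map_sum, map_smul, preD_mul, preD_preD, zero_mul, mul_zero,
    add_zero, Finset.sum_const_zero, smul_zero, sub_zero, map_zero]

theorem d_d (z : Forms) : d (d z) = 0 := by
  obtain ⟨w, rfl⟩ := form_surjective z
  rw [d_form, d_form, preD_preD, map_zero]

theorem contrQ_form_preOmega : contrQ (form preOmega)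
    = (∑ a, ∑ b, (sgn a * sgn b) •
        (form (preLie (rho a b)) * form (preD (weylContr dualXiXi a b))
          + form (preD (rho a b)) * form (preLie (weylContr dualXiXi a b))))
      - (2 : ℝ) • ∑ a, (form (preLie (xi a)) * form (preD (cottonContr dualXiXi a))
          + form (preD (xi a)) * form (preLie (cottonContr dualXiXi a))) := by
  rw [contrQ_form]
  simp only [preOmega, map_sub, map_sum, map_smul, preI_mul, map_add, map_mul,
    preI_preD (rho_mem _ _), preI_preD (xi_mem _), preI_preD (weylContr_mem _ _),
    preI_preD (cottonContr_mem _)]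

/-- The Hamiltonian in terms of `q ρ_{ab}` and `q ξ^a`, as an element of the free algebra: the
coefficient `¼` of the Weyl tensor in `ℒ` is half of the one in `q ρ_{ab}`, whence the subtraction
of half of the curvature. -/
def preHamiltonian : Pre :=
  (∑ a, ∑ b, (sgn a * sgn b) •
      ((preLie (rho a b) - (1 / 2 : ℝ) • weylCurv a b) * weylContr dualXiXi a b))
    - (2 : ℝ) • ∑ a, preLie (xi a) * cottonContr dualXiXi a

theorem hamiltonian_eq : hamiltonian = form preHamiltonian := by
  have h₁ : ∀ a b : Fin 4, (1 / 4 : ℝ) • ∑ i, ∑ j,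
      form (W a b i j) * form (xi i) * form (xi j) = (1 / 2 : ℝ) • form (weylCurv a b) := by
    intro a b
    simp only [weylCurv, map_smul, map_sum, map_mul, mul_assoc, form_W_mul, smul_smul]
    norm_num
  -- by the antisymmetry of the dual Weyl tensor
  have h₂ : ∑ a, ∑ b, (sgn a * sgn b) • (sgn b •
        (form (xi b) * (form (kappa a) * form (weylContr dualXiXi a b))))
      = -∑ a, ∑ b, (sgn a * sgn b) • (sgn a •
        (form (xi a) * (form (kappa b) * form (weylContr dualXiXi a b)))) := by
    rw [Finset.sum_comm]
    simp only [← Finset.sum_neg_distrib]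
    refine Finset.sum_congr rfl fun a _ => Finset.sum_congr rfl fun b _ => ?_
    rw [form_weylContr_antisymm, mul_comm (sgn b)]
    simp only [mul_neg, smul_neg]
  simp only [hamiltonian, preHamiltonian, weylDual_eq, cottonDual_eq, xiDown_eq, sum_eta_smul,
    preLie_rho, preLie_xi, map_add, map_sub, map_smul, map_sum, map_mul, h₁]
  simp only [add_mul, sub_mul, smul_add, smul_sub, Finset.sum_mul, Finset.smul_sum, smul_mul_assoc,
    mul_smul_comm, mul_assoc, Finset.sum_add_distrib, Finset.sum_sub_distrib,
    sgn_smul_sgn_smul] at h₂ ⊢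
  simp only [smul_comm _ (2 : ℝ), smul_comm _ (1 / 2 : ℝ), ← Finset.smul_sum] at h₂ ⊢
  linear_combination (norm := module) h₂

section Ring

variable {A : Type*} [Ring A] [Algebra ℝ A]

/-- The part of `i_q ω = dℒ` that does not involve the curvatures, for `r = ρ`, `x = ξ`, `k = κ`,
`l = λ`, their differentials `dr`, `dx`, `dk`, `dl`, and the dual Weyl and Cotton tensors `b`, `g`:
it follows from the cyclic symmetry of the trace of `ρ dρ b` and from the cyclic identities `hxb`
and `hxg` for `b` and `g`. -/
theorem hamiltonian_identity {r dr b : Fin 4 → Fin 4 → A} {x dx k dk g : Fin 4 → A} {l dl : A}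
    (hr : ∀ i j, r i j = -r j i) (hdr : ∀ i j, dr i j = -dr j i) (hb : ∀ i j, b i j = -b j i)
    (cdr : ∀ i j u, dr i j * u = u * dr i j) (cdx : ∀ i u, dx i * u = u * dx i)
    (hxb : ∀ j, ∑ i, x i * b i j = 0) (hxg : ∑ i, x i * g i = 0)
    (cdk : ∀ i u, dk i * u = u * dk i) (cdl : ∀ u, dl * u = u * dl) :
    ∑ i, ∑ j, (sgn i * sgn j) • (dr i j * ((∑ c, sgn c • (r i c * b c j + r j c * b i c))
          + (sgn i • (x i * g j) - sgn j • (x j * g i)))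
        - ((∑ c, sgn c • (dr i c * r c j - r i c * dr c j))
          + (sgn i • (dx i * k j - x i * dk j) - sgn j • (dx j * k i - x j * dk i))) * b i j)
      = (2 : ℝ) • ∑ i, (dx i * ((∑ c, sgn c • (r i c * g c)) + l * g i
            + ∑ j, sgn j • (k j * b j i))
          - ((∑ c, sgn i • (dr i c * x c - r i c * dx c)) + (dx i * l - x i * dl)) * g i) := by
  have crd : ∀ i j u w, dr i j * (u * w) = u * (dr i j * w) := fun i j u w => by
    rw [← mul_assoc, cdr, mul_assoc]
  have cxd : ∀ i u w, dx i * (u * w) = u * (dx i * w) := fun i u w => by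
    rw [← mul_assoc, cdx, mul_assoc]
  have e₁ : ∀ i j (z : A), (sgn i * sgn j) • sgn i • z = sgn j • z := fun i j z => by
    rw [smul_smul, mul_right_comm, sgn_mul_self, one_mul]
  have e₂ : ∀ i j (z : A), (sgn i * sgn j) • sgn j • z = sgn i • z := fun i j z => by
    rw [smul_smul, mul_assoc, sgn_mul_self, mul_one]
  -- the terms with `ρ dρ`
  have f₁ : ∑ i, ∑ j, ∑ c, (sgn i * sgn j) • sgn c • (r i c * (dr i j * b c j))
      = -∑ i, ∑ j, ∑ c, (sgn i * sgn j) • sgn c • (r i c * (dr c j * b i j)) := by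
    rw [sum_comm₃]
    simp only [← Finset.sum_neg_distrib]
    refine Finset.sum_congr rfl fun i _ => ?_
    rw [Finset.sum_comm]
    refine Finset.sum_congr rfl fun j _ => Finset.sum_congr rfl fun c _ => ?_
    rw [hr]
    simp only [neg_mul]
    module
  have f₂ : ∑ i, ∑ j, ∑ c, (sgn i * sgn j) • sgn c • (r j c * (dr i j * b i c))
      = -∑ i, ∑ j, ∑ c, (sgn i * sgn j) • sgn c • (r i c * (dr c j * b i j)) := by
    rw [sum_comm₃]
    simp only [← Finset.sum_neg_distrib]
    refine Finset.sum_congr rfl fun i _ => Finset.sum_congr rfl fun j _ =>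
      Finset.sum_congr rfl fun c _ => ?_
    rw [hr, hdr, hb]
    simp only [neg_mul, mul_neg]
    module
  have f₃ : ∑ i, ∑ j, ∑ c, (sgn i * sgn j) • sgn c • (r c j * (dr i c * b i j))
      = -∑ i, ∑ j, ∑ c, (sgn i * sgn j) • sgn c • (r i c * (dr c j * b i j)) := by
    rw [Finset.sum_comm]
    simp only [← Finset.sum_neg_distrib]
    refine Finset.sum_congr rfl fun i _ => Finset.sum_congr rfl fun j _ =>
      Finset.sum_congr rfl fun c _ => ?_
    rw [hr, hdr, hb]
    simp only [neg_mul, mul_neg]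
    module
  -- the terms with `ξ dρ`
  have f₄ : ∑ i, ∑ j, sgn j • (x i * (dr i j * g j))
      = -∑ i, ∑ j, sgn i • (x j * (dr i j * g i)) := by
    rw [Finset.sum_comm]
    simp only [← Finset.sum_neg_distrib]
    refine Finset.sum_congr rfl fun i _ => Finset.sum_congr rfl fun j _ => ?_
    rw [hdr, neg_mul, mul_neg, smul_neg]
  -- the terms with `κ dξ`
  have f₅ : ∑ i, ∑ j, sgn i • (k i * (dx j * b i j))
      = -∑ i, ∑ j, sgn j • (k j * (dx i * b i j)) := by
    rw [Finset.sum_comm]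
    simp only [← Finset.sum_neg_distrib]
    refine Finset.sum_congr rfl fun i _ => Finset.sum_congr rfl fun j _ => ?_
    rw [hb, mul_neg, mul_neg, smul_neg]
  have f₆ : ∑ i, ∑ j, sgn j • (k j * (dx i * b j i))
      = -∑ i, ∑ j, sgn j • (k j * (dx i * b i j)) := by
    rw [← f₅, Finset.sum_comm]
  -- the terms with `ρ dξ`
  have f₇ : ∑ i, ∑ j, sgn i • (r i j * (dx j * g i))
      = -∑ i, ∑ j, sgn j • (r i j * (dx i * g j)) := by
    rw [Finset.sum_comm]
    simp only [← Finset.sum_neg_distrib]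
    refine Finset.sum_congr rfl fun i _ => Finset.sum_congr rfl fun j _ => ?_
    rw [hr, neg_mul, smul_neg]
  -- the terms with `ξ dκ` and `ξ dλ` vanish by the cyclic identities
  have h₁ : ∀ j, ∑ i, x i * (dk j * b i j) = 0 := fun j => by
    rw [← mul_zero (dk j), ← hxb j, Finset.mul_sum]
    exact Finset.sum_congr rfl fun i _ => by rw [← mul_assoc, ← cdk, mul_assoc]
  have f₈ : ∑ i, ∑ j, sgn j • (x i * (dk j * b i j)) = 0 := by
    rw [Finset.sum_comm]
    simp only [← Finset.smul_sum, h₁, smul_zero, Finset.sum_const_zero]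
  have f₉ : ∑ i, ∑ j, sgn i • (x j * (dk i * b i j)) = 0 := by
    have h₂ : ∀ i, ∑ j, x j * (dk i * b i j) = -∑ j, x j * (dk i * b j i) := fun i => by
      rw [← Finset.sum_neg_distrib]
      exact Finset.sum_congr rfl fun j _ => by rw [hb i j, mul_neg, mul_neg]
    simp only [← Finset.smul_sum, h₂, h₁, neg_zero, smul_zero, Finset.sum_const_zero]
  have f₀ : ∑ i, x i * (dl * g i) = 0 := by
    rw [← mul_zero dl, ← hxg, Finset.mul_sum]
    exact Finset.sum_congr rfl fun i _ => by rw [← mul_assoc, ← cdl, mul_assoc]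
  simp only [mul_add, mul_sub, add_mul, sub_mul, Finset.mul_sum, Finset.sum_mul, Finset.smul_sum,
    smul_add, smul_sub, smul_mul_assoc, mul_smul_comm, mul_assoc, crd, cxd, e₁, e₂,
    Finset.sum_add_distrib, Finset.sum_sub_distrib]
  simp only [← Finset.smul_sum (r := (2 : ℝ))]
  linear_combination (norm := module) f₁ + f₂ - f₃ + f₄ + f₅ - (2 : ℝ) • f₆ + f₈ - f₉
    - (2 : ℝ) • f₇ - (2 : ℝ) • f₀

end Ring

theorem form_preD_rho_mul (a b : Fin 4) (u : Forms) :
    form (preD (rho a b)) * u = u * form (preD (rho a b)) :=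
  form_commute (preD_mem (rho_mem a b)) even_two u

theorem form_preD_xi_mul (a : Fin 4) (u : Forms) :
    form (preD (xi a)) * u = u * form (preD (xi a)) :=
  form_commute (preD_mem (xi_mem a)) even_two u

theorem form_preD_kappa_mul (b : Fin 4) (u : Forms) :
    form (preD (kappa b)) * u = u * form (preD (kappa b)) :=
  form_commute (preD_mem (kappa_mem b)) even_two u

theorem form_preD_lam_mul (u : Forms) : form (preD lam) * u = u * form (preD lam) :=
  form_commute (preD_mem lam_mem) even_two u

theorem form_preD_preHamiltonian : form (preD preHamiltonian)
    = (∑ a, ∑ b, (sgn a * sgn b) •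
        ((form (preD (preLie (rho a b))) - (1 / 2 : ℝ) • form (preD (weylCurv a b)))
            * form (weylContr dualXiXi a b)
          + (form (preLie (rho a b)) - (1 / 2 : ℝ) • form (weylCurv a b))
            * form (preD (weylContr dualXiXi a b))))
      - (2 : ℝ) • ∑ a, (form (preD (preLie (xi a))) * form (cottonContr dualXiXi a)
          + form (preLie (xi a)) * form (preD (cottonContr dualXiXi a))) := by
  have h₁ : ∀ a b, parity (preLie (rho a b)) = preLie (rho a b) := fun a b => by
    simpa using parity_of_mem (preLie_mem (rho_mem a b))
  have h₂ : ∀ a, parity (preLie (xi a)) = preLie (xi a) := fun a => by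
    simpa using parity_of_mem (preLie_mem (xi_mem a))
  have h₃ : ∀ a b, parity (weylCurv a b) = weylCurv a b := fun a b => by
    simpa using parity_of_mem (weylCurv_mem a b)
  simp only [preHamiltonian, map_sub, map_sum, map_smul, preD_mul, map_add, map_mul, h₁, h₂, h₃]

/-- `i_q ω = dℒ`: the terms without curvature cancel by `hamiltonian_identity`, those with curvature
by `sum_preD_weylCurv`. -/
theorem contrQ_omega : contrQ omega = d hamiltonian := by
  have hc := sum_preD_weylCurv
  have h := hamiltonian_identity (r := fun a b => form (rho a b))
    (dr := fun a b => form (preD (rho a b))) (b := fun a b => form (weylContr dualXiXi a b))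
    (x := fun a => form (xi a)) (dx := fun a => form (preD (xi a)))
    (k := fun a => form (kappa a)) (dk := fun a => form (preD (kappa a)))
    (g := fun a => form (cottonContr dualXiXi a)) (l := form lam) (dl := form (preD lam))
    form_rho_antisymm
    (fun a b => by
      have := congrArg d (form_rho_antisymm a b)
      simpa only [map_neg, d_form] using this)
    (form_weylContr_antisymm dualXiXi) form_preD_rho_mul form_preD_xi_mul sum_xi_mul_weylContr
    sum_xi_mul_cottonContr form_preD_kappa_mul form_preD_lam_mul
  have hρ : ∀ a b, (∑ c, sgn c • (form (preD (rho a c)) * form (rho c b)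
        - form (rho a c) * form (preD (rho c b))))
      + (sgn a • (form (preD (xi a)) * form (kappa b) - form (xi a) * form (preD (kappa b)))
        - sgn b • (form (preD (xi b)) * form (kappa a) - form (xi b) * form (preD (kappa a))))
      = form (preD (preLie (rho a b))) - form (preD (weylCurv a b)) := by
    intro a b
    simp only [preLie_rho, map_add, map_sub, map_sum, map_smul, preD_mul, parity_rho, parity_xi,
      map_mul, neg_mul, ← sub_eq_add_neg, add_sub_cancel_right]
  have hξ : ∀ a, (∑ c, sgn a • (form (preD (rho a c)) * form (xi c)
        - form (rho a c) * form (preD (xi c))))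
      + (form (preD (xi a)) * form lam - form (xi a) * form (preD lam))
      = form (preD (preLie (xi a))) := by
    intro a
    simp only [preLie_xi, map_add, map_sub, map_sum, map_smul, preD_mul, parity_rho, parity_xi,
      map_mul, neg_mul, ← sub_eq_add_neg]
  have hB : ∀ a b, (∑ c, sgn c • (form (rho a c) * form (weylContr dualXiXi c b)
        + form (rho b c) * form (weylContr dualXiXi a c)))
      + (sgn a • (form (xi a) * form (cottonContr dualXiXi b))
        - sgn b • (form (xi b) * form (cottonContr dualXiXi a)))
      = form (preLie (weylContr dualXiXi a b)) := by
    intro a b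
    rw [form_preLie_weylContr transformsLikeXiXi_dualXiXi, sum_xi_mul_dW]
  have hG : ∀ a, (∑ c, sgn c • (form (rho a c) * form (cottonContr dualXiXi c)))
      + form lam * form (cottonContr dualXiXi a)
      + ∑ j, sgn j • (form (kappa j) * form (weylContr dualXiXi j a))
      = form (preLie (cottonContr dualXiXi a)) := by
    intro a
    rw [form_preLie_cottonContr transformsLikeXiXi_dualXiXi, sum_xi_mul_dC, add_zero]
  simp only [hρ, hξ, hB, hG] at h
  rw [omega_eq, hamiltonian_eq, contrQ_form_preOmega, d_form, form_preD_preHamiltonian]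
  simp only [sub_mul, smul_sub, smul_add, smul_mul_assoc, smul_comm _ (1 / 2 : ℝ),
    Finset.sum_add_distrib, Finset.sum_sub_distrib] at h hc ⊢
  simp only [← Finset.smul_sum (r := (1 / 2 : ℝ))]
  linear_combination (norm := module) h - (1 / 2 : ℝ) • hc

/-- As `ω` is closed and `i_q ω` is exact, `L_q ω` vanishes. -/
theorem lieQ_omega : lieQ omega = 0 := by
  change contrQ (d omega) - d (contrQ omega) = 0
  rw [d_omega, map_zero, contrQ_omega, d_d, sub_zero]

end ConformalGravity

end

open ConformalGravity in
theorem mainTheorem1 :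
    -- `q` is a homological vector field of ghost degree one on `F`
    (∀ (p g : ℕ) (z : Forms), z ∈ bidegree p g → lieQ z ∈ bidegree p (g + 1)) ∧
    (∀ z : Forms, lieQ (lieQ z) = 0) ∧
    -- `ω` is a closed two-form of ghost degree `n - 1 = 3`, invariant under `q`
    omega ∈ bidegree 2 3 ∧
    d omega = 0 ∧
    lieQ omega = 0 ∧
    -- with the Hamiltonian `ℒ`
    contrQ omega = d hamiltonian := by
  exact ⟨fun _ _ _ => lieQ_mem_bidegree, lieQ_lieQ, omega_mem, d_omega, lieQ_omega, contrQ_omega⟩
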